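/- Let $n\ge 1$, let $\Omega\subset\mathbb R^n$ be a bounded open set with $C^\infty$ boundary, and let $\rho_1,\rho_2>0$, $a_{11}>0$, $a_{11}a_{22}-a_{12}^2>0$, $\kappa\ge 0$, $0<\alpha<1$, $\eta\ge 0$. Put $\mathfrak C=\pi^{-1}\sin(\alpha\pi)$ and $\mu(\xi)=|\xi|^{(2\alpha-1)/2}$. Consider, for real-valued $u,v$ on $\Omega\times(0,\infty)$ and $\varphi_1,\varphi_2$ on $\Omega\times(0,\infty)\times\mathbb R$, the augmented system $$\begin{cases}\rho_1u_{tt}-a_{11}\Delta u-a_{12}\Delta v+\kappa(u-v)+\mathfrak C\int_{\mathbb R}\mu(\xi)\varphi_1\,d\xi=0,\\ \rho_2v_{tt}-a_{12}\Delta u-a_{22}\Delta v-\kappa(u-v)+\mathfrak C\int_{\mathbb R}\mu(\xi)\varphi_2\,d\xi=0,\\ \varphi_{1t}+(\xi^2+\eta)\varphi_1=\mu(\xi)u_t,\qquad \varphi_{2t}+(\xi^2+\eta)\varphi_2=\mu(\xi)v_t,\\ u=v=0\ \text{ on }\partial\Omega,\end{cases}$$ with prescribed initial values of $(u,v,u_t,v_t,\varphi_1,\varphi_2)$.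 Let $$\mathcal H=[H^1_0(\Omega)]^2\times[L^2(\Omega)]^2\times[L^2(\mathbb R;L^2(\Omega))]^2 ,$$ and for $\mathbb U=(u,v,U,V,\varphi_1,\varphi_2)\in\mathcal H$ let $$\mathcal A\,\mathbb U=\begin{pmatrix}U\\ V\\ \rho_1^{-1}\big[\Delta(a_{11}u+a_{12}v)-\kappa(u-v)-\mathfrak C\int_{\mathbb R}\mu\varphi_1\,d\xi\big]\\ \rho_2^{-1}\big[\Delta(a_{12}u+a_{22}v)+\kappa(u-v)-\mathfrak C\int_{\mathbb R}\mu\varphi_2\,d\xi\big]\\ -(\xi^2+\eta)\varphi_1+\mu(\xi)U\\ -(\xi^2+\eta)\varphi_2+\mu(\xi)V\end{pmatrix},$$ with domain $\mathcal D(\mathcal A)$ the set of $\mathbb U\in\mathcal H$ such that $U,V\in H^1_0(\Omega)$; $a_{11}u+a_{12}v$ and $a_{12}u+a_{22}v$ lie in $H^2(\Omega)$; the integrals $\int_{\mathbb R}\mu\varphi_j\,d\xi$ converge in $L^2(\Omega)$; and $\xi\varphi_1$, $\xi\varphi_2$, $-(\xi^2+\eta)\varphi_1+\mu U$, $-(\xi^2+\eta)\varphi_2+\mu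 V$ lie in $L^2(\mathbb R;L^2(\Omega))$. With $\mathbb U=(u,v,u_t,v_t,\varphi_1,\varphi_2)$ the system reads $\mathbb U'=\mathcal A\mathbb U$, $\mathbb U(0)=\mathbb U_0$. A (mild) solution in $C([0,\infty);\mathcal H)$ is a continuous $\mathbb U:[0,\infty)\to\mathcal H$ with $\int_0^t\mathbb U\,ds\in\mathcal D(\mathcal A)$ and $\mathbb U(t)=\mathbb U_0+\mathcal A\int_0^t\mathbb U(s)\,ds$ for all $t\ge0$. A (strong) solution is a $\mathbb U\in C([0,\infty);\mathcal D(\mathcal A))\cap C^1([0,\infty);\mathcal H)$ with $\mathbb U'=\mathcal A\mathbb U$ on $[0,\infty)$ and $\mathbb U(0)=\mathbb U_0$, where $\mathcal D(\mathcal A)$ carries the graph norm. The energy of $\mathbb U\in\mathcal H$ is $$E(\mathbb U)=\tfrac12\Big[\rho_1\|U\|^2+\rho_2\|V\|^2+\int_\Omega\big(a_{11}|\nabla u|^2+2a_{12}\nabla u\cdot\nabla v+a_{22}|\nabla v|^2\big)dx+\kappa\|u-v\|^2+\mathfrak C\|\varphi_1\|^2_{L^2(\mathbb R;L^2(\Omega))}+\mathfrak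 C\|\varphi_2\|^2_{L^2(\mathbb R;L^2(\Omega))}\Big],$$ where $\|\cdot\|$ is the norm of $L^2(\Omega)$, and we put $$D(\mathbb U)=\mathfrak C\int_{\mathbb R}(\xi^2+\eta)\|\varphi_1(\xi)\|^2\,d\xi+\mathfrak C\int_{\mathbb R}(\xi^2+\eta)\|\varphi_2(\xi)\|^2\,d\xi .$$ **Theorem (existence and uniqueness of solutions).** The system is well-posed in $\mathcal H$: 1. For every $\mathbb U_0\in\mathcal H$ (in particular for $\mathbb U_0=(u_0,v_0,u_1,v_1,0,0)$) there is a unique mild solution $\mathbb U\in C([0,\infty);\mathcal H)$. 2. For every $\mathbb U_0\in\mathcal D(\mathcal A)$ there is a unique strong solution $\mathbb U\in C([0,\infty);\mathcal D(\mathcal A))\cap C^1([0,\infty);\mathcal H)$. Every strong solution is a mild solution. 3. If $\mathbb U,\mathbb W$ are mild solutions with initial data $\mathbb U_0,\mathbb W_0$, then $E(\mathbb U(t)-\mathbb W(t))\le E(\mathbb U_0-\mathbb W_0)$ for all $t\ge0$. 4. For every strong solution and every $t\ge0$, the integrals in $D(\mathbb U(t))$ are finite and $$\frac{d}{dt}E(\mathbb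 U(t))=-D(\mathbb U(t))=-\mathfrak C\int_{\mathbb R}(\xi^2+\eta)\big(\|\varphi_1(t,\xi)\|^2+\|\varphi_2(t,\xi)\|^2\big)\,d\xi$$ (one-sided derivative at $t=0$). For every mild solution the same law holds in integrated form: the integrals in $D(\mathbb U(s))$ are finite for almost every $s\ge0$, $s\mapsto D(\mathbb U(s))$ is integrable on $[0,t]$, and $E(\mathbb U(t))=E(\mathbb U_0)-\int_0^tD(\mathbb U(s))\,ds$ for all $t\ge 0$. -/

import Mathlib

open MeasureTheory Set
open scoped ContDiff

noncomputable section

namespace MixtureSystem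

/-- The Euclidean space `ℝⁿ`. -/
abbrev Space (n : ℕ) : Type := EuclideanSpace ℝ (Fin n)

/-- A bounded open subset of `ℝⁿ` with `C^∞` boundary: near each boundary point a smooth
diffeomorphism straightens `Ω` to the half space `{y | 0 < y₀}`. -/
structure IsSmoothBoundedDomain {n : ℕ} [NeZero n] (Ω : Set (Space n)) : Prop where
  isOpen : IsOpen Ω
  isBounded : Bornology.IsBounded Ω
  smooth_boundary : ∀ x ∈ frontier Ω, ∃ e : OpenPartialHomeomorph (Space n) (Space n),
    x ∈ e.source ∧ ContDiffOn ℝ ∞ e e.source ∧ ContDiffOn ℝ ∞ e.symm e.target ∧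
      ∀ y ∈ e.source, (y ∈ Ω ↔ 0 < e y 0)

/-! ### Function spaces -/

/-- `L²(Ω)`, real valued. -/
abbrev L2 {n : ℕ} (Ω : Set (Space n)) : Type := Lp ℝ 2 (volume.restrict Ω)

/-- The Bochner space `L²(ℝ; L²(Ω))`. -/
abbrev L2L2 {n : ℕ} (Ω : Set (Space n)) : Type := Lp (L2 Ω) 2 (volume : Measure ℝ)

/-- Test functions, `C_c^∞(Ω)`. -/
def IsTest {n : ℕ} (Ω : Set (Space n)) (f : Space n → ℝ) : Prop :=
  ContDiff ℝ ∞ f ∧ HasCompactSupport f ∧ tsupport f ⊆ Ω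

/-- The classical partial derivative in the `i`-th coordinate direction. -/
def pderiv {n : ℕ} (i : Fin n) (f : Space n → ℝ) (x : Space n) : ℝ :=
  fderiv ℝ f x (EuclideanSpace.single i 1)

/-- `g` is the weak partial derivative `∂ᵢ u` in `Ω`. -/
def HasWeakDeriv {n : ℕ} {Ω : Set (Space n)} (i : Fin n) (u g : L2 Ω) : Prop :=
  ∀ f : Space n → ℝ, IsTest Ω f →
    ∫ x in Ω, u x * pderiv i f x = - ∫ x in Ω, g x * f x

open Classical in
/-- The weak partial derivative `∂ᵢ u` (zero if there is none in `L²(Ω)`). -/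
def weakDeriv {n : ℕ} {Ω : Set (Space n)} (i : Fin n) (u : L2 Ω) : L2 Ω :=
  if h : ∃ g, HasWeakDeriv i u g then h.choose else 0

/-- `z ∈ H²(Ω)`. -/
def MemH2 {n : ℕ} {Ω : Set (Space n)} (z : L2 Ω) : Prop :=
  (∀ i, ∃ g : L2 Ω, HasWeakDeriv i z g) ∧
    ∀ i j, ∃ h : L2 Ω, HasWeakDeriv j (weakDeriv i z) h

/-- The Laplacian of `z ∈ H²(Ω)`. -/
def laplacian {n : ℕ} {Ω : Set (Space n)} (z : L2 Ω) : L2 Ω :=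
  ∑ i, weakDeriv i (weakDeriv i z)

/-- The pairs `(f, ∇f)` with `f ∈ C_c^∞(Ω)`, inside `L²(Ω) × L²(Ω)ⁿ`. -/
def testPairs {n : ℕ} (Ω : Set (Space n)) : Submodule ℝ (L2 Ω × (Fin n → L2 Ω)) where
  carrier := {w | ∃ f : Space n → ℝ, IsTest Ω f ∧ w.1 =ᵐ[volume.restrict Ω] f ∧
    ∀ i, w.2 i =ᵐ[volume.restrict Ω] pderiv i f}
  zero_mem' := by
    refine ⟨fun _ => 0, ⟨contDiff_const, HasCompactSupport.zero, by simp [tsupport]⟩,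
      Lp.coeFn_zero _ _ _, fun i => ?_⟩
    filter_upwards [Lp.coeFn_zero ℝ 2 (volume.restrict Ω)] with x hx
    simpa [pderiv] using hx
  add_mem' := by
    rintro w z ⟨f, ⟨hf, hfc, hfs⟩, h1, h2⟩ ⟨g, ⟨hg, hgc, hgs⟩, k1, k2⟩
    refine ⟨f + g, ⟨hf.add hg, hfc.add hgc,
      (tsupport_add f g).trans (union_subset hfs hgs)⟩, ?_, fun i => ?_⟩
    · filter_upwards [Lp.coeFn_add w.1 z.1, h1, k1] with x hx hx1 hx2
      exact hx.trans (by simp [hx1, hx2])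
    · filter_upwards [Lp.coeFn_add (w.2 i) (z.2 i), h2 i, k2 i] with x hx hx1 hx2
      have e : fderiv ℝ (f + g) x = fderiv ℝ f x + fderiv ℝ g x :=
        fderiv_add (hf.differentiable (by simp) x) (hg.differentiable (by simp) x)
      exact hx.trans (by simp [hx1, hx2, pderiv, e])
  smul_mem' := by
    rintro c w ⟨f, ⟨hf, hfc, hfs⟩, h1, h2⟩
    refine ⟨c • f, ⟨hf.const_smul c, hfc.mono (Function.support_const_smul_subset c f),
      (closure_mono (Function.support_const_smul_subset c f)).trans hfs⟩, ?_, fun i => ?_⟩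
    · filter_upwards [Lp.coeFn_smul c w.1, h1] with x hx hx1
      simp [hx, hx1]
    · filter_upwards [Lp.coeFn_smul c (w.2 i), h2 i] with x hx hx1
      have e : fderiv ℝ (c • f) x = c • fderiv ℝ f x :=
        fderiv_const_smul (hf.differentiable (by simp) x) c
      simp [hx, hx1, pderiv, e]

/-- `H¹₀(Ω)`, the closure of `C_c^∞(Ω)` in the `H¹` topology. An element is a pair `(u, ∇u)` in
`L²(Ω) × L²(Ω)ⁿ`, and the topology is that of the `H¹` norm. -/
abbrev H10 {n : ℕ} (Ω : Set (Space n)) : Type := (testPairs Ω).topologicalClosure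

/-- The function `u ∈ L²(Ω)` underlying an element of `H¹₀(Ω)`. -/
def H10.fn {n : ℕ} {Ω : Set (Space n)} (u : H10 Ω) : L2 Ω := u.1.1

/-- The components of the gradient of an element of `H¹₀(Ω)`. -/
def H10.grad {n : ℕ} {Ω : Set (Space n)} (u : H10 Ω) (i : Fin n) : L2 Ω := u.1.2 i

/-- `U ∈ L²(Ω)` lies in `H¹₀(Ω)`. -/
def MemH10 {n : ℕ} {Ω : Set (Space n)} (U : L2 Ω) : Prop := ∃ w : H10 Ω, w.fn = U

open Classical in
/-- `U ∈ L²(Ω)` regarded as an element of `H¹₀(Ω)` (zero if it is not one). -/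
def toH10 {n : ℕ} {Ω : Set (Space n)} (U : L2 Ω) : H10 Ω :=
  if h : MemH10 U then h.choose else 0

/-- The phase space `H¹₀(Ω)² × L²(Ω)² × L²(ℝ; L²(Ω))²`, with vectors `(u, v, U, V, φ₁, φ₂)`. -/
abbrev Phase {n : ℕ} (Ω : Set (Space n)) : Type :=
  H10 Ω × H10 Ω × L2 Ω × L2 Ω × L2L2 Ω × L2L2 Ω

namespace Phase

variable {n : ℕ} {Ω : Set (Space n)}

/-- First component, `u`. -/
abbrev u (W : Phase Ω) : H10 Ω := W.1
/-- Second component, `v`. -/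
abbrev v (W : Phase Ω) : H10 Ω := W.2.1
/-- Third component, `U`. -/
abbrev U (W : Phase Ω) : L2 Ω := W.2.2.1
/-- Fourth component, `V`. -/
abbrev V (W : Phase Ω) : L2 Ω := W.2.2.2.1
/-- Fifth component, `φ₁`. -/
abbrev φ₁ (W : Phase Ω) : L2L2 Ω := W.2.2.2.2.1
/-- Sixth component, `φ₂`. -/
abbrev φ₂ (W : Phase Ω) : L2L2 Ω := W.2.2.2.2.2

end Phase

/-! ### The system -/

/-- The coefficients: densities `ρ₁, ρ₂`, the symmetric matrix `(aᵢⱼ)`, the coupling constant `κ`,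
and the order `α` and exponential weight `η` of the fractional derivative. -/
structure Coeffs where
  (ρ₁ ρ₂ a₁₁ a₁₂ a₂₂ κ α η : ℝ)

/-- The standing assumptions on the coefficients. -/
structure Coeffs.Admissible (p : Coeffs) : Prop where
  ρ₁_pos : 0 < p.ρ₁
  ρ₂_pos : 0 < p.ρ₂
  a₁₁_pos : 0 < p.a₁₁
  det_pos : 0 < p.a₁₁ * p.a₂₂ - p.a₁₂ ^ 2
  κ_nonneg : 0 ≤ p.κ
  α_pos : 0 < p.α
  α_lt_one : p.α < 1
  η_nonneg : 0 ≤ p.η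

/-- `𝔠 = π⁻¹ sin(απ)`. -/
def Coeffs.c (p : Coeffs) : ℝ := Real.pi⁻¹ * Real.sin (p.α * Real.pi)

/-- `μ(ξ) = |ξ|^((2α - 1)/2)`. -/
def Coeffs.μ (p : Coeffs) (ξ : ℝ) : ℝ := |ξ| ^ ((2 * p.α - 1) / 2)

section System

variable {n : ℕ} {Ω : Set (Space n)}

/-- The function `ξ ↦ -(ξ² + η) φ(ξ) + μ(ξ) U`. -/
def Coeffs.diffusion (p : Coeffs) (φ : L2L2 Ω) (U : L2 Ω) (ξ : ℝ) : L2 Ω :=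
  -((ξ ^ 2 + p.η) • φ ξ) + p.μ ξ • U

open Classical in
/-- The same function as an element of `L²(ℝ; L²(Ω))` (zero if it is not one). -/
def Coeffs.diffusionLp (p : Coeffs) (φ : L2L2 Ω) (U : L2 Ω) : L2L2 Ω :=
  if h : MemLp (p.diffusion φ U) 2 volume then h.toLp _ else 0

/-- The domain of the operator. -/
structure Coeffs.MemDomain (p : Coeffs) (W : Phase Ω) : Prop where
  memH10_U : MemH10 W.U
  memH10_V : MemH10 W.V
  memH2₁ : MemH2 (p.a₁₁ • W.u.fn + p.a₁₂ • W.v.fn)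
  memH2₂ : MemH2 (p.a₁₂ • W.u.fn + p.a₂₂ • W.v.fn)
  integrable₁ : Integrable (fun ξ : ℝ => p.μ ξ • W.φ₁ ξ)
  integrable₂ : Integrable (fun ξ : ℝ => p.μ ξ • W.φ₂ ξ)
  memLp_mul₁ : MemLp (fun ξ : ℝ => ξ • W.φ₁ ξ) 2 volume
  memLp_mul₂ : MemLp (fun ξ : ℝ => ξ • W.φ₂ ξ) 2 volume
  memLp_diffusion₁ : MemLp (p.diffusion W.φ₁ W.U) 2 volume
  memLp_diffusion₂ : MemLp (p.diffusion W.φ₂ W.V) 2 volume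

/-- The operator (meaningful on its domain). -/
def Coeffs.op (p : Coeffs) (W : Phase Ω) : Phase Ω :=
  (toH10 W.U,
   toH10 W.V,
   p.ρ₁⁻¹ • (laplacian (p.a₁₁ • W.u.fn + p.a₁₂ • W.v.fn) - p.κ • (W.u.fn - W.v.fn)
      - p.c • ∫ ξ : ℝ, p.μ ξ • W.φ₁ ξ),
   p.ρ₂⁻¹ • (laplacian (p.a₁₂ • W.u.fn + p.a₂₂ • W.v.fn) + p.κ • (W.u.fn - W.v.fn)
      - p.c • ∫ ξ : ℝ, p.μ ξ • W.φ₂ ξ),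
   p.diffusionLp W.φ₁ W.U,
   p.diffusionLp W.φ₂ W.V)

/-- The energy of a state. -/
def Coeffs.energy (p : Coeffs) (W : Phase Ω) : ℝ :=
  1 / 2 * (p.ρ₁ * ‖W.U‖ ^ 2 + p.ρ₂ * ‖W.V‖ ^ 2
    + ∑ i, (p.a₁₁ * ‖W.u.grad i‖ ^ 2 + 2 * p.a₁₂ * inner ℝ (W.u.grad i) (W.v.grad i)
        + p.a₂₂ * ‖W.v.grad i‖ ^ 2)
    + p.κ * ‖W.u.fn - W.v.fn‖ ^ 2
    + p.c * ‖W.φ₁‖ ^ 2 + p.c * ‖W.φ₂‖ ^ 2)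

/-- The integrals `∫ (ξ² + η) ‖φᵢ(ξ)‖² dξ` are finite. -/
def Coeffs.FiniteDissipation (p : Coeffs) (W : Phase Ω) : Prop :=
  Integrable (fun ξ : ℝ => (ξ ^ 2 + p.η) * ‖W.φ₁ ξ‖ ^ 2) ∧
    Integrable (fun ξ : ℝ => (ξ ^ 2 + p.η) * ‖W.φ₂ ξ‖ ^ 2)

/-- `𝔠 ∫ (ξ² + η) ‖φ₁(ξ)‖² dξ + 𝔠 ∫ (ξ² + η) ‖φ₂(ξ)‖² dξ`. -/
def Coeffs.dissipation (p : Coeffs) (W : Phase Ω) : ℝ :=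
  p.c * (∫ ξ : ℝ, (ξ ^ 2 + p.η) * ‖W.φ₁ ξ‖ ^ 2)
    + p.c * ∫ ξ : ℝ, (ξ ^ 2 + p.η) * ‖W.φ₂ ξ‖ ^ 2

/-- A (mild) solution in `C([0,∞); ℋ)` with initial state `W₀`: the evolution equation holds
in integrated form, `W(t) = W₀ + 𝒜 ∫₀ᵗ W(s) ds`. Only the values at `t ≥ 0` matter. -/
structure Coeffs.IsMildSolution (p : Coeffs) (W₀ : Phase Ω) (W : ℝ → Phase Ω) : Prop where
  continuousOn : ContinuousOn W (Ici 0)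
  integral_mem : ∀ t : ℝ, 0 ≤ t → p.MemDomain (∫ s in (0 : ℝ)..t, W s)
  eq_add : ∀ t : ℝ, 0 ≤ t → W t = W₀ + p.op (∫ s in (0 : ℝ)..t, W s)

/-- A (strong) solution in `C([0,∞); 𝒟(𝒜)) ∩ C¹([0,∞); ℋ)` with initial state `W₀`, where
`𝒟(𝒜)` carries the graph norm; the derivative at `t = 0` is one-sided. -/
structure Coeffs.IsStrongSolution (p : Coeffs) (W₀ : Phase Ω) (W : ℝ → Phase Ω) : Prop where
  initial : W 0 = W₀
  mem : ∀ t : ℝ, 0 ≤ t → p.MemDomain (W t)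
  continuousOn : ContinuousOn W (Ici 0)
  continuousOn_op : ContinuousOn (fun t => p.op (W t)) (Ici 0)
  hasDeriv : ∀ t : ℝ, 0 ≤ t → HasDerivWithinAt W (p.op (W t)) (Ici 0) t

end System

end MixtureSystem

end

noncomputable section

namespace MixtureSystem

open Filter Topology

/-! ### Maximal dissipative operators -/

section Dissipative

variable {X : Type*} [NormedAddCommGroup X] [NormedSpace ℝ X]

/-! The system is a linear evolution equation for a maximal dissipative operator. Twice the energy
is a bounded symmetric form `B` on the phase space. It is coercive by Poincaré's inequality and the
positive definiteness of the matrix of the coefficients, so it is an equivalent Hilbert structure.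

Dissipativity is an exact identity (`Coeffs.Admissible.energyForm_op`): pairing the operator with
the state, Green's formula cancels the elastic terms, the coupling terms cancel, and the memory
integrals cancel against the source terms of the diffusive variables. Only minus the dissipation is
left.

Surjectivity of `r - A` for every `r > 0` (`Coeffs.Admissible.exists_op_eq`) is an elimination. The
diffusive equations are solved pointwise in `ξ`, which turns each memory integral into an affine
function of the velocity with a nonnegative slope; that slope is finite because `0 < α < 1`. The
velocities are then expressed through `u` and `v`, and a coercive elliptic system remains, solved by
Riesz representation. Each of the two combinations in the domain solves a scalar Poisson equation
weakly, so the `H²` condition reduces to regularity for the Dirichlet Laplacian (`IsWeakSol.memH2`).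

That regularity comes from difference quotients along families of diffeomorphisms of `ℝⁿ` that
preserve `Ω` (`TangentFlow`). They map test functions to test functions and nearly preserve the
Dirichlet form, so tangential derivatives of the weak gradient are in `L²` without rewriting the
equation in charts. The one second derivative transversal to the boundary is recovered from the
equation itself, and a partition of unity makes the estimate global.

The abstract theory then gives the solutions. The Yosida approximations generate exponentials that
converge on the domain to strong solutions (`IsMaxDissipative.exists_isStrong`); density and
contractivity give mild ones (`IsMaxDissipative.exists_isMild`). The maps `Jₖ` turn a mild solution
into strong solutions converging to it, which yields contraction and uniqueness. For the energy law,
the dissipation extends to a lower semicontinuous function with values in `[0, ∞]`: Fatou's lemma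
gives one inequality along `Jₖ W → W`, and applying that inequality to `Jₖ W - W` gives the other
(`IsMaxDissipative.lintegral_dissipation`). -/

/-- A bounded symmetric coercive bilinear form; its square root is an equivalent Hilbert norm. -/
structure IsEnergyForm (B : X →L[ℝ] X →L[ℝ] ℝ) : Prop where
  symm : ∀ x y, B x y = B y x
  coercive : ∃ c : ℝ, 0 < c ∧ ∀ x, c * ‖x‖ ^ 2 ≤ B x x

namespace IsEnergyForm

variable {B : X →L[ℝ] X →L[ℝ] ℝ}

theorem nonneg (hB : IsEnergyForm B) (x : X) : 0 ≤ B x x := by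
  obtain ⟨c, hc, h⟩ := hB.coercive
  exact le_trans (by positivity) (h x)

theorem eq_zero (hB : IsEnergyForm B) {x : X} (hx : B x x ≤ 0) : x = 0 := by
  obtain ⟨c, hc, h⟩ := hB.coercive
  have h1 : ‖x‖ ^ 2 ≤ 0 := by
    by_contra! h2
    nlinarith [h x, mul_pos hc h2]
  exact norm_eq_zero.1 (pow_eq_zero_iff two_ne_zero |>.1 (le_antisymm h1 (sq_nonneg _)))

/-- The phase space carries a sup norm of products, not the energy norm; contraction estimates for
`B` reach its topology through this constant. -/
theorem exists_norm_le (hB : IsEnergyForm B) :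
    ∃ M : ℝ, 0 ≤ M ∧ ∀ x y, B y y ≤ B x x → ‖y‖ ≤ M * ‖x‖ := by
  obtain ⟨c, hc, h⟩ := hB.coercive
  refine ⟨√(‖B‖ / c), by positivity, fun x y hxy => ?_⟩
  have h1 : B x x ≤ ‖B‖ * ‖x‖ * ‖x‖ := (Real.le_norm_self _).trans (B.le_opNorm₂ x x)
  have h2 : ‖y‖ ^ 2 ≤ ‖B‖ / c * ‖x‖ ^ 2 := by
    rw [div_mul_eq_mul_div, le_div_iff₀ hc]
    nlinarith [h y]
  calc ‖y‖ = √(‖y‖ ^ 2) := (Real.sqrt_sq (norm_nonneg _)).symm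
    _ ≤ √(‖B‖ / c * ‖x‖ ^ 2) := Real.sqrt_le_sqrt h2
    _ = _ := by rw [Real.sqrt_mul (by positivity), Real.sqrt_sq (norm_nonneg _)]

theorem form_sub (hB : IsEnergyForm B) (x y : X) :
    B (x - y) (x - y) = B x x - 2 * B x y + B y y := by
  simp only [map_sub, _root_.sub_apply, hB.symm y x]; ring

theorem form_add (hB : IsEnergyForm B) (x y : X) :
    B (x + y) (x + y) = B x x + 2 * B x y + B y y := by
  simp only [map_add, _root_.add_apply, hB.symm y x]; ring

/-- Every bounded functional is represented by an energy form. -/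
theorem exists_repr [CompleteSpace X] (hB : IsEnergyForm B) (l : X →L[ℝ] ℝ) :
    ∃ x, ∀ y, B x y = l y := by
  obtain ⟨c, hc, hco⟩ := hB.coercive
  -- Direct method: the representing vector is the minimiser of this quadratic functional.
  let J : X → ℝ := fun x => B x x - 2 * l x
  have hJc : Continuous J := by fun_prop
  have hlow : ∀ x, -(‖l‖ ^ 2 / c) ≤ J x := fun x => by
    have h1 : l x ≤ ‖l‖ * ‖x‖ := (Real.le_norm_self _).trans (l.le_opNorm x)
    have h2 : 0 ≤ c * (‖x‖ - ‖l‖ / c) ^ 2 := by positivity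
    have h3 : c * (‖x‖ - ‖l‖ / c) ^ 2 = c * ‖x‖ ^ 2 - 2 * (‖l‖ * ‖x‖) + ‖l‖ ^ 2 / c := by
      field_simp; ring
    change _ ≤ B x x - 2 * l x
    linarith [hco x]
  have hbdd : BddBelow (range J) := ⟨_, by rintro _ ⟨x, rfl⟩; exact hlow x⟩
  set m := sInf (range J) with hm
  have hmle : ∀ x, m ≤ J x := fun x => csInf_le hbdd ⟨x, rfl⟩
  have hex : ∀ k : ℕ, ∃ x, J x < m + 1 / ((k : ℝ) + 1) := fun k => by
    obtain ⟨_, ⟨x, rfl⟩, hx⟩ := exists_lt_of_csInf_lt (range_nonempty J)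
      (show m < m + 1 / ((k : ℝ) + 1) from lt_add_of_pos_right _ (by positivity))
    exact ⟨x, hx⟩
  choose s hs using hex
  -- Parallelogram law: the midpoint has value at least `m`, so two near minimisers are close by
  -- coercivity.
  have hpar : ∀ x y, c * ‖x - y‖ ^ 2 ≤ 2 * (J x + J y - 2 * m) := fun x y => by
    have h1 := hmle ((1 / 2 : ℝ) • (x + y))
    have h2 := hco (x - y)
    have h3 : J ((1 / 2 : ℝ) • (x + y)) = (1 / 4) * B (x + y) (x + y) - (l x + l y) := by
      simp only [J, map_smul, _root_.smul_apply, smul_eq_mul, map_add]; ring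
    rw [hB.form_sub] at h2
    rw [h3, hB.form_add] at h1
    simp only [J]
    linarith
  have hcau : CauchySeq s := by
    refine cauchySeq_of_le_tendsto_0 (fun N : ℕ => √(4 / c * (1 / ((N : ℝ) + 1)))) ?_ ?_
    · intro i j N hi hj
      rw [dist_eq_norm]
      refine Real.le_sqrt_of_sq_le ?_
      have h1 : 1 / ((i : ℝ) + 1) ≤ 1 / ((N : ℝ) + 1) :=
        one_div_le_one_div_of_le (by positivity) (by exact_mod_cast Nat.succ_le_succ hi)
      have h2 : 1 / ((j : ℝ) + 1) ≤ 1 / ((N : ℝ) + 1) :=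
        one_div_le_one_div_of_le (by positivity) (by exact_mod_cast Nat.succ_le_succ hj)
      rw [div_mul_eq_mul_div, le_div_iff₀ hc]
      linarith [hpar (s i) (s j), hs i, hs j]
    · have h1 := (tendsto_one_div_add_atTop_nhds_zero_nat (𝕜 := ℝ)).const_mul (4 / c)
      simpa using h1.sqrt
  obtain ⟨x, hx⟩ := cauchySeq_tendsto_of_complete hcau
  have hJx : J x = m := by
    refine le_antisymm ?_ (hmle x)
    refine le_of_tendsto_of_tendsto ((hJc.tendsto x).comp hx)
      (show Tendsto (fun k : ℕ => m + 1 / ((k : ℝ) + 1)) atTop (𝓝 m) by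
        simpa using (tendsto_one_div_add_atTop_nhds_zero_nat (𝕜 := ℝ)).const_add m)
      (Eventually.of_forall fun k => (hs k).le)
  refine ⟨x, fun y => ?_⟩
  -- Minimality along the line through `x` in direction `y`. A nonnegative quadratic without
  -- constant term has discriminant at most zero, which kills its linear coefficient.
  have hq : ∀ t : ℝ, 0 ≤ B y y * (t * t) + 2 * (B x y - l y) * t + 0 := fun t => by
    have h1 := hmle (x + t • y)
    have h2 : J (x + t • y) = J x + (B y y * (t * t) + 2 * (B x y - l y) * t) := by
      simp only [J, map_add, map_smul, _root_.add_apply,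
        _root_.smul_apply, smul_eq_mul, hB.symm y x]
      ring
    linarith
  have h3 := discrim_le_zero hq
  simp only [discrim, mul_zero, sub_zero] at h3
  nlinarith [pow_eq_zero_iff (two_ne_zero) |>.1 (le_antisymm h3 (sq_nonneg _))]

end IsEnergyForm

/-- `A` is linear on `D`, dissipative for the form `B`, and `r - A` maps `D` onto `X` for each
`r > 0`. -/
structure IsMaxDissipative (B : X →L[ℝ] X →L[ℝ] ℝ) (D : Submodule ℝ X) (A : X → X) : Prop where
  map_add : ∀ x ∈ D, ∀ y ∈ D, A (x + y) = A x + A y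
  map_smul : ∀ (r : ℝ), ∀ x ∈ D, A (r • x) = r • A x
  form_nonpos : ∀ x ∈ D, B (A x) x ≤ 0
  range_eq : ∀ r : ℝ, 0 < r → ∀ f, ∃ x ∈ D, r • x - A x = f

/-- Mild solutions of `W' = A W`. -/
structure IsMild (D : Submodule ℝ X) (A : X → X) (x₀ : X) (W : ℝ → X) : Prop where
  continuousOn : ContinuousOn W (Ici 0)
  integral_mem : ∀ t : ℝ, 0 ≤ t → ∫ s in (0 : ℝ)..t, W s ∈ D
  eq_add : ∀ t : ℝ, 0 ≤ t → W t = x₀ + A (∫ s in (0 : ℝ)..t, W s)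

/-- Strong solutions of `W' = A W`. -/
structure IsStrong (D : Submodule ℝ X) (A : X → X) (x₀ : X) (W : ℝ → X) : Prop where
  initial : W 0 = x₀
  mem : ∀ t : ℝ, 0 ≤ t → W t ∈ D
  continuousOn : ContinuousOn W (Ici 0)
  continuousOn_op : ContinuousOn (fun t => A (W t)) (Ici 0)
  hasDeriv : ∀ t : ℝ, 0 ≤ t → HasDerivWithinAt W (A (W t)) (Ici 0) t

/-- The derivative of `B (W t) (W t)` is `2 * B (W' t) (W t)`. Leaving `W'` free lets the estimate
serve both strong solutions and exponentials of bounded operators. -/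
theorem IsEnergyForm.form_le_of_hasDerivWithinAt {B : X →L[ℝ] X →L[ℝ] ℝ} (hB : IsEnergyForm B)
    {W W' : ℝ → X} (h : ∀ t, 0 ≤ t → HasDerivWithinAt W (W' t) (Ici 0) t)
    (h' : ∀ t, 0 ≤ t → B (W' t) (W t) ≤ 0) {t : ℝ} (ht : 0 ≤ t) :
    B (W t) (W t) ≤ B (W 0) (W 0) := by
  have hd : ∀ t, 0 ≤ t →
      HasDerivWithinAt (fun t => B (W t) (W t)) (2 * B (W' t) (W t)) (Ici 0) t := fun t ht => by
    have h1 := (B.hasFDerivAt.comp_hasDerivWithinAt t (h t ht)).clm_apply (h t ht)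
    refine h1.congr_deriv ?_
    simp [hB.symm (W t)]; ring
  refine antitoneOn_of_deriv_nonpos (convex_Ici 0) (fun t ht => (hd t ht).continuousWithinAt)
    (fun t ht => ?_) (fun t ht => ?_) (self_mem_Ici) ht ht
  · exact ((hd t (interior_subset ht)).mono interior_subset).differentiableWithinAt
  · rw [interior_Ici, mem_Ioi] at ht
    rw [((hd t ht.le).hasDerivAt (Ici_mem_nhds ht)).deriv]
    linarith [h' t ht.le]

namespace IsMaxDissipative

variable {B : X →L[ℝ] X →L[ℝ] ℝ} {D : Submodule ℝ X} {A : X → X}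

theorem map_sub (hA : IsMaxDissipative B D A) {x y : X} (hx : x ∈ D) (hy : y ∈ D) :
    A (x - y) = A x - A y := by
  have h := hA.map_smul (-1) y hy
  rw [neg_one_smul, neg_one_smul] at h
  rw [sub_eq_add_neg, hA.map_add x hx _ (D.neg_mem hy), h, sub_eq_add_neg]

/-- Expand the square on the right: the cross term `-2 r B (A x) x` and the term `B (A x) (A x)` are
both nonnegative. Injectivity of `r - A` and contractivity of its scaled inverse follow. -/
theorem form_smul_le (hA : IsMaxDissipative B D A) (hB : IsEnergyForm B) {r : ℝ} (hr : 0 < r)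
    {x : X} (hx : x ∈ D) : B (r • x) (r • x) ≤ B (r • x - A x) (r • x - A x) := by
  rw [hB.form_sub, hB.symm (r • x) (A x), _root_.map_smul]
  have h1 := hA.form_nonpos x hx
  have h2 := hB.nonneg (A x)
  simp only [_root_.map_smul, smul_eq_mul]
  nlinarith [mul_nonpos_of_nonneg_of_nonpos hr.le h1]

/-- Injectivity of `r - A` makes the chosen preimage a left inverse on `D`, and this alone forces it
to be linear. -/
theorem exists_resolvent (hA : IsMaxDissipative B D A) (hB : IsEnergyForm B) {r : ℝ}
    (hr : 0 < r) : ∃ R : X →L[ℝ] X, (∀ f, R f ∈ D ∧ r • R f - A (R f) = f) ∧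
      (∀ x ∈ D, R (r • x - A x) = x) ∧ ∀ f, B (r • R f) (r • R f) ≤ B f f := by
  obtain ⟨M, hM, hMle⟩ := hB.exists_norm_le
  choose R hRD hR using hA.range_eq r hr
  have huniq : ∀ x ∈ D, R (r • x - A x) = x := fun x hx => by
    have h1 := hA.form_smul_le hB hr (D.sub_mem (hRD (r • x - A x)) hx)
    rw [hA.map_sub (hRD _) hx, smul_sub, sub_sub_sub_comm, hR, sub_self] at h1
    simp only [map_zero] at h1
    have h2 := hB.eq_zero h1
    rw [← smul_sub, smul_eq_zero] at h2
    exact sub_eq_zero.1 (h2.resolve_left hr.ne')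
  have hq : ∀ f, B (r • R f) (r • R f) ≤ B f f := fun f => by
    have := hA.form_smul_le hB hr (hRD f)
    rwa [hR] at this
  let R₀ : X →ₗ[ℝ] X :=
    { toFun := R
      map_add' := fun f g => by
        rw [← huniq (R f + R g) (D.add_mem (hRD f) (hRD g)), hA.map_add _ (hRD f) _ (hRD g),
          smul_add, add_sub_add_comm, hR, hR]
      map_smul' := fun a f => by
        rw [RingHom.id_apply, ← huniq (a • R f) (D.smul_mem a (hRD f)), hA.map_smul _ _ (hRD f),
          smul_comm, ← smul_sub, hR] }
  refine ⟨R₀.mkContinuous (M / r) fun f => ?_, fun f => ⟨hRD f, hR f⟩, huniq, hq⟩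
  have h1 := hMle f (r • R f) (hq f)
  rw [norm_smul, Real.norm_of_nonneg hr.le] at h1
  rw [div_mul_eq_mul_div, le_div_iff₀ hr]
  rw [mul_comm]
  exact h1

/-- The graph of `A`, a closed subspace. -/
def graph (hA : IsMaxDissipative B D A) : Submodule ℝ (X × X) where
  carrier := {w | w.1 ∈ D ∧ w.2 = A w.1}
  zero_mem' := ⟨D.zero_mem, by
    have := hA.map_smul 0 0 D.zero_mem
    simpa using this.symm⟩
  add_mem' := by
    rintro ⟨x, x'⟩ ⟨y, y'⟩ ⟨h1, h2⟩ ⟨h3, h4⟩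
    exact ⟨D.add_mem h1 h3, by simp_all [hA.map_add x h1 y h3]⟩
  smul_mem' := by
    rintro r ⟨x, x'⟩ ⟨h1, h2⟩
    exact ⟨D.smul_mem r h1, by simp_all [hA.map_smul r x h1]⟩

/-- With `R` the bounded inverse of `1 - A`, the graph is the zero set of the continuous map `(x, y)
↦ R (x - y) - x`. Every later passage to the limit under `A` goes through this. -/
theorem isClosed_graph (hA : IsMaxDissipative B D A) (hB : IsEnergyForm B) :
    IsClosed (hA.graph : Set (X × X)) := by
  obtain ⟨R, hR, hRinv, -⟩ := hA.exists_resolvent hB one_pos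
  have : (hA.graph : Set (X × X)) = {w | R (w.1 - w.2) = w.1} := by
    ext ⟨x, y⟩
    constructor
    · rintro ⟨h1, h2⟩
      dsimp only at h1 h2
      have := hRinv x h1
      rw [one_smul] at this
      rw [mem_ofPred, h2, this]
    · intro h
      rw [mem_ofPred] at h
      dsimp only at h
      have h1 := hR (x - y)
      rw [h, one_smul] at h1
      exact ⟨h1.1, by simpa using h1.2.symm⟩
  rw [this]
  exact isClosed_eq (by fun_prop) (by fun_prop)

/-- Density follows from surjectivity. If `y` represents a functional vanishing on `D` and `y = z -
A z`, then `0 = B y z = B z z - B (A z) z ≥ B z z`, so `z` and with it `y` are zero. -/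
theorem dense (hA : IsMaxDissipative B D A) (hB : IsEnergyForm B) [CompleteSpace X] :
    Dense (D : Set X) := by
  by_contra hD
  obtain ⟨x, hx⟩ : ∃ x, x ∉ D.topologicalClosure := by
    by_contra! h
    exact hD (Submodule.dense_iff_topologicalClosure_eq_top.2 (eq_top_iff.2 fun x _ => h x))
  obtain ⟨l, u, hl, hu⟩ := geometric_hahn_banach_closed_point D.topologicalClosure.convex
    D.isClosed_topologicalClosure hx
  have hl0 : ∀ a ∈ D, l a = 0 := fun a ha => by
    by_contra hne
    -- On this multiple `l` takes the value `u`, which the strict separation forbids.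
    have h1 := hl ((u / l a) • a) (D.le_topologicalClosure (D.smul_mem _ ha))
    rw [_root_.map_smul, smul_eq_mul, div_mul_cancel₀ _ hne] at h1
    exact lt_irrefl _ h1
  have hu0 : 0 < u := by simpa using hl 0 (Submodule.zero_mem _)
  obtain ⟨y, hy⟩ := hB.exists_repr l
  obtain ⟨z, hz, hzy⟩ := hA.range_eq 1 one_pos y
  have h1 : B y z = 0 := by rw [hy, hl0 z hz]
  rw [← hzy, one_smul, _root_.map_sub, _root_.sub_apply] at h1
  have hz0 : z = 0 := hB.eq_zero (by linarith [hA.form_nonpos z hz])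
  have hA0 : A 0 = 0 := by simpa using hA.map_smul 0 0 D.zero_mem
  rw [hz0, hA0, smul_zero, sub_zero] at hzy
  have := hy x
  rw [← hzy, _root_.map_zero, _root_.zero_apply] at this
  linarith

end IsMaxDissipative

end Dissipative

/-! ### Mild and strong solutions, the Yosida family, and uniqueness -/

section Dissipative

set_option linter.unusedSectionVars false

variable {X : Type*} [NormedAddCommGroup X] [NormedSpace ℝ X] [CompleteSpace X]

/-- A closed subspace is complete, so the integral can be taken inside it and pushed forward by the
inclusion. Precomposing with `max s 0` makes the integrand continuous on the whole line. -/
theorem intervalIntegral_mem_of_isClosed {S : Submodule ℝ X} (hS : IsClosed (S : Set X))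
    {F : ℝ → X} (hF : ContinuousOn F (Ici 0)) (hm : ∀ s, 0 ≤ s → F s ∈ S) {t : ℝ} (ht : 0 ≤ t) :
    ∫ s in (0 : ℝ)..t, F s ∈ S := by
  have : CompleteSpace S := hS.completeSpace_coe
  let G : ℝ → S := fun s => ⟨F (max s 0), hm _ (le_max_right _ _)⟩
  have hG : Continuous G := Continuous.subtype_mk
    (hF.comp_continuous (by fun_prop) fun s => mem_Ici.2 (le_max_right _ _)) _
  have h1 : ∫ s in (0 : ℝ)..t, F s = ∫ s in (0 : ℝ)..t, S.subtypeL (G s) := by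
    refine intervalIntegral.integral_congr fun s hs => ?_
    rw [uIcc_of_le ht] at hs
    simp [G, max_eq_left hs.1]
  rw [h1, ContinuousLinearMap.intervalIntegral_comp_comm _ (hG.intervalIntegrable _ _)]
  exact Subtype.coe_prop _

theorem hasDerivWithinAt_integral {W : ℝ → X} (hW : ContinuousOn W (Ici 0)) {t : ℝ}
    (ht : 0 ≤ t) : HasDerivWithinAt (fun t => ∫ s in (0 : ℝ)..t, W s) (W t) (Ici 0) t := by
  have hc : Continuous fun s => W (max s 0) :=
    hW.comp_continuous (by fun_prop) fun s => mem_Ici.2 (le_max_right _ _)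
  have h1 := (hc.integral_hasStrictDerivAt 0 t).hasDerivAt.hasDerivWithinAt (s := Ici 0)
  rw [max_eq_left ht] at h1
  have hcongr : ∀ t, 0 ≤ t → ∫ s in (0 : ℝ)..t, W s = ∫ s in (0 : ℝ)..t, W (max s 0) :=
    fun t ht => intervalIntegral.integral_congr fun s hs => by
      rw [uIcc_of_le ht] at hs
      simp [max_eq_left hs.1]
  exact h1.congr (fun t ht => hcongr t ht) (hcongr t ht)

theorem intervalIntegrable_of_continuousOn_Ici {W : ℝ → X} (hW : ContinuousOn W (Ici 0)) {t : ℝ}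
    (ht : 0 ≤ t) : IntervalIntegrable W volume 0 t := by
  refine (hW.mono ?_).intervalIntegrable
  rw [uIcc_of_le ht]
  exact Icc_subset_Ici_self

theorem integral_eq_sub_of_hasDerivWithinAt_Ici {W W' : ℝ → X}
    (h : ∀ t, 0 ≤ t → HasDerivWithinAt W (W' t) (Ici 0) t) (hW' : ContinuousOn W' (Ici 0))
    {t : ℝ} (ht : 0 ≤ t) : ∫ s in (0 : ℝ)..t, W' s = W t - W 0 := by
  refine intervalIntegral.integral_eq_sub_of_hasDeriv_right_of_le ht
    (fun s hs => ((h s hs.1).continuousWithinAt).mono Icc_subset_Ici_self)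
    (fun s hs => (h s hs.1.le).mono (Ioi_subset_Ici hs.1.le))
    (intervalIntegrable_of_continuousOn_Ici hW' ht)

namespace IsMaxDissipative

variable {B : X →L[ℝ] X →L[ℝ] ℝ} {D : Submodule ℝ X} {A : X → X}

/-- A closed operator commutes with integration: `(W, A W)` is a continuous curve in the closed
graph, so its integral stays there. -/
theorem integral_mem_graph (hA : IsMaxDissipative B D A) (hB : IsEnergyForm B) {W W' : ℝ → X}
    (hW : ContinuousOn W (Ici 0)) (hW' : ContinuousOn W' (Ici 0))
    (h : ∀ s, 0 ≤ s → W s ∈ D ∧ W' s = A (W s)) {t : ℝ} (ht : 0 ≤ t) :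
    ∫ s in (0 : ℝ)..t, W s ∈ D ∧ ∫ s in (0 : ℝ)..t, W' s = A (∫ s in (0 : ℝ)..t, W s) := by
  have hc : ContinuousOn (fun s => (W s, W' s)) (Ici 0) := hW.prodMk hW'
  have h1 := intervalIntegral_mem_of_isClosed (hA.isClosed_graph hB) hc
    (fun s hs => (h s hs : (W s, W' s) ∈ hA.graph)) ht
  have hi := intervalIntegrable_of_continuousOn_Ici hc ht
  have e1 := (ContinuousLinearMap.fst ℝ X X).intervalIntegral_comp_comm hi
  have e2 := (ContinuousLinearMap.snd ℝ X X).intervalIntegral_comp_comm hi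
  simp only [ContinuousLinearMap.coe_fst', ContinuousLinearMap.coe_snd'] at e1 e2
  rw [e1, e2]
  exact h1

theorem isMild_of_isStrong (hA : IsMaxDissipative B D A) (hB : IsEnergyForm B) {x₀ : X}
    {W : ℝ → X} (hW : IsStrong D A x₀ W) : IsMild D A x₀ W := by
  have h1 := fun t (ht : (0 : ℝ) ≤ t) => hA.integral_mem_graph hB hW.continuousOn
    hW.continuousOn_op (fun s hs => ⟨hW.mem s hs, rfl⟩) ht
  refine ⟨hW.continuousOn, fun t ht => (h1 t ht).1, fun t ht => ?_⟩
  rw [← (h1 t ht).2, integral_eq_sub_of_hasDerivWithinAt_Ici hW.hasDeriv hW.continuousOn_op ht,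
    hW.initial, add_sub_cancel]

theorem isMild_sub (hA : IsMaxDissipative B D A) {x₀ z₀ : X} {W Z : ℝ → X}
    (hW : IsMild D A x₀ W) (hZ : IsMild D A z₀ Z) :
    IsMild D A (x₀ - z₀) (fun t => W t - Z t) := by
  have h1 : ∀ t, 0 ≤ t → ∫ s in (0 : ℝ)..t, (W s - Z s)
      = (∫ s in (0 : ℝ)..t, W s) - ∫ s in (0 : ℝ)..t, Z s := fun t ht =>
    intervalIntegral.integral_sub (intervalIntegrable_of_continuousOn_Ici hW.continuousOn ht)
      (intervalIntegrable_of_continuousOn_Ici hZ.continuousOn ht)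
  refine ⟨hW.continuousOn.sub hZ.continuousOn, fun t ht => ?_, fun t ht => ?_⟩
  · rw [h1 t ht]
    exact D.sub_mem (hW.integral_mem t ht) (hZ.integral_mem t ht)
  · rw [h1 t ht, hA.map_sub (hW.integral_mem t ht) (hZ.integral_mem t ht), hW.eq_add t ht,
      hZ.eq_add t ht]
    abel

theorem isStrong_sub (hA : IsMaxDissipative B D A) {x₀ z₀ : X} {W Z : ℝ → X}
    (hW : IsStrong D A x₀ W) (hZ : IsStrong D A z₀ Z) :
    IsStrong D A (x₀ - z₀) (fun t => W t - Z t) := by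
  have h1 : ∀ t, 0 ≤ t → A (W t - Z t) = A (W t) - A (Z t) := fun t ht =>
    hA.map_sub (hW.mem t ht) (hZ.mem t ht)
  refine ⟨by rw [hW.initial, hZ.initial], fun t ht => D.sub_mem (hW.mem t ht) (hZ.mem t ht),
    hW.continuousOn.sub hZ.continuousOn,
    (hW.continuousOn_op.sub hZ.continuousOn_op).congr fun t ht => h1 t ht, fun t ht => ?_⟩
  rw [h1 t ht]
  exact (hW.hasDeriv t ht).sub (hZ.hasDeriv t ht)

theorem form_le_of_isStrong (hA : IsMaxDissipative B D A) (hB : IsEnergyForm B) {x₀ : X}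
    {W : ℝ → X} (hW : IsStrong D A x₀ W) {t : ℝ} (ht : 0 ≤ t) : B (W t) (W t) ≤ B x₀ x₀ := by
  rw [← hW.initial]
  exact hB.form_le_of_hasDerivWithinAt hW.hasDeriv (fun s hs => hA.form_nonpos _ (hW.mem s hs)) ht

/-- The family `Jₖ = (k + 1)(k + 1 - A)⁻¹`, which maps into the domain and tends strongly to the
identity. -/
structure IsYosida (B : X →L[ℝ] X →L[ℝ] ℝ) (D : Submodule ℝ X) (A : X → X)
    (J : ℕ → X →L[ℝ] X) : Prop where
  mem : ∀ (k : ℕ) f, J k f ∈ D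
  sub_op : ∀ (k : ℕ) f, ((k : ℝ) + 1) • J k f - A (J k f) = ((k : ℝ) + 1) • f
  left_inv : ∀ (k : ℕ), ∀ x ∈ D, ((k : ℝ) + 1) • J k x - J k (A x) = ((k : ℝ) + 1) • x
  form_le : ∀ (k : ℕ) f, B (J k f) (J k f) ≤ B f f

theorem exists_isYosida (hA : IsMaxDissipative B D A) (hB : IsEnergyForm B) :
    ∃ J : ℕ → X →L[ℝ] X, IsYosida B D A J := by
  have hk : ∀ k : ℕ, (0 : ℝ) < (k : ℝ) + 1 := fun k => by positivity
  choose R hR hRinv hRle using fun k : ℕ => hA.exists_resolvent hB (hk k)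
  refine ⟨fun k => ((k : ℝ) + 1) • R k, fun k f => D.smul_mem _ (hR k f).1, fun k f => ?_,
    fun k x hx => ?_, fun k f => hRle k f⟩
  · rw [_root_.smul_apply, hA.map_smul _ _ (hR k f).1, ← smul_sub, (hR k f).2]
  · have h := hRinv k x hx
    rw [_root_.map_sub, _root_.map_smul] at h
    rw [_root_.smul_apply, _root_.smul_apply, ← smul_sub, h]

namespace IsYosida

variable {J : ℕ → X →L[ℝ] X}

/-- The right side is a bounded operator in `f`; it is the Yosida approximation of `A`. -/
theorem op_apply (hJ : IsYosida B D A J) (k : ℕ) (f : X) :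
    A (J k f) = ((k : ℝ) + 1) • (J k f - f) := by
  rw [smul_sub, ← hJ.sub_op k f]; abel

theorem apply_op (hJ : IsYosida B D A J) (k : ℕ) {x : X} (hx : x ∈ D) :
    J k (A x) = A (J k x) := by
  rw [hJ.op_apply, smul_sub, ← hJ.left_inv k x hx]; abel

/-- For `y ∈ D` the difference `J k y - y` equals `J k (A y) / (k + 1)`, which is `O(1 / k)`.
Uniform boundedness and density of `D` extend the convergence to all vectors. -/
theorem tendsto (hJ : IsYosida B D A J) (hA : IsMaxDissipative B D A) (hB : IsEnergyForm B)
    (x : X) : Tendsto (fun k => J k x) atTop (𝓝 x) := by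
  obtain ⟨M, hM, hMle⟩ := hB.exists_norm_le
  have hJn : ∀ k f, ‖J k f‖ ≤ M * ‖f‖ := fun k f => hMle f _ (hJ.form_le k f)
  have hD : ∀ y ∈ D, Tendsto (fun k => J k y) atTop (𝓝 y) := fun y hy => by
    have h1 : ∀ k : ℕ, ‖J k y - y‖ ≤ 1 / ((k : ℝ) + 1) * (M * ‖A y‖) := fun k => by
      have hk : (0 : ℝ) < (k : ℝ) + 1 := by positivity
      have h2 : ‖((k : ℝ) + 1) • (J k y - y)‖ ≤ M * ‖A y‖ := by
        rw [← hJ.op_apply, ← hJ.apply_op k hy]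
        exact hJn k _
      rw [norm_smul, Real.norm_of_nonneg hk.le] at h2
      rw [one_div, ← div_eq_inv_mul, le_div_iff₀ hk]
      linarith
    rw [tendsto_iff_norm_sub_tendsto_zero]
    refine squeeze_zero (fun _ => norm_nonneg _) h1 ?_
    simpa using (tendsto_one_div_add_atTop_nhds_zero_nat (𝕜 := ℝ)).mul_const (M * ‖A y‖)
  rw [Metric.tendsto_atTop]
  intro ε hε
  obtain ⟨y, hy, hyx⟩ := (Metric.dense_iff.1 (hA.dense hB)) x (ε / (2 * (M + 1))) (by positivity)
  rw [Metric.mem_ball, dist_comm, dist_eq_norm] at hy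
  rw [lt_div_iff₀ (by positivity)] at hy
  obtain ⟨N, hN⟩ := Metric.tendsto_atTop.1 (hD y hyx) (ε / 2) (by positivity)
  refine ⟨N, fun k hk => ?_⟩
  have h1 := hN k hk
  rw [dist_eq_norm] at h1 ⊢
  have h2 : J k x - x = J k (x - y) + (J k y - y) - (x - y) := by rw [_root_.map_sub]; abel
  rw [h2]
  have h3 := norm_sub_le (J k (x - y) + (J k y - y)) (x - y)
  have h4 := norm_add_le (J k (x - y)) (J k y - y)
  have h5 := hJn k (x - y)
  linarith

/-- Apply `J k` to the integrated equation: since `A ∘ J k` is bounded, the right side becomes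
differentiable in time. Claims about mild solutions thereby reduce to strong ones. -/
theorem isStrong (hJ : IsYosida B D A J) {x₀ : X} {W : ℝ → X} (hW : IsMild D A x₀ W) (k : ℕ) :
    IsStrong D A (J k x₀) (fun t => J k (W t)) := by
  have hc : ContinuousOn (fun t => J k (W t)) (Ici 0) :=
    (J k).continuous.comp_continuousOn hW.continuousOn
  have h0 : W 0 = x₀ := by
    have h1 := hW.eq_add 0 le_rfl
    have h2 := hJ.op_apply k 0
    simpa [show A 0 = 0 by simpa using h2] using h1
  have h1 : ∀ t, 0 ≤ t → J k (W t)
      = J k x₀ + ((k : ℝ) + 1) • (J k (∫ s in (0 : ℝ)..t, W s) - ∫ s in (0 : ℝ)..t, W s) :=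
    fun t ht => by
      rw [hW.eq_add t ht, _root_.map_add, hJ.apply_op k (hW.integral_mem t ht), hJ.op_apply]
  refine ⟨by rw [h0], fun t _ => hJ.mem k _, hc, ?_, fun t ht => ?_⟩
  · simp only [hJ.op_apply]
    exact (hc.sub hW.continuousOn).const_smul _
  · have h2 := hasDerivWithinAt_integral hW.continuousOn ht
    have h3 := ((((J k).hasFDerivAt.comp_hasDerivWithinAt t h2).sub h2).const_smul
      ((k : ℝ) + 1)).const_add (J k x₀)
    rw [← hJ.op_apply] at h3
    exact h3.congr (fun s hs => h1 s hs) (h1 t ht)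

/-- `J k` commutes with `A` on `D`, hence with `l + 1 - A`, hence with the inverse of the latter. -/
theorem comm (hJ : IsYosida B D A J) (k l : ℕ) (f : X) :
    J k (J l f) = J l (J k f) := by
  have hl : ((l : ℝ) + 1) ≠ 0 := by positivity
  have h1 : J k (((l : ℝ) + 1) • J l f - A (J l f)) = ((l : ℝ) + 1) • J k f := by
    rw [hJ.sub_op, _root_.map_smul]
  rw [_root_.map_sub, _root_.map_smul, hJ.apply_op k (hJ.mem l f)] at h1
  have h2 := hJ.left_inv l _ (hJ.mem k (J l f))
  rw [← _root_.map_smul, ← _root_.map_sub, h1, _root_.map_smul] at h2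
  exact (smul_right_injective X hl h2).symm

end IsYosida

theorem form_le_of_isMild (hA : IsMaxDissipative B D A) (hB : IsEnergyForm B) {x₀ : X}
    {W : ℝ → X} (hW : IsMild D A x₀ W) {t : ℝ} (ht : 0 ≤ t) : B (W t) (W t) ≤ B x₀ x₀ := by
  obtain ⟨J, hJ⟩ := hA.exists_isYosida hB
  have hc : Continuous fun x => B x x := by fun_prop
  exact le_of_tendsto_of_tendsto' ((hc.tendsto _).comp (hJ.tendsto hA hB (W t)))
    ((hc.tendsto _).comp (hJ.tendsto hA hB x₀))
    fun k => hA.form_le_of_isStrong hB (hJ.isStrong hW k) ht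

theorem isMild_unique (hA : IsMaxDissipative B D A) (hB : IsEnergyForm B) {x₀ : X}
    {W Z : ℝ → X} (hW : IsMild D A x₀ W) (hZ : IsMild D A x₀ Z) : EqOn W Z (Ici 0) :=
  fun t ht => sub_eq_zero.1 <| hB.eq_zero <| by
    simpa using hA.form_le_of_isMild hB (hA.isMild_sub hW hZ) ht

end IsMaxDissipative

end Dissipative

/-! ### Existence of strong and mild solutions -/

section Dissipative

set_option linter.unusedSectionVars false

variable {X : Type*} [NormedAddCommGroup X] [NormedSpace ℝ X] [CompleteSpace X]

namespace IsMaxDissipative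

variable {B : X →L[ℝ] X →L[ℝ] ℝ} {D : Submodule ℝ X} {A : X → X}

namespace IsYosida

variable {J : ℕ → X →L[ℝ] X}

theorem hasDerivAt_exp (a : X →L[ℝ] X) (x : X) (t : ℝ) :
    HasDerivAt (fun t : ℝ => NormedSpace.exp (t • a) x) (NormedSpace.exp (t • a) (a x)) t :=
  (hasDerivAt_exp_smul_const a t).clm_apply (hasDerivAt_const t x) |>.congr_deriv (by simp)

theorem exp_apply_comm {a b : X →L[ℝ] X} (h : Commute a b) (t : ℝ) (x : X) :
    NormedSpace.exp (t • a) (b x) = b (NormedSpace.exp (t • a) x) :=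
  congrArg (fun T : X →L[ℝ] X => T x) ((h.symm.smul_right t).exp_right).eq.symm

theorem form_exp_le (hB : IsEnergyForm B) {a : X →L[ℝ] X} (ha : ∀ x, B (a x) x ≤ 0) (x : X)
    {t : ℝ} (ht : 0 ≤ t) :
    B (NormedSpace.exp (t • a) x) (NormedSpace.exp (t • a) x) ≤ B x x := by
  have h := hB.form_le_of_hasDerivWithinAt
    (fun s _ => (hasDerivAt_exp a x s).hasDerivWithinAt)
    (fun s _ => by rw [exp_apply_comm (Commute.refl a)]; exact ha _) ht
  simpa using h

/-- The curve `s ↦ exp ((t - s) b) (exp (s a) x)` joins the two exponentials, and by commutation its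
derivative is the same product applied to `a x - b x`. The factor `M` appears twice because each
exponential is a contraction for `B`, not for the norm. -/
theorem norm_exp_sub_le (hB : IsEnergyForm B) {M : ℝ} (hM : 0 ≤ M)
    (hMle : ∀ x y, B y y ≤ B x x → ‖y‖ ≤ M * ‖x‖) {a b : X →L[ℝ] X} (h : Commute a b)
    (ha : ∀ x, B (a x) x ≤ 0) (hb : ∀ x, B (b x) x ≤ 0) (x : X) {t : ℝ} (ht : 0 ≤ t) :
    ‖NormedSpace.exp (t • a) x - NormedSpace.exp (t • b) x‖
      ≤ M * (M * ‖a x - b x‖) * t := by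
  let g : ℝ → X := fun s => NormedSpace.exp ((t - s) • b) (NormedSpace.exp (s • a) x)
  have hg : ∀ s, HasDerivAt g
      (NormedSpace.exp ((t - s) • b) (NormedSpace.exp (s • a) (a x - b x))) s := fun s => by
    have h1 : HasDerivAt (fun s : ℝ => NormedSpace.exp ((t - s) • b))
        (-(NormedSpace.exp ((t - s) • b) * b)) s := by
      exact ((hasDerivAt_exp_smul_const b (t - s)).scomp s
        ((hasDerivAt_id s).const_sub t)).congr_deriv (by simp)
    refine (h1.clm_apply (hasDerivAt_exp a x s)).congr_deriv ?_
    rw [_root_.map_sub, _root_.map_sub, exp_apply_comm h s x]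
    exact neg_add_eq_sub _ _
  have h1 := norm_image_sub_le_of_norm_deriv_le_segment' (f := g) (a := 0) (b := t)
    (C := M * (M * ‖a x - b x‖)) (fun s _ => (hg s).hasDerivWithinAt) (fun s hs => ?_) t
    (right_mem_Icc.2 ht)
  · simpa [g] using h1
  · refine (hMle _ _ (form_exp_le hB hb _ (by linarith [hs.2]))).trans ?_
    exact mul_le_mul_of_nonneg_left (hMle _ _ (form_exp_le hB ha _ hs.1)) hM

/-- Write `f = J k f - (J k f - f)` in the second slot. The first part gives `B (A (J k f)) (J k f)
≤ 0`, the second a negative multiple of a square. -/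
theorem form_op_nonpos (hJ : IsYosida B D A J) (hA : IsMaxDissipative B D A)
    (hB : IsEnergyForm B) (k : ℕ) (f : X) : B (((k : ℝ) + 1) • (J k f - f)) f ≤ 0 := by
  have hk : (0 : ℝ) < (k : ℝ) + 1 := by positivity
  have h1 := hA.form_nonpos _ (hJ.mem k f)
  rw [hJ.op_apply, _root_.map_smul, _root_.smul_apply, smul_eq_mul] at h1
  have h2 := hB.nonneg (J k f - f)
  have h3 : B (J k f - f) (J k f - f) = B (J k f - f) (J k f) - B (J k f - f) f := by
    rw [_root_.map_sub (B (J k f - f))]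
  rw [_root_.map_smul, _root_.smul_apply, smul_eq_mul]
  nlinarith

end IsYosida

open IsYosida in
/-- The Yosida approximations converge to a strong solution. -/
theorem exists_isStrong (hA : IsMaxDissipative B D A) (hB : IsEnergyForm B) {x₀ : X}
    (hx₀ : x₀ ∈ D) : ∃ W : ℝ → X, IsStrong D A x₀ W := by
  obtain ⟨J, hJ⟩ := hA.exists_isYosida hB
  obtain ⟨M, hM, hMle⟩ := hB.exists_norm_le
  let a : ℕ → X →L[ℝ] X := fun k => ((k : ℝ) + 1) • (J k - 1)
  have haA : ∀ k f, a k f = A (J k f) := fun k f => by rw [hJ.op_apply]; rfl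
  have ha : ∀ k f, B (a k f) f ≤ 0 := fun k f => hJ.form_op_nonpos hA hB k f
  have hcomm : ∀ k l, Commute (a k) (a l) := fun k l => by
    have h1 : Commute (J k) (J l) := ContinuousLinearMap.ext fun f => hJ.comm k l f
    exact (((h1.sub_left (Commute.one_left _)).sub_right (Commute.one_right _)).smul_left
      _).smul_right _
  let T : ℕ → ℝ → X →L[ℝ] X := fun k t => NormedSpace.exp (t • a k)
  have hTn : ∀ k t x, 0 ≤ t → ‖T k t x‖ ≤ M * ‖x‖ := fun k t x ht =>
    hMle _ _ (form_exp_le hB (ha k) x ht)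
  have hlim : ∀ y ∈ D, Tendsto (fun k => a k y) atTop (𝓝 (A y)) := fun y hy => by
    simp only [haA, ← hJ.apply_op _ hy]
    exact hJ.tendsto hA hB _
  -- Replace `x` by a nearby `y ∈ D`: the error is controlled by the uniform bound on `T k t`, and
  -- for `y` the interpolation estimate applies because `a k y` converges.
  have huc : ∀ t₀ x, UniformCauchySeqOn (fun k t => T k t x) atTop (Icc 0 t₀) := by
    intro t₀ x
    rw [Metric.uniformCauchySeqOn_iff]
    intro ε hε
    obtain ⟨y, hy, hyx⟩ :=
      (Metric.dense_iff.1 (hA.dense hB)) x (ε / (4 * (M + 1))) (by positivity)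
    rw [Metric.mem_ball, dist_comm, dist_eq_norm, lt_div_iff₀ (by positivity)] at hy
    obtain ⟨N, hN⟩ := Metric.cauchySeq_iff.1 (hlim y hyx).cauchySeq
      (ε / (2 * (M * M * |t₀| + 1))) (by positivity)
    refine ⟨N, fun k hk l hl t ht => ?_⟩
    have h1 := hN k hk l hl
    rw [dist_eq_norm, lt_div_iff₀ (by positivity)] at h1
    have h2 := norm_exp_sub_le hB hM hMle (hcomm k l) (ha k) (ha l) y ht.1
    have h3 : M * (M * ‖a k y - a l y‖) * t ≤ M * (M * ‖a k y - a l y‖) * |t₀| :=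
      mul_le_mul_of_nonneg_left (ht.2.trans (le_abs_self _)) (by positivity)
    rw [dist_eq_norm]
    have h4 : T k t x - T l t x = T k t (x - y) + (T k t y - T l t y) - T l t (x - y) := by
      rw [_root_.map_sub, _root_.map_sub]; abel
    rw [h4]
    have h5 := norm_sub_le (T k t (x - y) + (T k t y - T l t y)) (T l t (x - y))
    have h6 := norm_add_le (T k t (x - y)) (T k t y - T l t y)
    have h7 := hTn k t (x - y) ht.1
    have h8 := hTn l t (x - y) ht.1
    have h9 : ‖T k t y - T l t y‖ ≤ _ := h2
    have h10 := norm_nonneg (a k y - a l y)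
    have h11 := norm_nonneg (x - y)
    nlinarith
  -- The limit exists only for `t ≥ 0`; the value zero elsewhere merely makes `S` a total function.
  have hex : ∀ x t, ∃ y, 0 ≤ t → Tendsto (fun k => T k t x) atTop (𝓝 y) := fun x t => by
    by_cases ht : 0 ≤ t
    · obtain ⟨y, hy⟩ := cauchySeq_tendsto_of_complete
        ((huc t x).cauchySeq (right_mem_Icc.2 ht))
      exact ⟨y, fun _ => hy⟩
    · exact ⟨0, fun h => absurd h ht⟩
  choose S hS using hex
  have hunif : ∀ t₀ x, TendstoUniformlyOn (fun k t => T k t x) (S x) atTop (Icc 0 t₀) :=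
    fun t₀ x => (huc t₀ x).tendstoUniformlyOn_of_tendsto fun t ht => hS x t ht.1
  have hTd : ∀ k x t, HasDerivAt (fun t => T k t x) (T k t (a k x)) t := fun k x t =>
    hasDerivAt_exp _ _ _
  have hTc : ∀ k x, Continuous fun t => T k t x := fun k x =>
    continuous_iff_continuousAt.2 fun t => (hTd k x t).continuousAt
  have hSc : ∀ x, ContinuousOn (S x) (Ici 0) := fun x => by
    have h1 : ∀ t₀, ContinuousOn (S x) (Icc 0 t₀) := fun t₀ =>
      (hunif t₀ x).continuousOn (Frequently.of_forall fun k => (hTc k x).continuousOn)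
    intro t ht
    refine ((h1 (t + 1)) t ⟨ht, by linarith⟩).mono_of_mem_nhdsWithin ?_
    filter_upwards [self_mem_nhdsWithin, mem_nhdsWithin_of_mem_nhds (Iio_mem_nhds
      (lt_add_one t))] with s h1 h2 using ⟨h1, le_of_lt h2⟩
  have hTA : ∀ t, 0 ≤ t → Tendsto (fun k => T k t (a k x₀)) atTop (𝓝 (S (A x₀) t)) :=
    fun t ht => by
      have h1 : Tendsto (fun k => T k t (a k x₀ - A x₀)) atTop (𝓝 0) := by
        refine squeeze_zero_norm (fun k => hTn k t _ ht) ?_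
        have := (tendsto_iff_norm_sub_tendsto_zero.1 (hlim x₀ hx₀)).const_mul M
        simpa using this
      have h2 := h1.add (hS (A x₀) t ht)
      simp only [← _root_.map_add, sub_add_cancel, zero_add] at h2
      exact h2
  have hmem : ∀ t, 0 ≤ t → S x₀ t ∈ D ∧ S (A x₀) t = A (S x₀ t) := fun t ht => by
    -- Since `a k = A ∘ J k` commutes with its exponential, these pairs lie on the graph. Their
    -- limit shows at once that `S x₀ t` is in the domain and that `A` commutes with `S`.
    have h1 : ∀ k, (J k (T k t x₀), T k t (a k x₀)) ∈ hA.graph := fun k =>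
      ⟨hJ.mem k _, by rw [← haA]; exact exp_apply_comm (Commute.refl _) _ _⟩
    have h2 : Tendsto (fun k => J k (T k t x₀)) atTop (𝓝 (S x₀ t)) := by
      have h3 : Tendsto (fun k => J k (T k t x₀ - S x₀ t)) atTop (𝓝 0) := by
        refine squeeze_zero_norm (fun k => hMle _ _ (hJ.form_le k _)) ?_
        have := (tendsto_iff_norm_sub_tendsto_zero.1 (hS x₀ t ht)).const_mul M
        simpa using this
      have h4 := h3.add (hJ.tendsto hA hB (S x₀ t))
      simp only [← _root_.map_add, sub_add_cancel, zero_add] at h4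
      exact h4
    exact (hA.isClosed_graph hB).mem_of_tendsto (h2.prodMk_nhds (hTA t ht))
      (Eventually.of_forall h1)
  -- The limit of the integrated approximate equations. Its integrand `S (A x₀)` is continuous, so
  -- `S x₀` is continuously differentiable.
  have hint : ∀ t, 0 ≤ t → S x₀ t = x₀ + ∫ s in (0 : ℝ)..t, S (A x₀) s := fun t ht => by
    have h1 : ∀ k, T k t x₀ = x₀ + ∫ s in (0 : ℝ)..t, T k s (a k x₀) := fun k => by
      rw [integral_eq_sub_of_hasDerivWithinAt_Ici (W := fun t => T k t x₀)
        (fun s _ => (hTd k x₀ s).hasDerivWithinAt) (hTc k _).continuousOn ht]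
      simp [T]
    refine tendsto_nhds_unique (hS x₀ t ht) ?_
    simp only [h1]
    refine Tendsto.const_add _ ?_
    obtain ⟨K, hK⟩ := (hlim x₀ hx₀).norm.bddAbove_range
    refine intervalIntegral.tendsto_integral_filter_of_dominated_convergence (fun _ => M * K)
      (Eventually.of_forall fun k => (hTc k _).aestronglyMeasurable)
      (Eventually.of_forall fun k => Eventually.of_forall fun s hs => ?_)
      intervalIntegrable_const (Eventually.of_forall fun s hs => ?_)
    · rw [uIoc_of_le ht] at hs
      exact (hTn k s _ hs.1.le).trans (mul_le_mul_of_nonneg_left (hK ⟨k, rfl⟩) hM)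
    · rw [uIoc_of_le ht] at hs
      exact hTA s hs.1.le
  refine ⟨S x₀, ?_, fun t ht => (hmem t ht).1, hSc x₀,
    (hSc (A x₀)).congr fun t ht => (hmem t ht).2.symm, fun t ht => ?_⟩
  · simpa using hint 0 le_rfl
  · rw [← (hmem t ht).2]
    exact ((hasDerivWithinAt_integral (hSc (A x₀)) ht).const_add x₀).congr
      (fun s hs => hint s hs) (hint t ht)

/-- The strong solutions starting at `J k x₀ ∈ D` converge uniformly on `[0, ∞)` by contractivity.
The integrated equation says that `(∫ W, W t - x₀)` is on the graph, a condition that survives the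
limit. -/
theorem exists_isMild (hA : IsMaxDissipative B D A) (hB : IsEnergyForm B) (x₀ : X) :
    ∃ W : ℝ → X, IsMild D A x₀ W := by
  obtain ⟨J, hJ⟩ := hA.exists_isYosida hB
  obtain ⟨M, hM, hMle⟩ := hB.exists_norm_le
  choose W hW using fun k => hA.exists_isStrong hB (hJ.mem k x₀)
  have hJx := hJ.tendsto hA hB x₀
  have hWn : ∀ k l t, 0 ≤ t → ‖W k t - W l t‖ ≤ M * ‖J k x₀ - J l x₀‖ := fun k l t ht =>
    hMle _ _ (hA.form_le_of_isStrong hB (hA.isStrong_sub (hW k) (hW l)) ht)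
  have huc : UniformCauchySeqOn W atTop (Ici 0) := by
    rw [Metric.uniformCauchySeqOn_iff]
    intro ε hε
    obtain ⟨N, hN⟩ := Metric.cauchySeq_iff.1 hJx.cauchySeq (ε / (M + 1)) (by positivity)
    refine ⟨N, fun k hk l hl t ht => ?_⟩
    have h1 := hN k hk l hl
    rw [dist_eq_norm, lt_div_iff₀ (by positivity)] at h1
    rw [dist_eq_norm]
    have := norm_nonneg (J k x₀ - J l x₀)
    linarith [hWn k l t ht]
  have hex : ∀ t, ∃ y, 0 ≤ t → Tendsto (fun k => W k t) atTop (𝓝 y) := fun t => by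
    by_cases ht : 0 ≤ t
    · obtain ⟨y, hy⟩ := cauchySeq_tendsto_of_complete (huc.cauchySeq ht)
      exact ⟨y, fun _ => hy⟩
    · exact ⟨0, fun h => absurd h ht⟩
  choose Z hZ using hex
  have hunif : TendstoUniformlyOn W Z atTop (Ici 0) :=
    huc.tendstoUniformlyOn_of_tendsto fun t ht => hZ t ht
  have hZc : ContinuousOn Z (Ici 0) :=
    hunif.continuousOn (Frequently.of_forall fun k => (hW k).continuousOn)
  have hmem : ∀ t, 0 ≤ t →
      ((∫ s in (0 : ℝ)..t, Z s), Z t - x₀) ∈ hA.graph := fun t ht => by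
    have hm := fun k => hA.isMild_of_isStrong hB (hW k)
    have h1 : ∀ k, ((∫ s in (0 : ℝ)..t, W k s), W k t - J k x₀) ∈ hA.graph := fun k =>
      ⟨(hm k).integral_mem t ht, by
        have := (hm k).eq_add t ht
        dsimp only
        rw [this, add_sub_cancel_left]⟩
    refine (hA.isClosed_graph hB).mem_of_tendsto (Tendsto.prodMk_nhds ?_ ((hZ t ht).sub hJx))
      (Eventually.of_forall h1)
    have hsub : uIcc 0 t ⊆ Ici 0 := by rw [uIcc_of_le ht]; exact Icc_subset_Ici_self
    obtain ⟨K, hK⟩ := hJx.norm.bddAbove_range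
    refine intervalIntegral.tendsto_integral_filter_of_dominated_convergence (fun _ => M * K)
      (Eventually.of_forall fun k =>
        (intervalIntegrable_iff.1 (intervalIntegrable_of_continuousOn_Ici
          (hW k).continuousOn ht)).aestronglyMeasurable)
      (Eventually.of_forall fun k => Eventually.of_forall fun s hs => ?_)
      intervalIntegrable_const (Eventually.of_forall fun s hs => ?_)
    · rw [uIoc_of_le ht] at hs
      exact (hMle _ _ (hA.form_le_of_isStrong hB (hW k) hs.1.le)).trans
        (mul_le_mul_of_nonneg_left (hK ⟨k, rfl⟩) hM)
    · rw [uIoc_of_le ht] at hs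
      exact hZ s hs.1.le
  refine ⟨Z, hZc, fun t ht => (hmem t ht).1, fun t ht => ?_⟩
  rw [← (hmem t ht).2, add_sub_cancel]

end IsMaxDissipative

end Dissipative

/-! ### Square integrable functions -/

section SquareIntegrable

variable {α : Type*} [MeasurableSpace α] {μ : Measure α}

theorem inner_toLp {f g : α → ℝ} (hf : MemLp f 2 μ) (hg : MemLp g 2 μ) :
    inner ℝ (hf.toLp f) (hg.toLp g) = ∫ x, f x * g x ∂μ := by
  rw [L2.inner_def]
  refine integral_congr_ae ?_
  filter_upwards [hf.coeFn_toLp, hg.coeFn_toLp] with x h1 h2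
  simp [h1, h2, mul_comm]

theorem norm_toLp_eq {f : α → ℝ} (hf : MemLp f 2 μ) :
    ‖hf.toLp f‖ = √(∫ x, f x ^ 2 ∂μ) := by
  rw [norm_eq_sqrt_real_inner, inner_toLp]
  simp only [sq]

theorem abs_integral_mul_le {f g : α → ℝ} (hf : MemLp f 2 μ) (hg : MemLp g 2 μ) :
    |∫ x, f x * g x ∂μ| ≤ √(∫ x, f x ^ 2 ∂μ) * √(∫ x, g x ^ 2 ∂μ) := by
  rw [← inner_toLp hf hg, ← norm_toLp_eq hf, ← norm_toLp_eq hg]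
  exact abs_real_inner_le_norm _ _

end SquareIntegrable

/-- In a Hilbert space, a functional bounded by the norm of a linear map is represented by a
vector. -/
theorem exists_inner_eq_of_abs_le {V H : Type*} [AddCommGroup V] [Module ℝ V]
    [NormedAddCommGroup H] [InnerProductSpace ℝ H] [CompleteSpace H] (T : V →ₗ[ℝ] H)
    (l : V →ₗ[ℝ] ℝ) {C : ℝ} (hl : ∀ v, |l v| ≤ C * ‖T v‖) : ∃ h : H, ∀ v, l v = inner ℝ h (T v) := by
  -- The functional factors through the range of `T`. A linear section `s` gives the factor,
  -- Hahn–Banach extends it to `H`, and Riesz represents it.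
  obtain ⟨s, hs⟩ := T.rangeRestrict.exists_rightInverse_of_surjective T.range_rangeRestrict
  have hTs : ∀ y : T.range, T (s y) = y := fun y => by
    have := LinearMap.congr_fun hs y
    exact congrArg Subtype.val this
  have hbd : ∀ y : T.range, ‖(l ∘ₗ s) y‖ ≤ C * ‖y‖ := fun y => by
    have := hl (s y)
    rw [hTs] at this
    exact this
  obtain ⟨g, hg, -⟩ := exists_extension_norm_eq (𝕜 := ℝ) T.range ((l ∘ₗ s).mkContinuous C hbd)
  refine ⟨(InnerProductSpace.toDual ℝ H).symm g, fun v => ?_⟩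
  rw [InnerProductSpace.toDual_symm_apply]
  have h1 := hg ⟨T v, LinearMap.mem_range_self T v⟩
  rw [h1]
  simp only [LinearMap.mkContinuous_apply, LinearMap.comp_apply]
  -- The argument is in the kernel of `T`, where the bound forces `l` to vanish; hence the choice of
  -- section is immaterial.
  have h2 := hl (v - s ⟨T v, LinearMap.mem_range_self T v⟩)
  rw [map_sub, map_sub, hTs, sub_self, norm_zero, mul_zero] at h2
  exact sub_eq_zero.1 (abs_nonpos_iff.1 h2)

/-! ### Test functions -/

section Test

variable {n : ℕ} {Ω : Set (Space n)}

namespace IsTest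

variable {f g : Space n → ℝ}

theorem continuous (hf : IsTest Ω f) : Continuous f := hf.1.continuous

theorem differentiable (hf : IsTest Ω f) : Differentiable ℝ f := hf.1.differentiable (by simp)

theorem mono {Ω' : Set (Space n)} (h : Ω ⊆ Ω') (hf : IsTest Ω f) : IsTest Ω' f :=
  ⟨hf.1, hf.2.1, hf.2.2.trans h⟩

theorem eq_zero (hf : IsTest Ω f) {x : Space n} (hx : x ∉ Ω) : f x = 0 :=
  image_eq_zero_of_notMem_tsupport fun h => hx (hf.2.2 h)

theorem memLp (hf : IsTest Ω f) (μ : Measure (Space n)) [IsFiniteMeasureOnCompacts μ] :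
    MemLp f 2 μ := hf.continuous.memLp_of_hasCompactSupport hf.2.1

theorem mul_left (hf : IsTest Ω f) {a : Space n → ℝ} (ha : ContDiff ℝ ∞ a) :
    IsTest Ω fun x => a x * f x :=
  ⟨ha.mul hf.1, hf.2.1.mul_left, (tsupport_mul_subset_right).trans hf.2.2⟩

theorem add (hf : IsTest Ω f) (hg : IsTest Ω g) : IsTest Ω (fun x => f x + g x) :=
  ⟨hf.1.add hg.1, hf.2.1.add hg.2.1, (tsupport_add f g).trans (union_subset hf.2.2 hg.2.2)⟩

theorem const_mul (hf : IsTest Ω f) (c : ℝ) : IsTest Ω (fun x => c * f x) :=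
  hf.mul_left contDiff_const

theorem sub (hf : IsTest Ω f) (hg : IsTest Ω g) : IsTest Ω (fun x => f x - g x) := by
  have := hf.add (hg.const_mul (-1))
  simpa [sub_eq_add_neg] using this

theorem pderiv (hf : IsTest Ω f) (i : Fin n) : IsTest Ω (pderiv i f) := by
  refine ⟨(hf.1.fderiv_right (m := ∞) (by simp)).clm_apply contDiff_const, ?_, ?_⟩
  · exact (hf.2.1.fderiv (𝕜 := ℝ)).comp_left
      (g := fun T : Space n →L[ℝ] ℝ => T (EuclideanSpace.single i 1)) rfl
  · refine (closure_mono fun x hx => ?_).trans ((tsupport_fderiv_subset ℝ (f := f)).trans hf.2.2)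
    intro h0
    rw [Function.mem_support] at hx
    exact hx (by simp [MixtureSystem.pderiv, h0])

theorem integral_restrict (hf : IsTest Ω f) : ∫ x in Ω, f x = ∫ x, f x :=
  setIntegral_eq_integral_of_forall_compl_eq_zero fun _ hx => hf.eq_zero hx

end IsTest

theorem pderiv_add {f g : Space n → ℝ} (hf : Differentiable ℝ f) (hg : Differentiable ℝ g)
    (i : Fin n) (x : Space n) : pderiv i (fun x => f x + g x) x = pderiv i f x + pderiv i g x := by
  simp [pderiv, fderiv_fun_add (hf x) (hg x)]

theorem pderiv_sub {f g : Space n → ℝ} (hf : Differentiable ℝ f) (hg : Differentiable ℝ g)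
    (i : Fin n) (x : Space n) : pderiv i (fun x => f x - g x) x = pderiv i f x - pderiv i g x := by
  simp [pderiv, fderiv_fun_sub (hf x) (hg x)]

theorem pderiv_const_mul {f : Space n → ℝ} (hf : Differentiable ℝ f) (c : ℝ)
    (i : Fin n) (x : Space n) : pderiv i (fun x => c * f x) x = c * pderiv i f x := by
  simp [pderiv, fderiv_const_mul (hf x)]

theorem pderiv_mul {f g : Space n → ℝ} (hf : Differentiable ℝ f) (hg : Differentiable ℝ g)
    (i : Fin n) (x : Space n) :
    pderiv i (fun x => f x * g x) x = pderiv i f x * g x + f x * pderiv i g x := by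
  simp [pderiv, fderiv_fun_mul (hf x) (hg x)]; ring

/-- Integration by parts. -/
theorem integral_mul_pderiv {f g : Space n → ℝ} (hf : ContDiff ℝ ∞ f) (hg : IsTest univ g)
    (i : Fin n) : ∫ x, f x * pderiv i g x = -∫ x, pderiv i f x * g x := by
  have hf' : Continuous (pderiv i f) :=
    ((hf.fderiv_right (m := ∞) (by simp)).clm_apply contDiff_const).continuous
  refine integral_mul_fderiv_eq_neg_fderiv_mul_of_integrable ?_ ?_ ?_
    (fun x _ => hf.differentiable (by simp) x) (fun x _ => hg.differentiable x)
  · exact (hf'.mul hg.continuous).integrable_of_hasCompactSupport hg.2.1.mul_left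
  · exact (hf.continuous.mul (hg.pderiv i).continuous).integrable_of_hasCompactSupport
      (hg.pderiv i).2.1.mul_left
  · exact (hf.continuous.mul hg.continuous).integrable_of_hasCompactSupport hg.2.1.mul_left

/-- The second derivatives of a test function are symmetric. -/
theorem IsTest.pderiv_comm {f : Space n → ℝ} (hf : IsTest Ω f) (i j : Fin n) (x : Space n) :
    MixtureSystem.pderiv i (MixtureSystem.pderiv j f) x
      = MixtureSystem.pderiv j (MixtureSystem.pderiv i f) x := by
  have hd : DifferentiableAt ℝ (fderiv ℝ f) x :=
    (hf.1.fderiv_right (m := ∞) (by simp)).differentiable (by simp) x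
  have h1 : ∀ v w : Space n, fderiv ℝ (fun y => fderiv ℝ f y v) x w
      = fderiv ℝ (fderiv ℝ f) x w v := fun v w => by
    rw [fderiv_clm_apply hd (differentiableAt_const v)]
    simp
  have hs : IsSymmSndFDerivAt ℝ f x := by
    refine (hf.1.contDiffAt (x := x)).isSymmSndFDerivAt (by
      simpa using WithTop.coe_le_coe.2 (le_top : (2 : ℕ∞) ≤ ⊤))
  unfold MixtureSystem.pderiv
  rw [h1, h1]
  exact hs _ _

/-- The element of `L²(Ω)` given by a test function. -/
def IsTest.toL2 {f : Space n → ℝ} (hf : IsTest Ω f) : L2 Ω := (hf.memLp _).toLp f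

theorem IsTest.inner_toL2 {f : Space n → ℝ} (hf : IsTest Ω f) (u : L2 Ω) :
    inner ℝ u hf.toL2 = ∫ x in Ω, u x * f x := by
  rw [L2.inner_def]
  refine integral_congr_ae ?_
  filter_upwards [(hf.memLp (volume.restrict Ω)).coeFn_toLp] with x h1
  rw [IsTest.toL2, h1]
  simp [mul_comm]

theorem IsTest.norm_toL2 {f : Space n → ℝ} (hf : IsTest Ω f) :
    ‖hf.toL2‖ = √(∫ x, f x ^ 2) := by
  rw [IsTest.toL2, norm_toLp_eq]
  congr 1
  exact setIntegral_eq_integral_of_forall_compl_eq_zero fun x hx => by simp [hf.eq_zero hx]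

theorem IsTest.ae_eq_toL2 {f : Space n → ℝ} (hf : IsTest Ω f) {u : L2 Ω} 
    (h : u =ᵐ[volume.restrict Ω] f) : u = hf.toL2 :=
  Lp.ext (h.trans (hf.memLp _).coeFn_toLp.symm)

/-- This is the fundamental lemma of the calculus of variations; it gives uniqueness of weak
derivatives and identifies Laplacians. -/
theorem ext_of_inner_test (hΩ : IsOpen Ω) {u v : L2 Ω}
    (h : ∀ f (hf : IsTest Ω f), inner ℝ u hf.toL2 = inner ℝ v hf.toL2) : u = v := by
  have h0 := hΩ.ae_eq_zero_of_integral_contDiff_smul_eq_zero (μ := volume)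
    (f := (u - v : L2 Ω)) ?_ fun f h1 h2 h3 => ?_
  · rw [← sub_eq_zero]
    refine Lp.ext ?_
    filter_upwards [ae_restrict_of_ae (s := Ω) h0, ae_restrict_mem hΩ.measurableSet,
      Lp.coeFn_zero ℝ 2 (volume.restrict Ω)] with x h1 h2 h3
    rw [h1 h2, h3, Pi.zero_apply]
  · have hm : MemLp (u - v : L2 Ω) 2 (volume.restrict Ω) := Lp.memLp _
    exact locallyIntegrableOn_of_locallyIntegrable_restrict (hm.locallyIntegrable (by norm_num))
  · have hf : IsTest Ω f := ⟨h1, h2, h3⟩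
    have h4 : inner ℝ (u - v) hf.toL2 = 0 := by rw [inner_sub_left, h f hf, sub_self]
    rw [hf.inner_toL2] at h4
    rw [← h4]
    symm
    rw [setIntegral_eq_integral_of_forall_compl_eq_zero]
    · simp only [smul_eq_mul, mul_comm]
    · intro x hx
      rw [hf.eq_zero hx, mul_zero]

end Test

/-! ### Weak derivatives -/

section Weak

variable {n : ℕ} {Ω : Set (Space n)}

theorem hasWeakDeriv_iff {i : Fin n} {u g : L2 Ω} : HasWeakDeriv i u g ↔
    ∀ f (hf : IsTest Ω f), inner ℝ u (hf.pderiv i).toL2 = -inner ℝ g hf.toL2 := by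
  refine forall₂_congr fun f hf => ?_
  rw [hf.inner_toL2, (hf.pderiv i).inner_toL2]

theorem HasWeakDeriv.unique (hΩ : IsOpen Ω) {i : Fin n} {u g h : L2 Ω} (hg : HasWeakDeriv i u g)
    (hh : HasWeakDeriv i u h) : g = h :=
  ext_of_inner_test hΩ fun f hf => neg_injective <| by
    rw [← hasWeakDeriv_iff.1 hg f hf, ← hasWeakDeriv_iff.1 hh f hf]

theorem HasWeakDeriv.weakDeriv_eq (hΩ : IsOpen Ω) {i : Fin n} {u g : L2 Ω}
    (hg : HasWeakDeriv i u g) : weakDeriv i u = g := by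
  have h : ∃ g, HasWeakDeriv i u g := ⟨g, hg⟩
  rw [weakDeriv, dif_pos h]
  exact h.choose_spec.unique hΩ hg

theorem HasWeakDeriv.add {i : Fin n} {u v g h : L2 Ω} (hg : HasWeakDeriv i u g)
    (hh : HasWeakDeriv i v h) : HasWeakDeriv i (u + v) (g + h) :=
  hasWeakDeriv_iff.2 fun f hf => by
    rw [inner_add_left, inner_add_left, hasWeakDeriv_iff.1 hg f hf, hasWeakDeriv_iff.1 hh f hf]
    ring

theorem HasWeakDeriv.smul {i : Fin n} {u g : L2 Ω} (c : ℝ) (hg : HasWeakDeriv i u g) :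
    HasWeakDeriv i (c • u) (c • g) :=
  hasWeakDeriv_iff.2 fun f hf => by
    rw [real_inner_smul_left, real_inner_smul_left, hasWeakDeriv_iff.1 hg f hf]
    ring

/-- The space of test functions. -/
def testSubmodule (Ω : Set (Space n)) : Submodule ℝ (Space n → ℝ) where
  carrier := {f | IsTest Ω f}
  zero_mem' := ⟨contDiff_const, HasCompactSupport.zero, by simp [tsupport]⟩
  add_mem' hf hg := hf.add hg
  smul_mem' c _ hf := hf.const_mul c

/-- An `L²` function has a weak derivative if the distributional derivative is bounded for the
`L²` norm. -/
theorem exists_hasWeakDeriv {i : Fin n} {u : L2 Ω} {C : ℝ}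
    (h : ∀ f (hf : IsTest Ω f), |inner ℝ u (hf.pderiv i).toL2| ≤ C * ‖hf.toL2‖) :
    ∃ g, HasWeakDeriv i u g := by
  let T : testSubmodule Ω →ₗ[ℝ] L2 Ω :=
    { toFun := fun f => IsTest.toL2 f.2
      map_add' := fun f g => rfl
      map_smul' := fun c f => rfl }
  let l : testSubmodule Ω →ₗ[ℝ] ℝ :=
    { toFun := fun f => inner ℝ u (IsTest.pderiv f.2 i).toL2
      map_add' := fun f g => by
        rw [← inner_add_right]
        congr 1
        refine Lp.ext ?_
        have e := ((IsTest.pderiv f.2 i).memLp (volume.restrict Ω)).coeFn_toLp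
        have e' := ((IsTest.pderiv g.2 i).memLp (volume.restrict Ω)).coeFn_toLp
        refine ((IsTest.pderiv (f + g).2 i).memLp (volume.restrict Ω)).coeFn_toLp.trans ?_
        refine EventuallyEq.trans ?_ (Lp.coeFn_add _ _).symm
        filter_upwards [e, e'] with x h1 h2
        rw [Pi.add_apply, IsTest.toL2, IsTest.toL2, h1, h2]
        exact pderiv_add (IsTest.differentiable f.2) (IsTest.differentiable g.2) i x
      map_smul' := fun c f => by
        rw [RingHom.id_apply, smul_eq_mul, ← real_inner_smul_right]
        congr 1
        refine Lp.ext ?_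
        have e := ((IsTest.pderiv f.2 i).memLp (volume.restrict Ω)).coeFn_toLp
        refine ((IsTest.pderiv (c • f).2 i).memLp (volume.restrict Ω)).coeFn_toLp.trans ?_
        refine EventuallyEq.trans ?_ (Lp.coeFn_smul _ _).symm
        filter_upwards [e] with x h1
        rw [Pi.smul_apply, IsTest.toL2, h1]
        exact pderiv_const_mul (IsTest.differentiable f.2) c i x }
  obtain ⟨g, hg⟩ := exists_inner_eq_of_abs_le T l (C := C) fun f => h f f.2
  refine ⟨-g, hasWeakDeriv_iff.2 fun f hf => ?_⟩
  rw [inner_neg_left, neg_neg]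
  exact hg ⟨f, hf⟩

theorem IsTest.mem_testPairs {f : Space n → ℝ} (hf : IsTest Ω f) :
    ((hf.toL2, fun i => (hf.pderiv i).toL2) : L2 Ω × (Fin n → L2 Ω)) ∈ testPairs Ω :=
  ⟨f, hf, (hf.memLp _).coeFn_toLp, fun i => ((hf.pderiv i).memLp _).coeFn_toLp⟩

/-- The element of `H¹₀(Ω)` given by a test function. -/
def IsTest.toH10 {f : Space n → ℝ} (hf : IsTest Ω f) : H10 Ω :=
  ⟨_, (testPairs Ω).le_topologicalClosure hf.mem_testPairs⟩

/-- Closed conditions on `H¹₀(Ω)` may be checked on test functions. -/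
theorem H10.induction {P : H10 Ω → Prop} (hP : IsClosed {u | P u})
    (h : ∀ f (hf : IsTest Ω f), P hf.toH10) (u : H10 Ω) : P u := by
  let S : Set (H10 Ω) := {v | ∃ (f : Space n → ℝ) (hf : IsTest Ω f), v = hf.toH10}
  have hS : ((testPairs Ω : Submodule ℝ _) : Set (L2 Ω × (Fin n → L2 Ω))) ⊆ Subtype.val '' S := by
    rintro w ⟨f, hf, h1, h2⟩
    refine ⟨hf.toH10, ⟨f, hf, rfl⟩, Prod.ext (hf.ae_eq_toL2 h1).symm (funext fun i => ?_)⟩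
    exact ((hf.pderiv i).ae_eq_toL2 (h2 i)).symm
  have hu : u ∈ closure S := closure_subtype.2 (closure_mono hS u.2)
  have h1 : closure S ⊆ {u | P u} :=
    hP.closure_subset_iff.2 (by rintro _ ⟨f, hf, rfl⟩; exact h f hf)
  exact h1 hu

/-- The inclusion `H¹₀(Ω) → L²(Ω)`. -/
def H10.fnL : H10 Ω →L[ℝ] L2 Ω :=
  (ContinuousLinearMap.fst ℝ (L2 Ω) (Fin n → L2 Ω)).comp (Submodule.subtypeL _)

/-- The partial derivative `H¹₀(Ω) → L²(Ω)`. -/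
def H10.gradL (i : Fin n) : H10 Ω →L[ℝ] L2 Ω :=
  (ContinuousLinearMap.proj (R := ℝ) (φ := fun _ : Fin n => L2 Ω) i).comp
    ((ContinuousLinearMap.snd ℝ (L2 Ω) (Fin n → L2 Ω)).comp (Submodule.subtypeL _))

@[fun_prop]
theorem H10.continuous_fn : Continuous (H10.fn : H10 Ω → L2 Ω) := H10.fnL.continuous

@[fun_prop]
theorem H10.continuous_grad (i : Fin n) : Continuous fun u : H10 Ω => u.grad i :=
  (H10.gradL i).continuous

theorem IsTest.inner_pderiv_toL2 {f g : Space n → ℝ} (hf : IsTest Ω f) (hg : IsTest Ω g)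
    (i : Fin n) : inner ℝ hf.toL2 (hg.pderiv i).toL2 = -inner ℝ (hf.pderiv i).toL2 hg.toL2 := by
  rw [IsTest.toL2, IsTest.toL2, IsTest.toL2, IsTest.toL2, inner_toLp, inner_toLp,
    ((hg.pderiv i).mul_left hf.1).integral_restrict, (hg.mul_left (hf.pderiv i).1).integral_restrict]
  exact integral_mul_pderiv hf.1 (hg.mono (subset_univ _)) i

theorem H10.hasWeakDeriv (u : H10 Ω) (i : Fin n) : HasWeakDeriv i u.fn (u.grad i) := by
  refine hasWeakDeriv_iff.2 fun g hg => ?_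
  refine H10.induction (P := fun u : H10 Ω => inner ℝ u.fn (hg.pderiv i).toL2
    = -inner ℝ (u.grad i) hg.toL2) (isClosed_eq (by fun_prop) (by fun_prop)) ?_ u
  exact fun f hf => hf.inner_pderiv_toL2 hg i

/-- Integration by parts against an element of `H¹₀(Ω)`. -/
theorem HasWeakDeriv.inner_grad {i : Fin n} {g h : L2 Ω} (hg : HasWeakDeriv i g h) (u : H10 Ω) :
    inner ℝ g (u.grad i) = -inner ℝ h u.fn := by
  refine H10.induction (P := fun u : H10 Ω => inner ℝ g (u.grad i) = -inner ℝ h u.fn)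
    (isClosed_eq (by fun_prop) (by fun_prop)) ?_ u
  exact fun f hf => hasWeakDeriv_iff.1 hg f hf

/-- An element is a pair, but its second component is the weak gradient of the first and so is
determined by it. Consequently `toH10` does not depend on a choice. -/
theorem H10.ext_fn (hΩ : IsOpen Ω) {u v : H10 Ω} (h : u.fn = v.fn) : u = v := by
  refine Subtype.ext (Prod.ext h (funext fun i => ?_))
  exact (u.hasWeakDeriv i).unique hΩ (by rw [h]; exact v.hasWeakDeriv i)

theorem toH10_fn {U : L2 Ω} (h : MemH10 U) : (toH10 U).fn = U := by
  rw [toH10, dif_pos h]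
  exact h.choose_spec

theorem toH10_eq (hΩ : IsOpen Ω) {u : H10 Ω} {U : L2 Ω} (h : u.fn = U) : toH10 U = u :=
  H10.ext_fn hΩ (by rw [toH10_fn ⟨u, h⟩, h])

theorem MemH2.hasWeakDeriv {z : L2 Ω} (hz : MemH2 z) (i : Fin n) :
    HasWeakDeriv i z (weakDeriv i z) := by
  rw [weakDeriv, dif_pos (hz.1 i)]
  exact (hz.1 i).choose_spec

theorem MemH2.hasWeakDeriv₂ {z : L2 Ω} (hz : MemH2 z) (i j : Fin n) :
    HasWeakDeriv j (weakDeriv i z) (weakDeriv j (weakDeriv i z)) := by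
  rw [weakDeriv.eq_def j, dif_pos (hz.2 i j)]
  exact (hz.2 i j).choose_spec

/-- Green's formula. -/
theorem MemH2.inner_laplacian {z : L2 Ω} (hz : MemH2 z) (u : H10 Ω) :
    inner ℝ (laplacian z) u.fn = -∑ i, inner ℝ (weakDeriv i z) (u.grad i) := by
  rw [laplacian, sum_inner, ← Finset.sum_neg_distrib]
  refine Finset.sum_congr rfl fun i _ => ?_
  rw [(hz.hasWeakDeriv₂ i i).inner_grad u, neg_neg]

theorem MemH2.add (hΩ : IsOpen Ω) {z w : L2 Ω} (hz : MemH2 z) (hw : MemH2 w) :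
    MemH2 (z + w) := by
  refine ⟨fun i => ⟨_, (hz.hasWeakDeriv i).add (hw.hasWeakDeriv i)⟩, fun i j => ?_⟩
  rw [((hz.hasWeakDeriv i).add (hw.hasWeakDeriv i)).weakDeriv_eq hΩ]
  exact ⟨_, (hz.hasWeakDeriv₂ i j).add (hw.hasWeakDeriv₂ i j)⟩

theorem MemH2.smul (hΩ : IsOpen Ω) {z : L2 Ω} (c : ℝ) (hz : MemH2 z) : MemH2 (c • z) := by
  refine ⟨fun i => ⟨_, (hz.hasWeakDeriv i).smul c⟩, fun i j => ?_⟩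
  rw [((hz.hasWeakDeriv i).smul c).weakDeriv_eq hΩ]
  exact ⟨_, (hz.hasWeakDeriv₂ i j).smul c⟩

theorem laplacian_add (hΩ : IsOpen Ω) {z w : L2 Ω} (hz : MemH2 z) (hw : MemH2 w) :
    laplacian (z + w) = laplacian z + laplacian w := by
  rw [laplacian, laplacian, laplacian, ← Finset.sum_add_distrib]
  refine Finset.sum_congr rfl fun i _ => ?_
  rw [((hz.hasWeakDeriv i).add (hw.hasWeakDeriv i)).weakDeriv_eq hΩ,
    ((hz.hasWeakDeriv₂ i i).add (hw.hasWeakDeriv₂ i i)).weakDeriv_eq hΩ]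

theorem laplacian_smul (hΩ : IsOpen Ω) {z : L2 Ω} (c : ℝ) (hz : MemH2 z) :
    laplacian (c • z) = c • laplacian z := by
  rw [laplacian, laplacian, Finset.smul_sum]
  refine Finset.sum_congr rfl fun i _ => ?_
  rw [((hz.hasWeakDeriv i).smul c).weakDeriv_eq hΩ,
    ((hz.hasWeakDeriv₂ i i).smul c).weakDeriv_eq hΩ]

/-- Poincaré's inequality. -/
theorem H10.exists_norm_fn_le (hΩ : Bornology.IsBounded Ω) (i : Fin n) :
    ∃ C : ℝ, 0 ≤ C ∧ ∀ u : H10 Ω, ‖u.fn‖ ≤ C * ‖u.grad i‖ := by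
  obtain ⟨R, hR0, hR⟩ := hΩ.subset_ball_lt 0 0
  refine ⟨2 * R, by positivity, fun u => ?_⟩
  refine H10.induction (P := fun u : H10 Ω => ‖u.fn‖ ≤ 2 * R * ‖u.grad i‖)
    (isClosed_le (by fun_prop) (by fun_prop)) (fun f hf => ?_) u
  change ‖hf.toL2‖ ≤ 2 * R * ‖(hf.pderiv i).toL2‖
  have hx : ContDiff ℝ ∞ fun x : Space n => x i := by fun_prop
  have hxf := hf.mul_left hx
  have hd : ∀ x : Space n, MixtureSystem.pderiv i (fun x : Space n => x i) x = 1 := fun x => by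
    have : HasFDerivAt (fun x : Space n => x i)
      (EuclideanSpace.proj i : Space n →L[ℝ] ℝ) x := 
      (EuclideanSpace.proj (𝕜 := ℝ) i).hasFDerivAt
    rw [MixtureSystem.pderiv, this.fderiv]
    simp
  -- Integration by parts with `∂ᵢ xᵢ = 1`. Cauchy–Schwarz and `|xᵢ| ≤ R` on `Ω` then give the
  -- constant `2 R`.
  have h1 : ∫ x, f x ^ 2 = -2 * ∫ x, MixtureSystem.pderiv i f x * (x i * f x) := by
    have h2 := integral_mul_pderiv hf.1 (hxf.mono (subset_univ _)) i
    have h3 : ∀ x, f x * MixtureSystem.pderiv i (fun x => x i * f x) x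
        = f x ^ 2 + MixtureSystem.pderiv i f x * (x i * f x) := fun x => by
      rw [pderiv_mul (hx.differentiable (by simp)) hf.differentiable, hd]; ring
    simp only [h3] at h2
    rw [integral_add] at h2
    · linarith
    · simp only [sq]
      exact (hf.mul_left hf.1).continuous.integrable_of_hasCompactSupport
        (hf.mul_left hf.1).2.1
    · exact (hxf.mul_left (hf.pderiv i).1).continuous.integrable_of_hasCompactSupport
        (hxf.mul_left (hf.pderiv i).1).2.1
  have h2 := abs_integral_mul_le ((hf.pderiv i).memLp volume) (hxf.memLp volume)
  have h3 : √(∫ x, (x i * f x) ^ 2) ≤ R * √(∫ x, f x ^ 2) := by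
    rw [← Real.sqrt_sq hR0.le, ← Real.sqrt_mul (sq_nonneg R), ← integral_const_mul]
    refine Real.sqrt_le_sqrt (integral_mono ?_ ?_ fun x => ?_)
    · exact (hxf.memLp volume).integrable_sq
    · exact ((hf.memLp volume).integrable_sq).const_mul _
    · dsimp only
      rw [mul_pow]
      by_cases hx : x ∈ Ω
      · refine mul_le_mul_of_nonneg_right (sq_le_sq' ?_ ?_) (sq_nonneg _)
        all_goals
          have h4 := hR hx
          rw [mem_ball_zero_iff] at h4
          have h5 := (PiLp.norm_apply_le x i).trans h4.le
          rw [Real.norm_eq_abs, abs_le] at h5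
        · exact h5.1
        · exact h5.2
      · rw [hf.eq_zero hx]; simp
  rw [hf.norm_toL2, (hf.pderiv i).norm_toL2]
  set N := √(∫ x, f x ^ 2)
  set P := √(∫ x, MixtureSystem.pderiv i f x ^ 2)
  have hN : N ^ 2 = ∫ x, f x ^ 2 := Real.sq_sqrt (integral_nonneg fun _ => sq_nonneg _)
  have hN0 : 0 ≤ N := Real.sqrt_nonneg _
  have hP0 : 0 ≤ P := Real.sqrt_nonneg _
  have h4 : N ^ 2 ≤ 2 * R * P * N := by
    have h5 := neg_le_abs (∫ x, MixtureSystem.pderiv i f x * (x i * f x))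
    have h6 := mul_le_mul_of_nonneg_left h3 hP0
    rw [hN, h1]
    linarith
  by_contra! h5
  have : 0 < N := lt_of_le_of_lt (by positivity) h5
  nlinarith

end Weak

/-! ### Families of diffeomorphisms preserving the domain -/

section Flow

variable {n : ℕ} {Ω : Set (Space n)}

/-- The `L²` norm of the gradient. -/
def gradNorm (f : Space n → ℝ) : ℝ := √(∫ x, ‖gradient f x‖ ^ 2)

/-- The Dirichlet form. -/
def dirichlet (f g : Space n → ℝ) : ℝ := ∫ x, inner ℝ (gradient f x) (gradient g x)

theorem gradient_apply (f : Space n → ℝ) (x : Space n) (i : Fin n) :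
    gradient f x i = pderiv i f x := by
  rw [pderiv, ← inner_gradient_left, EuclideanSpace.inner_single_right]
  simp

theorem inner_gradient_eq_sum (f g : Space n → ℝ) (x : Space n) :
    inner ℝ (gradient f x) (gradient g x) = ∑ i, pderiv i f x * pderiv i g x := by
  rw [PiLp.inner_apply]
  simp [gradient_apply, mul_comm]

theorem gradNorm_sq (f : Space n → ℝ) : gradNorm f ^ 2 = dirichlet f f := by
  rw [gradNorm, Real.sq_sqrt (integral_nonneg fun _ => by positivity), dirichlet]
  simp only [real_inner_self_eq_norm_sq]

namespace IsTest

variable {f g : Space n → ℝ}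

theorem continuous_gradient (hf : IsTest Ω f) : Continuous (gradient f) :=
  (InnerProductSpace.toDual ℝ (Space n)).symm.continuous.comp
    (hf.1.fderiv_right (m := 0) (by simp)).continuous

theorem hasCompactSupport_gradient (hf : IsTest Ω f) : HasCompactSupport (gradient f) :=
  (hf.2.1.fderiv (𝕜 := ℝ)).comp_left (g := (InnerProductSpace.toDual ℝ (Space n)).symm)
    (map_zero _)

theorem memLp_norm_gradient (hf : IsTest Ω f) : MemLp (fun x => ‖gradient f x‖) 2 volume :=
  (hf.continuous_gradient.memLp_of_hasCompactSupport hf.hasCompactSupport_gradient).norm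

theorem dirichlet_eq (hf : IsTest Ω f) (hg : IsTest Ω g) :
    dirichlet f g = ∑ i, inner ℝ (hf.pderiv i).toL2 (hg.pderiv i).toL2 := by
  simp only [dirichlet, inner_gradient_eq_sum]
  rw [integral_finsetSum]
  · refine Finset.sum_congr rfl fun i _ => ?_
    rw [IsTest.toL2, IsTest.toL2, inner_toLp,
      ((hg.pderiv i).mul_left (hf.pderiv i).1).integral_restrict]
  · intro i _
    exact ((hf.pderiv i).memLp volume).integrable_mul ((hg.pderiv i).memLp volume)

theorem gradNorm_sq_eq_sum (hf : IsTest Ω f) :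
    gradNorm f ^ 2 = ∑ i, ‖(hf.pderiv i).toL2‖ ^ 2 := by
  rw [gradNorm_sq, hf.dirichlet_eq hf]
  simp only [real_inner_self_eq_norm_sq]

theorem norm_pderiv_le (hf : IsTest Ω f) (i : Fin n) : ‖(hf.pderiv i).toL2‖ ≤ gradNorm f := by
  refine Real.le_sqrt_of_sq_le ?_ |>.trans_eq (Real.sqrt_sq (Real.sqrt_nonneg _))
  rw [hf.gradNorm_sq_eq_sum]
  exact Finset.single_le_sum (f := fun i => ‖(hf.pderiv i).toL2‖ ^ 2)
    (fun _ _ => sq_nonneg _) (Finset.mem_univ i)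

/-- The norm of `H10` is a supremum: it bounds each of the `n` components, and the `ℓ²` sum is at
most the `ℓ¹` sum. -/
theorem gradNorm_le (hf : IsTest Ω f) : gradNorm f ≤ n * ‖hf.toH10‖ := by
  have h1 : gradNorm f ≤ ∑ i, ‖(hf.pderiv i).toL2‖ := by
    refine abs_le_of_sq_le_sq' ?_ (Finset.sum_nonneg fun _ _ => norm_nonneg _) |>.2
    rw [hf.gradNorm_sq_eq_sum]
    exact Finset.sum_sq_le_sq_sum_of_nonneg fun _ _ => norm_nonneg _
  refine h1.trans ((Finset.sum_le_card_nsmul _ _ ‖hf.toH10‖ fun i _ => ?_).trans_eq (by simp))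
  exact (norm_le_pi_norm (fun i => (hf.pderiv i).toL2) i).trans (le_max_right _ _)

theorem toH10_sub (hf : IsTest Ω f) (hg : IsTest Ω g) :
    (hf.sub hg).toH10 = hf.toH10 - hg.toH10 := by
  refine Subtype.ext (Prod.ext rfl (funext fun i => Lp.ext ?_))
  have e := ((hf.pderiv i).memLp (volume.restrict Ω)).coeFn_toLp
  have e' := ((hg.pderiv i).memLp (volume.restrict Ω)).coeFn_toLp
  refine (((hf.sub hg).pderiv i).memLp (volume.restrict Ω)).coeFn_toLp.trans ?_
  refine EventuallyEq.trans ?_ (Lp.coeFn_sub _ _).symm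
  filter_upwards [e, e'] with x h1 h2
  exact (pderiv_sub hf.differentiable hg.differentiable i x).trans
    (congrArg₂ (· - ·) h1.symm h2.symm)

theorem dirichlet_sub_left {h : Space n → ℝ} (hf : IsTest Ω f) (hg : IsTest Ω g)
    (hh : IsTest Ω h) : dirichlet (fun x => f x - g x) h = dirichlet f h - dirichlet g h := by
  rw [(hf.sub hg).dirichlet_eq hh, hf.dirichlet_eq hh, hg.dirichlet_eq hh,
    ← Finset.sum_sub_distrib]
  refine Finset.sum_congr rfl fun i _ => ?_
  rw [← inner_sub_left]
  congr 1
  exact congrArg (fun u : H10 Ω => u.grad i) (hf.toH10_sub hg)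

end IsTest

theorem gradNorm_nonneg (f : Space n → ℝ) : 0 ≤ gradNorm f := Real.sqrt_nonneg _

/-- A family `Φₛ`, `|s| < r`, of diffeomorphisms of `ℝⁿ` preserving `Ω`, with velocity field `Vₛ`
and initial velocity `X`. -/
structure TangentFlow (Ω : Set (Space n)) (X : Space n → Space n) where
  /-- the diffeomorphisms -/
  Φ : ℝ → Space n → Space n
  /-- the velocity -/
  V : ℝ → Space n → Space n
  /-- the range of the parameter -/
  r : ℝ
  /-- a bound for the derivatives -/
  C : ℝ
  r_pos : 0 < r
  C_nonneg : 0 ≤ C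
  C_mul_le : C * r ≤ 1 / 2
  zero : ∀ x, Φ 0 x = x
  V_zero : ∀ x, V 0 x = X x
  contDiff : ∀ s, |s| < r → ContDiff ℝ ∞ (Φ s)
  exists_inv : ∀ s, |s| < r → ∃ Ψ : Space n → Space n, ContDiff ℝ ∞ Ψ ∧
    (∀ x, Ψ (Φ s x) = x) ∧ ∀ x, Φ s (Ψ x) = x
  mem_iff : ∀ s, |s| < r → ∀ x, Φ s x ∈ Ω ↔ x ∈ Ω
  norm_fderiv_sub_le : ∀ s, |s| < r → ∀ x,
    ‖fderiv ℝ (Φ s) x - ContinuousLinearMap.id ℝ _‖ ≤ C * |s|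
  abs_det_sub_le : ∀ s, |s| < r → ∀ x, |(|(fderiv ℝ (Φ s) x).det| - 1)| ≤ C * |s|
  hasDerivAt : ∀ s, |s| < r → ∀ x, HasDerivAt (fun s => Φ s x) (V s x) s
  norm_V_le : ∀ s, |s| < r → ∀ x, ‖V s x‖ ≤ C
  continuous_V : ∀ s, |s| < r → Continuous (V s)

namespace TangentFlow

variable {X : Space n → Space n} (F : TangentFlow Ω X) {s : ℝ}

/-- This keeps the derivative of `Φ s` within `1 / 2` of the identity and its absolute Jacobian
between `1 / 2` and `3 / 2`. -/
theorem C_mul_abs_le (hs : |s| < F.r) : F.C * |s| ≤ 1 / 2 :=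
  (mul_le_mul_of_nonneg_left hs.le F.C_nonneg).trans F.C_mul_le

/-- Here the invariance of `Ω` enters: a homeomorphism preserving `Ω` keeps supports compact and
inside it, so compositions remain admissible in the weak equation. -/
theorem isTest_comp (hs : |s| < F.r) {f : Space n → ℝ} (hf : IsTest Ω f) :
    IsTest Ω fun x => f (F.Φ s x) := by
  obtain ⟨Ψ, hΨ, h1, h2⟩ := F.exists_inv s hs
  let e : Space n ≃ₜ Space n := ⟨⟨F.Φ s, Ψ, h1, h2⟩, (F.contDiff s hs).continuous, hΨ.continuous⟩
  refine ⟨hf.1.comp (F.contDiff s hs), hf.2.1.comp_homeomorph e, fun x hx => ?_⟩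
  have hx' : x ∈ tsupport (f ∘ e) := hx
  rw [tsupport_comp_eq_preimage] at hx'
  exact (F.mem_iff s hs x).1 (hf.2.2 hx')

theorem exists_isTest_comp_eq (hs : |s| < F.r) {f : Space n → ℝ} (hf : IsTest Ω f) :
    ∃ g, IsTest Ω g ∧ ∀ x, g (F.Φ s x) = f x := by
  obtain ⟨Ψ, hΨ, h1, h2⟩ := F.exists_inv s hs
  let e : Space n ≃ₜ Space n := ⟨⟨Ψ, F.Φ s, h2, h1⟩, hΨ.continuous, (F.contDiff s hs).continuous⟩
  refine ⟨fun x => f (Ψ x), ⟨hf.1.comp hΨ, hf.2.1.comp_homeomorph e, fun x hx => ?_⟩,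
    fun x => by dsimp only; rw [h1]⟩
  have hx' : x ∈ tsupport (f ∘ e) := hx
  rw [tsupport_comp_eq_preimage] at hx'
  rw [← h2 x, F.mem_iff s hs]
  exact hf.2.2 hx'

theorem integral_eq (hs : |s| < F.r) (g : Space n → ℝ) :
    ∫ x, g x = ∫ x, |(fderiv ℝ (F.Φ s) x).det| * g (F.Φ s x) := by
  obtain ⟨Ψ, -, h1, h2⟩ := F.exists_inv s hs
  have h := integral_image_eq_integral_abs_det_fderiv_smul (volume : Measure (Space n))
    MeasurableSet.univ
    (fun x _ => ((F.contDiff s hs).differentiable (by simp) x).hasFDerivAt.hasFDerivWithinAt)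
    (Function.LeftInverse.injective h1).injOn g
  rw [image_univ, (Function.RightInverse.surjective h2).range_eq] at h
  simpa using h

theorem continuous_det (hs : |s| < F.r) :
    Continuous fun x => |(fderiv ℝ (F.Φ s) x).det| :=
  (ContinuousLinearMap.continuous_det.comp
    ((F.contDiff s hs).fderiv_right (m := 0) (by simp)).continuous).abs

/-- Change variables; the Jacobian is at least `1 / 2`. -/
theorem integral_comp_le (hs : |s| < F.r) {g : Space n → ℝ} (hg : Continuous g)
    (hgc : HasCompactSupport g) (h0 : ∀ x, 0 ≤ g x) :
    ∫ x, g (F.Φ s x) ≤ 2 * ∫ x, g x := by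
  obtain ⟨Ψ, hΨ, h1, h2⟩ := F.exists_inv s hs
  let e : Space n ≃ₜ Space n := ⟨⟨F.Φ s, Ψ, h1, h2⟩, (F.contDiff s hs).continuous, hΨ.continuous⟩
  have hc : Continuous fun x => g (F.Φ s x) := hg.comp (F.contDiff s hs).continuous
  have hcc : HasCompactSupport fun x => g (F.Φ s x) := hgc.comp_homeomorph e
  rw [F.integral_eq hs g, ← integral_const_mul]
  refine integral_mono (hc.integrable_of_hasCompactSupport hcc)
    (((F.continuous_det hs).mul hc).integrable_of_hasCompactSupport hcc.mul_left |>.const_mul 2)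
    fun x => ?_
  have h3 := (abs_le.1 ((F.abs_det_sub_le s hs x).trans (F.C_mul_abs_le hs))).1
  nlinarith [h0 (F.Φ s x)]

theorem gradient_comp (hs : |s| < F.r) {f : Space n → ℝ} (hf : IsTest Ω f) (x : Space n) :
    gradient (fun x => f (F.Φ s x)) x
      = ContinuousLinearMap.adjoint (fderiv ℝ (F.Φ s) x) (gradient f (F.Φ s x)) := by
  refine ext_inner_right ℝ fun v => ?_
  rw [inner_gradient_left, ContinuousLinearMap.adjoint_inner_left, inner_gradient_left]
  have := fderiv_comp x (hf.differentiable (F.Φ s x))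
    ((F.contDiff s hs).differentiable (by simp) x)
  exact congrArg (fun T : Space n →L[ℝ] ℝ => T v) this

/-- By the chain rule the difference is the adjoint of `DΦₛ - id` applied to the gradient at the
moved point. -/
theorem norm_gradient_comp_sub_le (hs : |s| < F.r) {f : Space n → ℝ} (hf : IsTest Ω f)
    (x : Space n) : ‖gradient (fun x => f (F.Φ s x)) x - gradient f (F.Φ s x)‖
      ≤ F.C * |s| * ‖gradient f (F.Φ s x)‖ := by
  have h1 : gradient (fun x => f (F.Φ s x)) x - gradient f (F.Φ s x)
      = ContinuousLinearMap.adjoint (fderiv ℝ (F.Φ s) x - ContinuousLinearMap.id ℝ _)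
        (gradient f (F.Φ s x)) := by
    rw [F.gradient_comp hs hf, map_sub, ContinuousLinearMap.adjoint_id, _root_.sub_apply,
      ContinuousLinearMap.id_apply]
  rw [h1]
  refine (ContinuousLinearMap.le_opNorm _ _).trans ?_
  rw [LinearIsometryEquiv.norm_map]
  exact mul_le_mul_of_nonneg_right (F.norm_fderiv_sub_le s hs x) (norm_nonneg _)

theorem integrable_of_comp (hs : |s| < F.r) {g : Space n → ℝ} (hg : Continuous g)
    (hgc : HasCompactSupport g) : Integrable fun x => g (F.Φ s x) := by
  obtain ⟨Ψ, hΨ, h1, h2⟩ := F.exists_inv s hs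
  let e : Space n ≃ₜ Space n := ⟨⟨F.Φ s, Ψ, h1, h2⟩, (F.contDiff s hs).continuous, hΨ.continuous⟩
  exact (hg.comp (F.contDiff s hs).continuous).integrable_of_hasCompactSupport
    (hgc.comp_homeomorph e)

/-- The Dirichlet form is almost invariant. -/
theorem abs_dirichlet_comp_sub_le (hs : |s| < F.r) {f g : Space n → ℝ} (hf : IsTest Ω f)
    (hg : IsTest Ω g) : |dirichlet (fun x => f (F.Φ s x)) (fun x => g (F.Φ s x)) - dirichlet f g|
      ≤ 8 * F.C * |s| * gradNorm f * gradNorm g := by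
  have hf' := F.isTest_comp hs hf
  have hg' := F.isTest_comp hs hg
  have hcc : ∀ {f g : Space n → ℝ}, IsTest Ω f → IsTest Ω g →
      Continuous (fun x => inner ℝ (gradient f x) (gradient g x)) ∧
      HasCompactSupport (fun x => inner ℝ (gradient f x) (gradient g x)) := fun hf hg =>
    ⟨hf.continuous_gradient.inner hg.continuous_gradient,
      hf.hasCompactSupport_gradient.mono' fun x hx => subset_closure fun h => hx (by simp [h])⟩
  have hi := (hcc hf' hg').1.integrable_of_hasCompactSupport (μ := volume) (hcc hf' hg').2
  have hc1 : Continuous fun x => ‖gradient f x‖ * ‖gradient g x‖ :=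
    hf.continuous_gradient.norm.mul hg.continuous_gradient.norm
  have hc2 : HasCompactSupport fun x => ‖gradient f x‖ * ‖gradient g x‖ :=
    hf.hasCompactSupport_gradient.norm.mul_right
  obtain ⟨Ψ, hΨ, h1, h2⟩ := F.exists_inv s hs
  let e : Space n ≃ₜ Space n := ⟨⟨F.Φ s, Ψ, h1, h2⟩, (F.contDiff s hs).continuous, hΨ.continuous⟩
  have hj : Integrable fun x => |(fderiv ℝ (F.Φ s) x).det| *
      inner ℝ (gradient f (F.Φ s x)) (gradient g (F.Φ s x)) :=
    ((F.continuous_det hs).mul ((hcc hf hg).1.comp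
      (F.contDiff s hs).continuous)).integrable_of_hasCompactSupport
        ((hcc hf hg).2.comp_homeomorph e).mul_left
  -- After the change of variables both forms are integrals over the same point. Two linear gradient
  -- errors, their product and the Jacobian error are each at most `C |s|` times the product of
  -- norms (the product by `C |s| ≤ 1`), giving `4`; `integral_comp_le` doubles it to `8`.
  have hpt : ∀ x, ‖inner ℝ (gradient (fun x => f (F.Φ s x)) x) (gradient (fun x => g (F.Φ s x)) x)
      - |(fderiv ℝ (F.Φ s) x).det| * inner ℝ (gradient f (F.Φ s x)) (gradient g (F.Φ s x))‖
      ≤ 4 * F.C * |s| * (‖gradient f (F.Φ s x)‖ * ‖gradient g (F.Φ s x)‖) := fun x => by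
    have e1 := F.norm_gradient_comp_sub_le hs hf x
    have e2 := F.norm_gradient_comp_sub_le hs hg x
    have e3 := F.abs_det_sub_le s hs x
    have e4 := F.C_mul_abs_le hs
    have e5 : 0 ≤ F.C * |s| := mul_nonneg F.C_nonneg (abs_nonneg _)
    set a' := gradient (fun x => f (F.Φ s x)) x
    set b' := gradient (fun x => g (F.Φ s x)) x
    set a := gradient f (F.Φ s x)
    set b := gradient g (F.Φ s x)
    set J := |(fderiv ℝ (F.Φ s) x).det|
    set ε := F.C * |s|
    have e6 : inner ℝ a' b' - J * inner ℝ a b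
        = inner ℝ (a' - a) (b' - b) + inner ℝ (a' - a) b + inner ℝ a (b' - b)
          - (J - 1) * inner ℝ a b := by
      simp only [inner_sub_left, inner_sub_right]; ring
    have ha := norm_nonneg a
    have hb := norm_nonneg b
    have i1 : ‖inner ℝ (a' - a) (b' - b)‖ ≤ (ε * ‖a‖) * (ε * ‖b‖) :=
      (norm_inner_le_norm _ _).trans (mul_le_mul e1 e2 (norm_nonneg _) (by positivity))
    have i2 : ‖inner ℝ (a' - a) b‖ ≤ (ε * ‖a‖) * ‖b‖ :=
      (norm_inner_le_norm _ _).trans (mul_le_mul_of_nonneg_right e1 hb)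
    have i3 : ‖inner ℝ a (b' - b)‖ ≤ ‖a‖ * (ε * ‖b‖) :=
      (norm_inner_le_norm _ _).trans (mul_le_mul_of_nonneg_left e2 ha)
    have i4 : ‖(J - 1) * inner ℝ a b‖ ≤ ε * (‖a‖ * ‖b‖) := by
      rw [norm_mul]
      exact mul_le_mul e3 (norm_inner_le_norm _ _) (norm_nonneg _) e5
    rw [e6]
    refine (norm_sub_le _ _).trans ?_
    have i5 := norm_add_le (inner ℝ (a' - a) (b' - b) + inner ℝ (a' - a) b) (inner ℝ a (b' - b))
    have i6 := norm_add_le (inner ℝ (a' - a) (b' - b)) (inner ℝ (a' - a) b)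
    have i7 : 0 ≤ ε * (‖a‖ * ‖b‖) := by positivity
    have i8 : (ε * ‖a‖) * (ε * ‖b‖) ≤ ε * (‖a‖ * ‖b‖) := by nlinarith
    linarith
  rw [dirichlet, dirichlet, F.integral_eq hs (fun x => inner ℝ (gradient f x) (gradient g x)),
    ← integral_sub hi hj, ← Real.norm_eq_abs]
  refine (norm_integral_le_of_norm_le ((F.integrable_of_comp hs hc1 hc2).const_mul
    (4 * F.C * |s|)) (Eventually.of_forall hpt)).trans ?_
  rw [integral_const_mul]
  have k1 := F.integral_comp_le hs hc1 hc2 fun x => by positivity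
  have k2 := (le_abs_self _).trans (abs_integral_mul_le hf.memLp_norm_gradient
    hg.memLp_norm_gradient)
  have k3 : 0 ≤ 4 * F.C * |s| := by have := F.C_nonneg; positivity
  calc _ ≤ 4 * F.C * |s| * (2 * (gradNorm f * gradNorm g)) :=
        mul_le_mul_of_nonneg_left (k1.trans (by unfold gradNorm; linarith)) k3
    _ = _ := by ring

/-- Pointwise, the gradient at the moved point is at most twice the gradient of the composition, and
the Jacobian is at most `3 / 2`. The squared factor `6` is rounded up to the perfect square `9`. -/
theorem gradNorm_le_comp (hs : |s| < F.r) {f : Space n → ℝ} (hf : IsTest Ω f) :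
    gradNorm f ≤ 3 * gradNorm (fun x => f (F.Φ s x)) := by
  have hf' := F.isTest_comp hs hf
  have h1 : ∫ x, ‖gradient f x‖ ^ 2 ≤ 9 * ∫ x, ‖gradient (fun x => f (F.Φ s x)) x‖ ^ 2 := by
    rw [F.integral_eq hs, ← integral_const_mul]
    refine integral_mono_of_nonneg (Eventually.of_forall fun x => by positivity)
      (hf'.memLp_norm_gradient.integrable_sq.const_mul 9) (Eventually.of_forall fun x => ?_)
    have e1 := F.norm_gradient_comp_sub_le hs hf x
    have e3 := (abs_le.1 (F.abs_det_sub_le s hs x)).2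
    have e4 := F.C_mul_abs_le hs
    dsimp only
    set a' := gradient (fun x => f (F.Φ s x)) x
    set a := gradient f (F.Φ s x)
    have e5 := norm_sub_norm_le a (a - a')
    rw [sub_sub_cancel, norm_sub_rev] at e5
    have e6 := norm_nonneg a
    have e7 : ‖a‖ ≤ 2 * ‖a'‖ := by nlinarith
    have e8 : ‖a‖ ^ 2 ≤ 4 * ‖a'‖ ^ 2 := by nlinarith
    nlinarith [sq_nonneg ‖a'‖, sq_nonneg ‖a‖]
  rw [gradNorm, gradNorm, show (3 : ℝ) = √9 by
    rw [show (9 : ℝ) = 3 ^ 2 by norm_num, Real.sqrt_sq (by norm_num)],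
    ← Real.sqrt_mul (by norm_num)]
  exact Real.sqrt_le_sqrt h1

end TangentFlow

end Flow

/-! ### Difference quotients of weak solutions along a flow -/

section Flow

variable {n : ℕ} {Ω : Set (Space n)}

namespace IsTest

variable {f g : Space n → ℝ}

theorem inner_toL2_toL2 (hf : IsTest Ω f) (hg : IsTest Ω g) :
    inner ℝ hf.toL2 hg.toL2 = ∫ x, f x * g x := by
  rw [IsTest.toL2, IsTest.toL2, inner_toLp, (hg.mul_left hf.1).integral_restrict]

theorem abs_sum_inner_sub_dirichlet_le (hf : IsTest Ω f) (hg : IsTest Ω g) (w : H10 Ω) :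
    |dirichlet f g - ∑ i, inner ℝ (w.grad i) (hg.pderiv i).toL2|
      ≤ n * ‖w - hf.toH10‖ * gradNorm g := by
  rw [hf.dirichlet_eq hg, ← Finset.sum_sub_distrib]
  refine (Finset.abs_sum_le_sum_abs _ _).trans
    ((Finset.sum_le_card_nsmul _ _ (‖w - hf.toH10‖ * gradNorm g) fun i _ => ?_).trans_eq ?_)
  · rw [← inner_sub_left, ← norm_neg (w - hf.toH10), neg_sub]
    refine (abs_real_inner_le_norm _ _).trans (mul_le_mul ?_ (hg.norm_pderiv_le i)
      (norm_nonneg _) (norm_nonneg _))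
    exact (norm_le_pi_norm (hf.toH10 - w).1.2 i).trans (le_max_right _ _)
  · simp; ring

/-- Test functions are dense in `H¹₀(Ω)`. -/
theorem exists_norm_sub_lt (w : H10 Ω) {ε : ℝ} (hε : 0 < ε) :
    ∃ (f : Space n → ℝ) (hf : IsTest Ω f), ‖w - hf.toH10‖ < ε := by
  obtain ⟨v, ⟨f, hf, h1, h2⟩, hv⟩ := Metric.mem_closure_iff.1 w.2 ε hε
  refine ⟨f, hf, ?_⟩
  have : v = (hf.toH10 : H10 Ω).1 := Prod.ext (hf.ae_eq_toL2 h1)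
    (funext fun i => (hf.pderiv i).ae_eq_toL2 (h2 i))
  rw [this, dist_eq_norm] at hv
  exact hv

end IsTest

namespace TangentFlow

variable {X : Space n → Space n} (F : TangentFlow Ω X) {s : ℝ}

theorem hasDerivAt_integral (hs : |s| < F.r) {f θ : Space n → ℝ} (hf : IsTest Ω f)
    (hθ : Continuous θ) (hθc : HasCompactSupport θ) :
    HasDerivAt (fun s => ∫ x, f (F.Φ s x) * θ x)
      (∫ x, inner ℝ (gradient f (F.Φ s x)) (F.V s x) * θ x) s := by
  obtain ⟨K, hK⟩ := hf.hasCompactSupport_gradient.exists_bound_of_continuous hf.continuous_gradient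
  have hopen : {s : ℝ | |s| < F.r} ∈ 𝓝 s :=
    (isOpen_lt continuous_abs continuous_const).mem_nhds hs
  have hcont : ∀ s, |s| < F.r → Continuous fun x => f (F.Φ s x) * θ x := fun s hs =>
    (hf.continuous.comp (F.contDiff s hs).continuous).mul hθ
  refine (hasDerivAt_integral_of_dominated_loc_of_deriv_le (F := fun s x => f (F.Φ s x) * θ x)
    (F' := fun s x => inner ℝ (gradient f (F.Φ s x)) (F.V s x) * θ x)
    (bound := fun x => K * F.C * ‖θ x‖) hopen ?_ ?_ ?_ ?_ ?_ ?_).2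
  · filter_upwards [hopen] with s hs using (hcont s hs).aestronglyMeasurable
  · exact (hcont s hs).integrable_of_hasCompactSupport hθc.mul_left
  · exact (((hf.continuous_gradient.comp (F.contDiff s hs).continuous).inner
      (F.continuous_V s hs)).mul hθ).aestronglyMeasurable
  · refine Eventually.of_forall fun x s hs => ?_
    rw [norm_mul]
    refine mul_le_mul_of_nonneg_right ((norm_inner_le_norm _ _).trans ?_) (norm_nonneg _)
    exact mul_le_mul (hK _) (F.norm_V_le s hs x) (norm_nonneg _) ((norm_nonneg _).trans (hK 0))
  · exact (hθ.norm.integrable_of_hasCompactSupport hθc.norm).const_mul _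
  · refine Eventually.of_forall fun x s hs => ?_
    have h1 := ((hf.differentiable (F.Φ s x)).hasFDerivAt.comp_hasDerivAt s
      (F.hasDerivAt s hs x)).mul_const (θ x)
    rw [inner_gradient_left]
    exact h1

/-- Mean value inequality in the flow parameter: the derivative pairs `∇f ∘ Φ` with the velocity
times `θ`, and Cauchy–Schwarz bounds it uniformly. -/
theorem abs_integral_comp_sub_le (hs : |s| < F.r) {f θ : Space n → ℝ} (hf : IsTest Ω f)
    (hθ : Continuous θ) (hθc : HasCompactSupport θ) :
    |∫ x, (f (F.Φ s x) - f x) * θ x| ≤ 2 * F.C * |s| * gradNorm f * √(∫ x, θ x ^ 2) := by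
  have hmem : ∀ y ∈ uIcc 0 s, |y| < F.r := fun y hy => by
    refine lt_of_le_of_lt ?_ hs
    have := abs_sub_left_of_mem_uIcc hy
    simpa using this
  have hbound : ∀ y ∈ uIcc 0 s, ‖∫ x, inner ℝ (gradient f (F.Φ y x)) (F.V y x) * θ x‖
      ≤ 2 * F.C * gradNorm f * √(∫ x, θ x ^ 2) := fun y hy => by
    have hy := hmem y hy
    have hc1 : Continuous fun x => ‖gradient f x‖ ^ 2 := hf.continuous_gradient.norm.pow 2
    have hc2 : HasCompactSupport fun x => ‖gradient f x‖ ^ 2 :=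
      hf.hasCompactSupport_gradient.norm.comp_left (g := fun t : ℝ => t ^ 2) (by simp)
    have hm : MemLp (fun x => ‖gradient f (F.Φ y x)‖) 2 volume := by
      refine (memLp_two_iff_integrable_sq ?_).2 (F.integrable_of_comp hy hc1 hc2)
      exact (hf.continuous_gradient.comp
        (F.contDiff y hy).continuous).norm.aestronglyMeasurable
    have hθm : MemLp (fun x => ‖θ x‖) 2 volume := (hθ.memLp_of_hasCompactSupport hθc).norm
    have h1 := F.integral_comp_le hy hc1 hc2 fun x => by positivity
    refine (norm_integral_le_of_norm_le (g := fun x => F.C * (‖gradient f (F.Φ y x)‖ * ‖θ x‖))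
      ((hm.integrable_mul hθm).const_mul F.C) (Eventually.of_forall fun x => ?_)).trans ?_
    · rw [norm_mul, ← mul_assoc]
      refine mul_le_mul_of_nonneg_right ((norm_inner_le_norm _ _).trans ?_) (norm_nonneg _)
      rw [mul_comm]
      exact mul_le_mul_of_nonneg_right (F.norm_V_le y hy x) (norm_nonneg _)
    · rw [integral_const_mul]
      have h2 := (le_abs_self _).trans (abs_integral_mul_le hm hθm)
      have h3 : √(∫ x, ‖gradient f (F.Φ y x)‖ ^ 2) ≤ 2 * gradNorm f := by
        rw [gradNorm, show (2 : ℝ) = √4 by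
          rw [show (4 : ℝ) = 2 ^ 2 by norm_num, Real.sqrt_sq (by norm_num)],
          ← Real.sqrt_mul (by norm_num)]
        refine Real.sqrt_le_sqrt (h1.trans ?_)
        have : 0 ≤ ∫ x, ‖gradient f x‖ ^ 2 := integral_nonneg fun x => by positivity
        linarith
      simp only [Real.norm_eq_abs, sq_abs] at h2 h3 ⊢
      calc _ ≤ F.C * (2 * gradNorm f * √(∫ x, θ x ^ 2)) :=
            mul_le_mul_of_nonneg_left (h2.trans
              (mul_le_mul_of_nonneg_right h3 (Real.sqrt_nonneg _))) F.C_nonneg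
        _ = _ := by ring
  have h := (convex_uIcc 0 s).norm_image_sub_le_of_norm_hasDerivWithin_le
    (fun y hy => (F.hasDerivAt_integral (hmem y hy) hf hθ hθc).hasDerivWithinAt) hbound
    left_mem_uIcc right_mem_uIcc
  have hi : ∀ y, |y| < F.r → Integrable fun x => f (F.Φ y x) * θ x := fun y hy =>
    ((hf.continuous.comp (F.contDiff y hy).continuous).mul hθ).integrable_of_hasCompactSupport
      hθc.mul_left
  rw [← integral_sub (hi s hs) (hi 0 (by simpa using F.r_pos))] at h
  simp only [F.zero, ← sub_mul, Real.norm_eq_abs, sub_zero] at h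
  calc _ ≤ _ := h
    _ = _ := by ring

/-- Take `θ` in the previous estimate to be the difference itself and cancel one factor of its norm.
-/
theorem norm_comp_sub_le (hs : |s| < F.r) {f : Space n → ℝ} (hf : IsTest Ω f) :
    ‖((F.isTest_comp hs hf).sub hf).toL2‖ ≤ 2 * F.C * |s| * gradNorm f := by
  have hg := (F.isTest_comp hs hf).sub hf
  have h := (le_abs_self _).trans (F.abs_integral_comp_sub_le hs hf hg.continuous hg.2.1)
  rw [← hg.norm_toL2, ← hg.inner_toL2_toL2 hg, real_inner_self_eq_norm_sq] at h
  by_contra! h1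
  have h2 : 0 ≤ 2 * F.C * |s| * gradNorm f :=
    mul_nonneg (mul_nonneg (mul_nonneg zero_le_two F.C_nonneg) (abs_nonneg _)) (gradNorm_nonneg _)
  nlinarith

/-- Difference quotients along the flow, of an approximation to a weak solution, are bounded. -/
theorem gradNorm_comp_sub_le (hs : |s| < F.r) (w : H10 Ω) (f : L2 Ω)
    (hw : ∀ φ (hφ : IsTest Ω φ), ∑ i, inner ℝ (w.grad i) (hφ.pderiv i).toL2
      = inner ℝ f hφ.toL2) {g : Space n → ℝ} (hg : IsTest Ω g) (hgw : ‖w - hg.toH10‖ ≤ |s|) :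
    gradNorm (fun x => g (F.Φ s x) - g x)
      ≤ |s| * (24 * F.C * gradNorm g + 4 * n + 6 * F.C * ‖f‖) := by
  have hgc := F.isTest_comp hs hg
  have hδ := hgc.sub hg
  set δ : Space n → ℝ := fun x => g (F.Φ s x) - g x with hδdef
  -- Pull the difference back, `δ = ψ ∘ Φ`. Then `‖∇δ‖²` is the Dirichlet form of `(g ∘ Φ, ψ ∘ Φ)`
  -- minus that of `(g, δ)`; near invariance replaces the first by that of `(g, ψ)`, and the weak
  -- equation leaves `⟨f, ψ - δ⟩`. As `ψ - δ = ψ - ψ ∘ Φ`, every error is of order `|s| ‖∇δ‖`. The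
  -- closeness of `g` to `w` within `|s|` makes the approximation error of that order too.
  obtain ⟨ψ, hψ, hψδ⟩ := F.exists_isTest_comp_eq hs hδ
  have hψδ' : (fun x => ψ (F.Φ s x)) = δ := funext hψδ
  have e1 : gradNorm ψ ≤ 3 * gradNorm δ := by
    have := F.gradNorm_le_comp hs hψ
    rwa [hψδ'] at this
  have e2 : gradNorm δ ^ 2 = dirichlet (fun x => g (F.Φ s x)) δ - dirichlet g δ := by
    rw [gradNorm_sq, ← hgc.dirichlet_sub_left hg hδ]
  have e3 := (abs_le.1 (F.abs_dirichlet_comp_sub_le hs hg hψ)).2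
  rw [hψδ'] at e3
  have e4 := (abs_le.1 (hg.abs_sum_inner_sub_dirichlet_le hψ w)).2
  have e5 := (abs_le.1 (hg.abs_sum_inner_sub_dirichlet_le hδ w)).1
  rw [hw ψ hψ] at e4
  rw [hw δ hδ] at e5
  have e6 := F.norm_comp_sub_le hs hψ
  have e7 : inner ℝ f hψ.toL2 - inner ℝ f hδ.toL2
      ≤ ‖f‖ * (2 * F.C * |s| * gradNorm ψ) := by
    have e8 : inner ℝ f hψ.toL2 - inner ℝ f hδ.toL2
        = -inner ℝ f ((F.isTest_comp hs hψ).sub hψ).toL2 := by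
      have : ((F.isTest_comp hs hψ).sub hψ).toL2 = hδ.toL2 - hψ.toL2 := by
        rw [show hδ.toL2 - hψ.toL2 = (hδ.sub hψ).toL2 from rfl]
        simp only [hψδ]
      rw [this, inner_sub_right]; ring
    rw [e8]
    refine (neg_le_abs _).trans ((abs_real_inner_le_norm _ _).trans ?_)
    exact mul_le_mul_of_nonneg_left e6 (norm_nonneg _)
  have hC := F.C_nonneg
  have hs0 := abs_nonneg s
  have hNδ := gradNorm_nonneg δ
  have hNψ := gradNorm_nonneg ψ
  have hNg := gradNorm_nonneg g
  have hf0 := norm_nonneg f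
  have k1 : (n : ℝ) * ‖w - hg.toH10‖ * gradNorm ψ ≤ n * |s| * (3 * gradNorm δ) := by gcongr
  have k2 : (n : ℝ) * ‖w - hg.toH10‖ * gradNorm δ ≤ n * |s| * gradNorm δ := by gcongr
  have k3 : 8 * F.C * |s| * gradNorm g * gradNorm ψ
      ≤ 8 * F.C * |s| * gradNorm g * (3 * gradNorm δ) := by gcongr
  have k4 : ‖f‖ * (2 * F.C * |s| * gradNorm ψ) ≤ ‖f‖ * (2 * F.C * |s| * (3 * gradNorm δ)) := by
    gcongr
  -- The constants are `8 · 3`, `3 n + n` and `2 · 3`, each `3` being the cost of passing from `ψ`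
  -- to `δ`.
  have k5 : gradNorm δ ^ 2 ≤ |s| * (24 * F.C * gradNorm g + 4 * n + 6 * F.C * ‖f‖)
      * gradNorm δ := by
    rw [e2]; linarith
  by_contra! k6
  have k7 : 0 ≤ |s| * (24 * F.C * gradNorm g + 4 * n + 6 * F.C * ‖f‖) := by positivity
  nlinarith

/-- The derivative of a weak solution along a tangent field has weak derivatives in `L²`. -/
theorem exists_bound (F : TangentFlow Ω X) (hX : ∀ i, ContDiff ℝ ∞ fun x => X x i) (w : H10 Ω) (f : L2 Ω)
    (hw : ∀ φ (hφ : IsTest Ω φ), ∑ i, inner ℝ (w.grad i) (hφ.pderiv i).toL2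
      = inner ℝ f hφ.toL2) : ∃ K : ℝ, ∀ l φ (hφ : IsTest Ω φ),
      |∑ i, inner ℝ (w.grad i) ((hφ.pderiv l).mul_left (hX i)).toL2| ≤ K * ‖hφ.toL2‖ := by
  set K : ℝ := 24 * F.C * (n * (‖w‖ + 1)) + 4 * n + 6 * F.C * ‖f‖ with hK
  refine ⟨K, fun l φ hφ => ?_⟩
  have hC := F.C_nonneg
  have hθ := hφ.pderiv l
  set θ := pderiv l φ
  set T := ∑ i, ‖(hθ.mul_left (hX i)).toL2‖ with hT
  have hT0 : 0 ≤ T := Finset.sum_nonneg fun _ _ => norm_nonneg _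
  -- `M` sums the coefficients of `η` in the three error terms below, so that they add up to exactly
  -- `ε`.
  set M : ℝ := T + 1 + 4 * F.C * n * ‖hθ.toL2‖ with hM
  have hM0 : 0 < M := by positivity
  refine le_of_forall_pos_le_add fun ε hε => ?_
  set η := ε / M with hη
  have hη0 : 0 < η := by positivity
  -- Two approximants are needed. This one is fixed before `h`, so its difference quotient converges
  -- as `h → 0`; the later `g` depends on `h`, because the uniform gradient bound needs an
  -- approximation error at most `h`.
  obtain ⟨g₀, hg₀, hwg₀⟩ := IsTest.exists_norm_sub_lt w hη0
  have h0 : |(0 : ℝ)| < F.r := by simpa using F.r_pos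
  have hder := F.hasDerivAt_integral h0 hg₀ hθ.continuous hθ.2.1
  simp only [F.zero, F.V_zero] at hder
  have hI₀ : ∫ x, inner ℝ (gradient g₀ x) (X x) * θ x
      = ∑ i, inner ℝ (hg₀.pderiv i).toL2 (hθ.mul_left (hX i)).toL2 := by
    simp only [IsTest.inner_toL2_toL2]
    rw [← integral_finsetSum]
    · refine integral_congr_ae (Eventually.of_forall fun x => ?_)
      simp only [PiLp.inner_apply, gradient_apply, Finset.sum_mul]
      refine Finset.sum_congr rfl fun i _ => ?_
      simp; ring
    · intro i _
      exact ((hg₀.pderiv i).memLp volume).integrable_mul ((hθ.mul_left (hX i)).memLp volume)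
  rw [hI₀] at hder
  obtain ⟨h, hh0, hhr, hh1, hhd⟩ : ∃ h : ℝ, 0 < h ∧ h < F.r ∧ h ≤ 1 ∧
      |h⁻¹ * (∫ x, (g₀ (F.Φ h x) - g₀ x) * θ x)
        - ∑ i, inner ℝ (hg₀.pderiv i).toL2 (hθ.mul_left (hX i)).toL2| < η := by
    have h1 := (hasDerivAt_iff_tendsto_slope_zero.1 hder)
    have h2 := h1.mono_left (nhdsWithin_mono 0
      (show Ioi (0 : ℝ) ⊆ {0}ᶜ from fun x hx => ne_of_gt hx))
    have h3 := (Metric.tendsto_nhds.1 h2 η hη0).and (Ioc_mem_nhdsGT (lt_min F.r_pos one_pos))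
    have h4 : ∀ᶠ h in 𝓝[>] (0 : ℝ), h < F.r :=
      mem_nhdsWithin_of_mem_nhds (Iio_mem_nhds F.r_pos)
    obtain ⟨h, ⟨h5, h6⟩, h7⟩ := (h3.and h4).exists
    refine ⟨h, h6.1, h7, h6.2.trans (min_le_right _ _), ?_⟩
    have hhr : |h| < F.r := by rwa [abs_of_pos h6.1]
    rw [Real.dist_eq, zero_add, smul_eq_mul] at h5
    convert h5 using 4
    rw [← integral_sub]
    · simp only [F.zero, sub_mul]
    · exact (hθ.mul_left (F.isTest_comp hhr hg₀).1).continuous.integrable_of_hasCompactSupport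
        hθ.2.1.mul_left
    · simp only [F.zero]
      exact (hθ.mul_left hg₀.1).continuous.integrable_of_hasCompactSupport hθ.2.1.mul_left
  have hhr' : |h| < F.r := by rwa [abs_of_pos hh0]
  obtain ⟨g, hg, hwg⟩ := IsTest.exists_norm_sub_lt w (lt_min hh0 hη0)
  have hgc := F.isTest_comp hhr' hg
  have hδ := hgc.sub hg
  -- the difference quotient of `g`
  have s1 : |h⁻¹ * ∫ x, (g (F.Φ h x) - g x) * θ x| ≤ K * ‖hφ.toL2‖ := by
    have t1 := F.gradNorm_comp_sub_le hhr' w f hw hg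
      ((hwg.le.trans (min_le_left _ _)).trans (le_abs_self h))
    have t2 : gradNorm g ≤ n * (‖w‖ + 1) := by
      refine hg.gradNorm_le.trans (mul_le_mul_of_nonneg_left ?_ (by positivity))
      have := norm_sub_norm_le hg.toH10 w
      rw [norm_sub_rev] at this
      linarith [hwg.le.trans (min_le_left _ _)]
    have t3 : gradNorm (fun x => g (F.Φ h x) - g x) ≤ h * K := by
      rw [abs_of_pos hh0] at t1
      refine t1.trans (mul_le_mul_of_nonneg_left ?_ hh0.le)
      have : 24 * F.C * gradNorm g ≤ 24 * F.C * (n * (‖w‖ + 1)) := by gcongr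
      linarith
    -- Moving `∂ₗ` onto the difference lets its gradient bound act and leaves only the `L²` norm of
    -- `φ`.
    have t4 : ∫ x, (g (F.Φ h x) - g x) * θ x = -inner ℝ (hδ.pderiv l).toL2 hφ.toL2 := by
      rw [← hδ.inner_toL2_toL2 hθ]
      exact hδ.inner_pderiv_toL2 hφ l
    rw [t4, abs_mul, abs_neg, abs_of_pos (inv_pos.2 hh0), inv_mul_le_iff₀ hh0, ← mul_assoc]
    exact (abs_real_inner_le_norm _ _).trans (mul_le_mul_of_nonneg_right
      ((hδ.norm_pderiv_le l).trans t3) (norm_nonneg _))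
  -- the two difference quotients are close
  have s2 : |h⁻¹ * (∫ x, (g₀ (F.Φ h x) - g₀ x) * θ x)
      - h⁻¹ * ∫ x, (g (F.Φ h x) - g x) * θ x| ≤ 4 * F.C * n * ‖hθ.toL2‖ * η := by
    have hd := hg₀.sub hg
    have t1 := F.abs_integral_comp_sub_le hhr' hd hθ.continuous hθ.2.1
    rw [← hθ.norm_toL2] at t1
    have t2 : gradNorm (fun x => g₀ x - g x) ≤ n * (2 * η) := by
      refine hd.gradNorm_le.trans (mul_le_mul_of_nonneg_left ?_ (by positivity))
      rw [hg₀.toH10_sub hg, ← sub_sub_sub_cancel_left hg.toH10 hg₀.toH10 w]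
      refine (norm_sub_le _ _).trans ?_
      linarith [hwg.le.trans (min_le_right _ _)]
    have t3 : ∫ x, ((g₀ (F.Φ h x) - g (F.Φ h x)) - (g₀ x - g x)) * θ x
        = (∫ x, (g₀ (F.Φ h x) - g₀ x) * θ x) - ∫ x, (g (F.Φ h x) - g x) * θ x := by
      rw [← integral_sub]
      · congr 1; ext x; ring
      · exact (hθ.mul_left ((F.isTest_comp hhr' hg₀).sub hg₀).1).continuous
          |>.integrable_of_hasCompactSupport hθ.2.1.mul_left
      · exact (hθ.mul_left hδ.1).continuous.integrable_of_hasCompactSupport hθ.2.1.mul_left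
    rw [t3, abs_of_pos hh0] at t1
    rw [← mul_sub, abs_mul, abs_of_pos (inv_pos.2 hh0), inv_mul_le_iff₀ hh0]
    refine t1.trans ?_
    have : 2 * F.C * h * gradNorm (fun x => g₀ x - g x) * ‖hθ.toL2‖
        ≤ 2 * F.C * h * (n * (2 * η)) * ‖hθ.toL2‖ := by gcongr
    linarith
  have s3 : |∑ i, inner ℝ (w.grad i) (hθ.mul_left (hX i)).toL2
      - ∑ i, inner ℝ (hg₀.pderiv i).toL2 (hθ.mul_left (hX i)).toL2| ≤ η * T := by
    rw [← Finset.sum_sub_distrib, hT, Finset.mul_sum]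
    refine (Finset.abs_sum_le_sum_abs _ _).trans (Finset.sum_le_sum fun i _ => ?_)
    rw [← inner_sub_left]
    refine (abs_real_inner_le_norm _ _).trans (mul_le_mul_of_nonneg_right ?_ (norm_nonneg _))
    exact ((norm_le_pi_norm (w - hg₀.toH10).1.2 i).trans (le_max_right _ _)).trans hwg₀.le
  have s4 : ε = η * T + η + 4 * F.C * n * ‖hθ.toL2‖ * η := by
    rw [hη, hM]; field_simp
  rw [s4]
  rw [abs_le] at *
  constructor <;> linarith [s1.1, s1.2, s2.1, s2.2, s3.1, s3.2, hhd.le, (abs_lt.1 hhd).1, (abs_lt.1 hhd).2]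

end TangentFlow

end Flow

/-! ### Construction of flows that preserve the domain -/

section Construction

/-- By the Leibniz formula the determinant is a polynomial in the matrix entries. -/
theorem contDiff_det {n : ℕ} :
    ContDiff ℝ ∞ (ContinuousLinearMap.det : (Space n →L[ℝ] Space n) → ℝ) := by
  have h : (ContinuousLinearMap.det : (Space n →L[ℝ] Space n) → ℝ) = fun A =>
      ∑ σ : Equiv.Perm (Fin n), (Equiv.Perm.sign σ : ℤ) •
        ∏ i, (A (EuclideanSpace.single i 1)) (σ i) := by
    ext A
    rw [ContinuousLinearMap.det, ← LinearMap.det_toMatrix (EuclideanSpace.basisFun (Fin n) ℝ).toBasis,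
      Matrix.det_apply]
    refine Finset.sum_congr rfl fun σ _ => congrArg _ (Finset.prod_congr rfl fun i _ => ?_)
    simp [LinearMap.toMatrix_apply]
  rw [h]
  refine ContDiff.sum fun σ _ => ContDiff.const_smul _ (contDiff_prod fun i _ => ?_)
  fun_prop

/-- A smooth family which is constant at time zero and outside a compact set is uniformly
Lipschitz in time. -/
theorem exists_norm_sub_le_mul_abs {E F : Type*} [NormedAddCommGroup E] [NormedSpace ℝ E]
    [NormedAddCommGroup F] [NormedSpace ℝ F] {G : ℝ × E → F} {r : ℝ} {K : Set E} {c : F}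
    (hr : 0 < r) (hK : IsCompact K) (hG : ContDiffOn ℝ 1 G (Ioo (-r) r ×ˢ univ))
    (h0 : ∀ x, G (0, x) = c) (hc : ∀ s, |s| < r → ∀ x ∉ K, G (s, x) = c) :
    ∃ C : ℝ, 0 ≤ C ∧ ∀ s, |s| ≤ r / 2 → ∀ x, ‖G (s, x) - c‖ ≤ C * |s| := by
  have hU : IsOpen (Ioo (-r) r ×ˢ (univ : Set E)) := isOpen_Ioo.prod isOpen_univ
  have hsub : Icc (-(r / 2)) (r / 2) ×ˢ K ⊆ Ioo (-r) r ×ˢ univ := fun p hp =>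
    ⟨⟨by linarith [hp.1.1], by linarith [hp.1.2]⟩, trivial⟩
  -- Halving the time interval gives a compact set inside the open set where `G` is continuously
  -- differentiable.
  obtain ⟨C, hC⟩ := (isCompact_Icc.prod hK).exists_bound_of_continuousOn
    ((hG.continuousOn_fderiv_of_isOpen hU le_rfl).mono hsub)
  refine ⟨max C 0, le_max_right _ _, fun s hs x => ?_⟩
  by_cases hx : x ∈ K
  · have hmem : ∀ y ∈ uIcc 0 s, y ∈ Icc (-(r / 2)) (r / 2) := fun y hy => by
      refine abs_le.1 (le_trans ?_ hs)
      simpa using abs_sub_left_of_mem_uIcc hy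
    have h := (convex_uIcc 0 s).norm_image_sub_le_of_norm_hasDerivWithin_le
      (f := fun y => G (y, x)) (f' := fun y => fderiv ℝ G (y, x) (1, 0)) (C := max C 0)
      (fun y hy => ?_) (fun y hy => ?_) left_mem_uIcc right_mem_uIcc
    · simpa [h0] using h
    · have hy' := hsub (mk_mem_prod (hmem y hy) hx)
      have h1 := ((hG.differentiableOn one_ne_zero).differentiableAt (hU.mem_nhds hy')).hasFDerivAt
      exact (h1.comp_hasDerivAt y
        ((hasDerivAt_id y).prodMk (hasDerivAt_const y x))).hasDerivWithinAt
    · refine (ContinuousLinearMap.le_opNorm _ _).trans ?_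
      have h2 := hC (y, x) (mk_mem_prod (hmem y hy) hx)
      simp only [Prod.norm_def, norm_one, norm_zero, zero_le_one, max_eq_left, mul_one]
      exact h2.trans (le_max_left _ _)
  · rw [hc s (by linarith [abs_nonneg s]) x hx]
    simp; positivity

variable {n : ℕ} {Ω : Set (Space n)}

/-- A compactly supported vector field in a chart generates a flow of diffeomorphisms, provided
that moving along it in the chart does not leave `Ω`. -/
theorem nonempty_tangentFlow (e : OpenPartialHomeomorph (Space n) (Space n))
    (he : ContDiffOn ℝ ∞ e e.source) (he' : ContDiffOn ℝ ∞ e.symm e.target)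
    {X : Space n → Space n} (hX : ContDiff ℝ ∞ X) (hXc : HasCompactSupport X)
    (hXs : tsupport X ⊆ e.source)
    (hΩ : ∀ x ∈ e.source, ∀ s : ℝ, e x + s • fderiv ℝ e x (X x) ∈ e.target →
      (e.symm (e x + s • fderiv ℝ e x (X x)) ∈ Ω ↔ x ∈ Ω)) :
    Nonempty (TangentFlow Ω X) := by
  classical
  set K := tsupport X with hK
  have hKc : IsCompact K := hXc
  have hX0 : ∀ x ∉ K, X x = 0 := fun x hx => image_eq_zero_of_notMem_tsupport hx
  -- The field seen in the chart. Points move along straight segments `e x + s Z x` there, so no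
  -- differential equation is solved; only the velocity at `s = 0` has to equal `X`.
  set Z : Space n → Space n := fun x => fderiv ℝ e x (X x) with hZdef
  have hZ0 : ∀ x ∉ K, Z x = 0 := fun x hx => by simp [hZdef, hX0 x hx]
  have hcover : e.source ∪ Kᶜ = univ :=
    eq_univ_of_forall fun x => (em (x ∈ K)).imp (fun h => hXs h) id
  have hKo : IsOpen Kᶜ := (isClosed_tsupport X).isOpen_compl
  have hZ : ContDiff ℝ ∞ Z := by
    refine contDiff_of_contDiffOn_union_of_isOpen (s := e.source) (t := Kᶜ) ?_ ?_ hcover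
      e.open_source hKo
    · exact (he.fderiv_of_isOpen e.open_source (by simp)).clm_apply hX.contDiffOn
    · exact (contDiffOn_const (c := 0)).congr fun x hx => hZ0 x hx
  obtain ⟨b, hb⟩ := hKc.exists_bound_of_continuousOn hZ.continuous.continuousOn
  -- The image of the support has a uniform neighbourhood inside the chart target, so for short
  -- times the segments do not leave it.
  obtain ⟨δ, hδ, hδt⟩ := (hKc.image_of_continuousOn
    (e.continuousOn.mono hXs)).exists_thickening_subset_open e.open_target
    (image_subset_iff.2 fun x hx => e.map_source (hXs hx))
  set r₁ := δ / (|b| + 1) with hr₁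
  have hr₁0 : 0 < r₁ := by positivity
  have htarget : ∀ s, |s| < r₁ → ∀ x ∈ e.source, e x + s • Z x ∈ e.target := fun s hs x hx => by
    by_cases hxK : x ∈ K
    · refine hδt (Metric.mem_thickening_iff.2 ⟨e x, mem_image_of_mem _ hxK, ?_⟩)
      rw [dist_eq_norm, add_sub_cancel_left, norm_smul, Real.norm_eq_abs]
      rw [hr₁, lt_div_iff₀ (by positivity)] at hs
      have h1 := (hb x hxK).trans (le_abs_self b)
      have := abs_nonneg s
      nlinarith
    · rw [hZ0 x hxK, smul_zero, add_zero]
      exact e.map_source hx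
  -- Extension by the identity is smooth: off `K` the field vanishes and both branches are the
  -- identity, while `e.source` and the complement of `K` are open and cover the space.
  set P : ℝ × Space n → Space n := fun p =>
    if p.2 ∈ e.source then e.symm (e p.2 + p.1 • Z p.2) else p.2 with hP
  have hPs : ∀ s, ∀ x ∈ e.source, P (s, x) = e.symm (e x + s • Z x) := fun s x hx => if_pos hx
  have hPK : ∀ s, ∀ x ∉ K, P (s, x) = x := fun s x hx => by
    by_cases h : x ∈ e.source
    · rw [hPs s x h, hZ0 x hx, smul_zero, add_zero, e.left_inv h]
    · exact if_neg h
  have hP0 : ∀ x, P (0, x) = x := fun x => by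
    by_cases h : x ∈ e.source
    · rw [hPs 0 x h, zero_smul, add_zero, e.left_inv h]
    · exact if_neg h
  set U : Set (ℝ × Space n) := Ioo (-r₁) r₁ ×ˢ univ with hUdef
  have hU : IsOpen U := isOpen_Ioo.prod isOpen_univ
  have hmemU : ∀ {s x}, |s| < r₁ → (s, x) ∈ U := fun h => ⟨abs_lt.1 h, trivial⟩
  have hPsm : ContDiffOn ℝ ∞ P U := by
    have h1 : ContDiffOn ℝ ∞ P (Ioo (-r₁) r₁ ×ˢ e.source) := by
      have h2 : ContDiffOn ℝ ∞ (fun p : ℝ × Space n => e p.2 + p.1 • Z p.2)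
          (Ioo (-r₁) r₁ ×ˢ e.source) :=
        (he.comp contDiff_snd.contDiffOn fun p hp => hp.2).add
          (contDiff_fst.smul (hZ.comp contDiff_snd)).contDiffOn
      exact (he'.comp h2 fun p hp => htarget p.1 (abs_lt.2 hp.1) p.2 hp.2).congr
        fun p hp => hPs p.1 p.2 hp.2
    have h2 : ContDiffOn ℝ ∞ P (Ioo (-r₁) r₁ ×ˢ Kᶜ) :=
      contDiff_snd.contDiffOn.congr fun p hp => hPK p.1 p.2 hp.2
    have h3 := (contDiffOn_union_iff_of_isOpen (isOpen_Ioo.prod e.open_source)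
      (isOpen_Ioo.prod hKo)).2 ⟨h1, h2⟩
    rwa [← prod_union, hcover] at h3
  have hPd : ∀ s x, |s| < r₁ → HasFDerivAt P (fderiv ℝ P (s, x)) (s, x) := fun s x hs =>
    ((hPsm.differentiableOn (by simp)).differentiableAt (hU.mem_nhds (hmemU hs))).hasFDerivAt
  have hPx : ∀ s x, |s| < r₁ → HasFDerivAt (fun x => P (s, x))
      ((fderiv ℝ P (s, x)).comp (ContinuousLinearMap.inr ℝ ℝ (Space n))) x := fun s x hs =>
    (hPd s x hs).comp x (hasFDerivAt_prodMk_right s x)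
  have hPt : ∀ s x, |s| < r₁ → HasDerivAt (fun s => P (s, x)) (fderiv ℝ P (s, x) (1, 0)) s :=
    fun s x hs => HasFDerivAt.comp_hasDerivAt (f := fun s => (s, x)) s (hPd s x hs)
      ((hasDerivAt_id s).prodMk (hasDerivAt_const s x))
  have hfd : ContDiffOn ℝ ∞ (fderiv ℝ P) U := hPsm.fderiv_of_isOpen hU (by simp)
  -- the spatial derivative
  set G : ℝ × Space n → Space n →L[ℝ] Space n := fun p =>
    (fderiv ℝ P p).comp (ContinuousLinearMap.inr ℝ ℝ (Space n)) with hG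
  have hGsm : ContDiffOn ℝ ∞ G U := hfd.clm_comp contDiffOn_const
  have hGK : ∀ s, |s| < r₁ → ∀ x ∉ K, G (s, x) = ContinuousLinearMap.id ℝ _ := fun s hs x hx => by
    refine (hPx s x hs).unique ((hasFDerivAt_id x).congr_of_eventuallyEq ?_)
    filter_upwards [hKo.mem_nhds hx] with y hy using hPK s y hy
  have hG0 : ∀ x, G (0, x) = ContinuousLinearMap.id ℝ _ := fun x => by
    refine (hPx 0 x (by simpa using hr₁0)).unique ((hasFDerivAt_id x).congr_of_eventuallyEq ?_)
    exact Eventually.of_forall fun y => hP0 y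
  obtain ⟨C₁, hC₁, hC₁le⟩ := exists_norm_sub_le_mul_abs hr₁0 hKc (hGsm.of_le (by simp)) hG0 hGK
  obtain ⟨C₂, hC₂, hC₂le⟩ := exists_norm_sub_le_mul_abs (G := fun p => (G p).det) (c := (1 : ℝ))
    hr₁0 hKc ((contDiff_det.comp_contDiffOn hGsm).of_le (by simp))
    (fun x => by rw [hG0]; exact LinearMap.det_id)
    (fun s hs x hx => by rw [hGK s hs x hx]; exact LinearMap.det_id)
  -- the velocity
  have hsubU : Icc (-(r₁ / 2)) (r₁ / 2) ×ˢ K ⊆ U := fun p hp =>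
    ⟨⟨by linarith [hp.1.1], by linarith [hp.1.2]⟩, trivial⟩
  have hVc : ContinuousOn (fun p => fderiv ℝ P p (1, 0)) U :=
    hfd.continuousOn.clm_apply continuousOn_const
  obtain ⟨C₃, hC₃⟩ := (isCompact_Icc.prod hKc).exists_bound_of_continuousOn (hVc.mono hsubU)
  have hVK : ∀ s, |s| < r₁ → ∀ x ∉ K, fderiv ℝ P (s, x) (1, 0) = 0 := fun s hs x hx => by
    refine (hPt s x hs).unique ((hasDerivAt_const s x).congr_of_eventuallyEq ?_)
    exact Eventually.of_forall fun y => hPK y x hx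
  have hV0 : ∀ x, fderiv ℝ P (0, x) (1, 0) = X x := fun x => by
    have h0 : |(0 : ℝ)| < r₁ := by simpa using hr₁0
    by_cases hx : x ∈ e.source
    · have h1 : HasFDerivAt e.symm (fderiv ℝ e.symm (e x)) (e x + (0 : ℝ) • Z x) := by
        rw [zero_smul, add_zero]
        exact ((he'.differentiableOn (by simp)).differentiableAt
          (e.open_target.mem_nhds (e.map_source hx))).hasFDerivAt
      have h2 : HasDerivAt (fun s : ℝ => e x + s • Z x) (Z x) 0 := by
        simpa using ((hasDerivAt_id (0 : ℝ)).smul_const (Z x)).const_add (e x)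
      have h3 := h1.comp_hasDerivAt (0 : ℝ) h2
      have h4 : HasFDerivAt e (fderiv ℝ e x) x := ((he.differentiableOn (by simp)).differentiableAt
        (e.open_source.mem_nhds hx)).hasFDerivAt
      rw [zero_smul, add_zero] at h1
      have h5 : (fderiv ℝ e.symm (e x)).comp (fderiv ℝ e x) = ContinuousLinearMap.id ℝ _ := by
        refine (h1.comp x h4).unique ((hasFDerivAt_id x).congr_of_eventuallyEq ?_)
        filter_upwards [e.open_source.mem_nhds hx] with y hy using e.left_inv hy
      have h6 := congrArg (fun T : Space n →L[ℝ] Space n => T (X x)) h5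
      rw [(hPt 0 x h0).unique (h3.congr_of_eventuallyEq
        (Eventually.of_forall fun s => hPs s x hx))]
      exact h6
    · have hxK : x ∉ K := fun h => hx (hXs h)
      rw [hVK 0 h0 x hxK, hX0 x hxK]
  set C := C₁ + C₂ + |C₃| with hC
  have hC0 : 0 ≤ C := by positivity
  -- The first bound keeps times in the compact interval of the estimates; the second yields `C * r
  -- ≤ 1 / 2`.
  set r := min (r₁ / 2) (1 / (2 * (C + 1))) with hr
  have hr0 : 0 < r := lt_min (by positivity) (by positivity)
  have hCr : C * r ≤ 1 / 2 := by
    have h1 : C * r ≤ C * (1 / (2 * (C + 1))) :=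
      mul_le_mul_of_nonneg_left (min_le_right _ _) hC0
    refine h1.trans ?_
    rw [mul_one_div, div_le_div_iff₀ (by positivity) (by positivity)]
    linarith
  have hrr : ∀ {s}, |s| < r → |s| ≤ r₁ / 2 := fun h => h.le.trans (min_le_left _ _)
  have hrr' : ∀ {s}, |s| < r → |s| < r₁ := fun h => by linarith [hrr h]
  have hsm : ∀ s, |s| < r → ContDiff ℝ ∞ fun x => P (s, x) := fun s hs =>
    contDiffOn_univ.1 (hPsm.comp (contDiff_prodMk_right s).contDiffOn fun x _ => hmemU (hrr' hs))
  have hnorm : ∀ s, |s| < r → ∀ x,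
      ‖fderiv ℝ (fun x => P (s, x)) x - ContinuousLinearMap.id ℝ _‖ ≤ C * |s| := fun s hs x => by
    rw [(hPx s x (hrr' hs)).fderiv]
    refine (hC₁le s (hrr hs) x).trans (mul_le_mul_of_nonneg_right ?_ (abs_nonneg _))
    rw [hC]; linarith [abs_nonneg C₃]
  refine ⟨⟨fun s x => P (s, x), fun s x => fderiv ℝ P (s, x) (1, 0), r, C, hr0, hC0, hCr, hP0, hV0,
    hsm, fun s hs => ?_, fun s hs x => ?_, hnorm, fun s hs x => ?_,
    fun s hs x => hPt s x (hrr' hs), fun s hs x => ?_, fun s hs => ?_⟩⟩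
  -- The map differs from the identity by a `1 / 2`-Lipschitz map, so it is a global homeomorphism.
  -- Its derivative is invertible by a Neumann series, so the inverse is smooth.
  · have hhalf : ∀ x, ‖fderiv ℝ (fun x => P (s, x)) x - ContinuousLinearMap.id ℝ _‖ ≤ 1 / 2 :=
      fun x => (hnorm s hs x).trans ((mul_le_mul_of_nonneg_left hs.le hC0).trans hCr)
    have hd : ∀ x, HasFDerivAt (fun x => P (s, x)) (fderiv ℝ (fun x => P (s, x)) x) x := fun x =>
      ((hsm s hs).differentiable (by simp) x).hasFDerivAt
    have hlip : LipschitzWith (1 / 2 : NNReal) fun x => P (s, x) - x :=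
      lipschitzWith_of_nnnorm_fderiv_le
        (fun x => ((hd x).sub (hasFDerivAt_id x)).differentiableAt) fun x => by
          have h1 := ((hd x).sub (hasFDerivAt_id x)).fderiv
          have h2 : fderiv ℝ (fun x => P (s, x) - x) x
            = fderiv ℝ (fun x => P (s, x)) x - ContinuousLinearMap.id ℝ _ := h1
          rw [h2, ← NNReal.coe_le_coe]
          simpa using hhalf x
    have happ : ApproximatesLinearOn (fun x => P (s, x))
        ((ContinuousLinearEquiv.refl ℝ (Space n) : Space n ≃L[ℝ] Space n) :
          Space n →L[ℝ] Space n) univ (1 / 2 : NNReal) :=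
      ApproximatesLinearOn.approximatesLinearOn_iff_lipschitzOnWith.2 (lipschitzOnWith_univ.2 hlip)
    have hc : Subsingleton (Space n) ∨ (1 / 2 : NNReal) <
        ‖((ContinuousLinearEquiv.refl ℝ (Space n)).symm : Space n →L[ℝ] Space n)‖₊⁻¹ := by
      rcases subsingleton_or_nontrivial (Space n) with h | h
      · exact Or.inl h
      · refine Or.inr ?_
        have : ‖((ContinuousLinearEquiv.refl ℝ (Space n)).symm : Space n →L[ℝ] Space n)‖₊ = 1 :=
          ContinuousLinearMap.nnnorm_id
        rw [this, inv_one]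
        exact NNReal.half_lt_self one_ne_zero
    let H := happ.toHomeomorph _ hc
    have hinv : ∀ x, ∃ A : Space n ≃L[ℝ] Space n,
        (A : Space n →L[ℝ] Space n) = fderiv ℝ (fun x => P (s, x)) x := fun x => by
      have h1 : IsUnit (fderiv ℝ (fun x => P (s, x)) x) := by
        have h2 : ‖ContinuousLinearMap.id ℝ _ - fderiv ℝ (fun x => P (s, x)) x‖ < 1 := by
          rw [norm_sub_rev]
          linarith [hhalf x]
        have h3 := (Units.oneSub _ h2).isUnit
        rw [Units.val_oneSub] at h3
        have h4 : (1 : Space n →L[ℝ] Space n) - (ContinuousLinearMap.id ℝ _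
          - fderiv ℝ (fun x => P (s, x)) x) = fderiv ℝ (fun x => P (s, x)) x := sub_sub_cancel _ _
        rwa [h4] at h3
      obtain ⟨u, hu⟩ := h1
      exact ⟨ContinuousLinearEquiv.unitsEquiv ℝ _ u, by rw [← hu]; rfl⟩
    choose A hA using hinv
    refine ⟨H.symm, H.contDiff_symm (f₀' := A) (fun x => ?_) (hsm s hs), H.symm_apply_apply,
      H.apply_symm_apply⟩
    rw [hA]
    exact hd x
  · by_cases hx : x ∈ e.source
    · rw [hPs s x hx]
      exact hΩ x hx s (htarget s (hrr' hs) x hx)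
    · rw [hPK s x fun h => hx (hXs h)]
  · rw [(hPx s x (hrr' hs)).fderiv]
    have h1 := hC₂le s (hrr hs) x
    rw [Real.norm_eq_abs] at h1
    have h2 := abs_abs_sub_abs_le_abs_sub (G (s, x)).det 1
    rw [abs_one] at h2
    refine (h2.trans h1).trans (mul_le_mul_of_nonneg_right ?_ (abs_nonneg _))
    rw [hC]; linarith [abs_nonneg C₃]
  · by_cases hx : x ∈ K
    · refine (hC₃ (s, x) ⟨abs_le.1 (hrr hs), hx⟩).trans ((le_abs_self _).trans ?_)
      rw [hC]; linarith
    · rw [hVK s (hrr' hs) x hx, norm_zero]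
      exact hC0
  · exact continuousOn_univ.1 (hVc.comp (Continuous.prodMk_right s).continuousOn
      fun x _ => hmemU (hrr' hs))

end Construction

/-! ### Regularity up to the boundary -/

section Regularity

variable {n : ℕ} {Ω : Set (Space n)}

/-- Functionals on test functions which are bounded for the `L²` norm. -/
def IsL2Bounded (Ω : Set (Space n)) (l : (Space n → ℝ) → ℝ) : Prop :=
  ∃ K : ℝ, ∀ φ (hφ : IsTest Ω φ), |l φ| ≤ K * ‖hφ.toL2‖

namespace IsL2Bounded

variable {l m : (Space n → ℝ) → ℝ}

theorem congr (hl : IsL2Bounded Ω l) (h : ∀ φ, IsTest Ω φ → m φ = l φ) : IsL2Bounded Ω m := by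
  obtain ⟨K, hK⟩ := hl
  exact ⟨K, fun φ hφ => by rw [h φ hφ]; exact hK φ hφ⟩

theorem add (hl : IsL2Bounded Ω l) (hm : IsL2Bounded Ω m) :
    IsL2Bounded Ω fun φ => l φ + m φ := by
  obtain ⟨K, hK⟩ := hl
  obtain ⟨L, hL⟩ := hm
  refine ⟨K + L, fun φ hφ => (abs_add_le _ _).trans ?_⟩
  rw [add_mul]
  exact add_le_add (hK φ hφ) (hL φ hφ)

theorem neg (hl : IsL2Bounded Ω l) : IsL2Bounded Ω fun φ => -l φ := by
  obtain ⟨K, hK⟩ := hl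
  exact ⟨K, fun φ hφ => by rw [abs_neg]; exact hK φ hφ⟩

theorem sub (hl : IsL2Bounded Ω l) (hm : IsL2Bounded Ω m) :
    IsL2Bounded Ω fun φ => l φ - m φ := by
  simpa only [sub_eq_add_neg] using hl.add hm.neg

theorem sum {ι : Type*} (s : Finset ι) {l : ι → (Space n → ℝ) → ℝ}
    (hl : ∀ i ∈ s, IsL2Bounded Ω (l i)) : IsL2Bounded Ω fun φ => ∑ i ∈ s, l i φ := by
  classical
  induction s using Finset.induction_on with
  | empty => exact ⟨0, fun φ hφ => by simp⟩
  | insert a s ha ih =>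
    simp only [Finset.sum_insert ha]
    exact (hl a (Finset.mem_insert_self a s)).add
      (ih fun i hi => hl i (Finset.mem_insert_of_mem hi))

theorem inner_left (u : L2 Ω) : IsL2Bounded Ω fun φ => ∫ x in Ω, u x * φ x :=
  ⟨‖u‖, fun φ hφ => by dsimp only; rw [← hφ.inner_toL2]; exact abs_real_inner_le_norm _ _⟩

theorem comp_mul (hl : IsL2Bounded Ω l) {a : Space n → ℝ} (ha : ContDiff ℝ ∞ a)
    (hac : HasCompactSupport a) : IsL2Bounded Ω fun φ => l fun x => a x * φ x := by
  obtain ⟨K, hK⟩ := hl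
  obtain ⟨A, hA⟩ := hac.exists_bound_of_continuous ha.continuous
  refine ⟨|K| * A, fun φ hφ => (hK _ (hφ.mul_left ha)).trans ?_⟩
  have h1 : ‖(hφ.mul_left ha).toL2‖ ≤ A * ‖hφ.toL2‖ := by
    refine Lp.norm_le_mul_norm_of_ae_le_mul ?_
    filter_upwards [((hφ.mul_left ha).memLp (volume.restrict Ω)).coeFn_toLp,
      (hφ.memLp (volume.restrict Ω)).coeFn_toLp] with x h1 h2
    rw [IsTest.toL2, IsTest.toL2, h1, h2, norm_mul]
    exact mul_le_mul_of_nonneg_right (hA x) (norm_nonneg _)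
  calc _ ≤ |K| * ‖(hφ.mul_left ha).toL2‖ :=
        mul_le_mul_of_nonneg_right (le_abs_self K) (norm_nonneg _)
    _ ≤ |K| * (A * ‖hφ.toL2‖) := mul_le_mul_of_nonneg_left h1 (abs_nonneg _)
    _ = _ := by ring

end IsL2Bounded

/-- The distributional second derivative `-∂ₗ∂ᵢw`. -/
def hess (w : H10 Ω) (l i : Fin n) (φ : Space n → ℝ) : ℝ :=
  ∫ x in Ω, w.grad i x * pderiv l φ x

section Hess

variable {w : H10 Ω} {φ ψ : Space n → ℝ}

theorem hess_eq_inner (hφ : IsTest Ω φ) (l i : Fin n) :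
    hess w l i φ = inner ℝ (w.grad i) (hφ.pderiv l).toL2 := by
  rw [hess, IsTest.inner_toL2]

theorem integrable_mul_test (u : L2 Ω) (hφ : IsTest Ω φ) :
    Integrable (fun x => u x * φ x) (volume.restrict Ω) :=
  (Lp.memLp u).integrable_mul (hφ.memLp _)

theorem hess_add (hφ : IsTest Ω φ) (hψ : IsTest Ω ψ) (l i : Fin n) :
    hess w l i (fun x => φ x + ψ x) = hess w l i φ + hess w l i ψ := by
  simp only [hess, pderiv_add hφ.differentiable hψ.differentiable, mul_add]
  exact integral_add (integrable_mul_test _ (hφ.pderiv l)) (integrable_mul_test _ (hψ.pderiv l))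

theorem hess_const_mul (hφ : IsTest Ω φ) (c : ℝ) (l i : Fin n) :
    hess w l i (fun x => c * φ x) = c * hess w l i φ := by
  simp only [hess, pderiv_const_mul hφ.differentiable, mul_left_comm _ c]
  exact integral_const_mul _ _

theorem hess_sub (hφ : IsTest Ω φ) (hψ : IsTest Ω ψ) (l i : Fin n) :
    hess w l i (fun x => φ x - ψ x) = hess w l i φ - hess w l i ψ := by
  have h := hess_add (w := w) hφ (hψ.const_mul (-1)) l i
  rw [hess_const_mul hψ] at h
  simpa [sub_eq_add_neg] using h

theorem isTest_sum {ι : Type*} (s : Finset ι) {φ : ι → Space n → ℝ}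
    (hφ : ∀ j ∈ s, IsTest Ω (φ j)) : IsTest Ω fun x => ∑ j ∈ s, φ j x := by
  have := (testSubmodule Ω).sum_mem hφ
  have h2 : (∑ j ∈ s, φ j) = fun x => ∑ j ∈ s, φ j x := by ext x; simp
  rw [h2] at this
  exact this

theorem hess_sum {ι : Type*} (s : Finset ι) {φ : ι → Space n → ℝ}
    (hφ : ∀ j ∈ s, IsTest Ω (φ j)) (l i : Fin n) :
    hess w l i (fun x => ∑ j ∈ s, φ j x) = ∑ j ∈ s, hess w l i (φ j) := by
  classical
  induction s using Finset.induction_on with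
  | empty => simp [hess, pderiv]
  | insert a s ha ih =>
    simp only [Finset.sum_insert ha]
    have hs := fun j hj => hφ j (Finset.mem_insert_of_mem hj)
    rw [hess_add (hφ a (Finset.mem_insert_self a s)) (isTest_sum s hs), ih hs]

/-- Both sides equal minus the integral of `w` against a mixed second derivative of the test
function, and these derivatives commute. -/
theorem hess_symm (hφ : IsTest Ω φ) (l i : Fin n) : hess w l i φ = hess w i l φ := by
  rw [hess_eq_inner hφ, hess_eq_inner hφ]
  have h1 := hasWeakDeriv_iff.1 (w.hasWeakDeriv i) _ (hφ.pderiv l)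
  have h2 := hasWeakDeriv_iff.1 (w.hasWeakDeriv l) _ (hφ.pderiv i)
  have h3 : ((hφ.pderiv l).pderiv i).toL2 = ((hφ.pderiv i).pderiv l).toL2 := by
    congr 1
    ext x
    exact hφ.pderiv_comm i l x
  rw [h3] at h1
  linarith

/-- `w` solves `-Δw = f` weakly. -/
def IsWeakSol (w : H10 Ω) (f : L2 Ω) : Prop :=
  ∀ φ (hφ : IsTest Ω φ), ∑ i, inner ℝ (w.grad i) (hφ.pderiv i).toL2 = inner ℝ f hφ.toL2

/-- The sum is the weak form of `-Δw`, so the equation bounds it. This is the combination of second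
derivatives that tangential motion cannot supply. -/
theorem IsWeakSol.isL2Bounded_trace {f : L2 Ω} (hw : IsWeakSol w f) :
    IsL2Bounded Ω fun φ => ∑ i, hess w i i φ :=
  (IsL2Bounded.inner_left f).congr fun φ hφ => by
    rw [← hφ.inner_toL2, ← hw φ hφ]
    exact Finset.sum_congr rfl fun i _ => hess_eq_inner hφ i i

/-- `TangentFlow.exists_bound` controls the terms with `X` outside the derivative `∂ₗ`. Moving `X`
inside costs only first derivatives of `w` against `(∂ₗ X) φ`. -/
theorem IsWeakSol.isL2Bounded_of_tangentFlow {f : L2 Ω} (hw : IsWeakSol w f)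
    {X : Space n → Space n} (hX : ContDiff ℝ ∞ X) (hXc : HasCompactSupport X)
    (F : TangentFlow Ω X) (l : Fin n) :
    IsL2Bounded Ω fun φ => ∑ i, hess w l i fun x => X x i * φ x := by
  have hXi : ∀ i, ContDiff ℝ ∞ fun x => X x i := fun i => by fun_prop
  have hXic : ∀ i, HasCompactSupport fun x => X x i := fun i =>
    hXc.comp_left (g := fun v : Space n => v i) rfl
  have hdX : ∀ i, IsTest univ (pderiv l fun x => X x i) := fun i =>
    IsTest.pderiv ⟨hXi i, hXic i, subset_univ _⟩ l
  obtain ⟨K, hK⟩ := F.exists_bound hXi w f hw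
  have h1 : IsL2Bounded Ω fun φ => ∑ i, ∫ x in Ω, w.grad i x * (X x i * pderiv l φ x) :=
    ⟨K, fun φ hφ => by
      simp only [← ((hφ.pderiv l).mul_left (hXi _)).inner_toL2]
      exact hK l φ hφ⟩
  have h2 : IsL2Bounded Ω fun φ => ∑ i, ∫ x in Ω, w.grad i x *
      (pderiv l (fun x => X x i) x * φ x) :=
    IsL2Bounded.sum _ fun i _ =>
      (IsL2Bounded.inner_left (w.grad i)).comp_mul (hdX i).1 (hdX i).2.1
  refine (h1.add h2).congr fun φ hφ => ?_
  rw [← Finset.sum_add_distrib]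
  refine Finset.sum_congr rfl fun i _ => ?_
  rw [← integral_add (integrable_mul_test _ ((hφ.pderiv l).mul_left (hXi i)))
    (integrable_mul_test _ (hφ.mul_left (hdX i).1))]
  simp only [hess, pderiv_mul ((hXi i).differentiable (by simp)) hφ.differentiable]
  congr 1
  ext x
  ring

/-- `χw` has second derivatives in `L²`, up to lower order terms. -/
def IsLocallyH2 (w : H10 Ω) (χ : Space n → ℝ) : Prop :=
  ∀ l i, IsL2Bounded Ω fun φ => hess w l i fun x => χ x * φ x

/-- In the interior every direction is tangent: the identity chart of `Ω` and the field `χ eᵢ`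
suffice. -/
theorem IsWeakSol.isLocallyH2_interior {f : L2 Ω} (hw : IsWeakSol w f) (hΩ : IsOpen Ω)
    {χ : Space n → ℝ} (hχ : IsTest Ω χ) : IsLocallyH2 w χ := by
  intro l i
  let X : Space n → Space n := fun x => χ x • EuclideanSpace.single i 1
  have hX : ContDiff ℝ ∞ X := hχ.1.smul contDiff_const
  have hXc : HasCompactSupport X := hχ.2.1.smul_right
  have hXs : tsupport X ⊆ Ω := (tsupport_smul_subset_left _ _).trans hχ.2.2
  obtain ⟨F⟩ := nonempty_tangentFlow (Ω := Ω) (OpenPartialHomeomorph.ofSet Ω hΩ) contDiffOn_id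
    contDiffOn_id hX hXc hXs fun x hx s hs => ⟨fun _ => hx, fun _ => hs⟩
  refine (hw.isL2Bounded_of_tangentFlow hX hXc F l).congr fun φ hφ => ?_
  rw [Finset.sum_eq_single i]
  · simp [X]
  · intro j _ hj
    simp [X, hj, hess, pderiv]
  · simp

theorem contDiff_mul_of_contDiffOn {χ a : Space n → ℝ} {V : Set (Space n)} (hV : IsOpen V)
    (hχ : IsTest V χ) (ha : ContDiffOn ℝ ∞ a V) : IsTest V fun x => χ x * a x := by
  refine ⟨contDiff_of_contDiffOn_union_of_isOpen (s := V) (t := (tsupport χ)ᶜ) ?_ ?_ ?_ hV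
    (isClosed_tsupport χ).isOpen_compl, hχ.2.1.mul_right,
    (tsupport_mul_subset_left).trans hχ.2.2⟩
  · exact hχ.1.contDiffOn.mul ha
  · refine (contDiffOn_const (c := 0)).congr fun x hx => ?_
    rw [image_eq_zero_of_notMem_tsupport hx, zero_mul]
  · exact eq_univ_of_forall fun x => (em (x ∈ tsupport χ)).imp (fun h => hχ.2.2 h) id

/-- The boundary is a level set of `e · 0`. With `bᵢ` the quotient of its derivatives in directions
`i` and `k`, the fields `χ (eᵢ - bᵢ eₖ)` are tangent. Modulo bounded functionals this expresses
every second derivative through the single one in direction `(k, k)`, and the equation then bounds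
that one. -/
theorem IsWeakSol.isLocallyH2_boundary [NeZero n] {f : L2 Ω} (hw : IsWeakSol w f)
    (e : OpenPartialHomeomorph (Space n) (Space n))
    (he : ContDiffOn ℝ ∞ e e.source) (he' : ContDiffOn ℝ ∞ e.symm e.target)
    (heΩ : ∀ y ∈ e.source, (y ∈ Ω ↔ 0 < e y 0)) (k : Fin n) {V : Set (Space n)} (hV : IsOpen V)
    (hVe : V ⊆ e.source) (hVk : ∀ x ∈ V, fderiv ℝ e x (EuclideanSpace.single k 1) 0 ≠ 0)
    {χ : Space n → ℝ} (hχ : IsTest V χ) : IsLocallyH2 w χ := by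
  have hde : ∀ i, ContDiffOn ℝ ∞ (fun x => fderiv ℝ e x (EuclideanSpace.single i 1) 0) V :=
    fun i => by
      have h1 : ContDiffOn ℝ ∞ (fun x => fderiv ℝ e x (EuclideanSpace.single i 1)) V :=
        ((he.fderiv_of_isOpen e.open_source (by simp)).mono hVe).clm_apply contDiffOn_const
      fun_prop
  set b : Fin n → Space n → ℝ := fun i x => fderiv ℝ e x (EuclideanSpace.single i 1) 0 /
    fderiv ℝ e x (EuclideanSpace.single k 1) 0 with hbdef
  have hb : ∀ i, ContDiffOn ℝ ∞ (b i) V := fun i => (hde i).div (hde k) hVk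
  have hbk : ∀ x ∈ V, b k x = 1 := fun x hx => div_self (hVk x hx)
  have hmul : ∀ {χ}, IsTest V χ → ∀ i, IsTest V fun x => χ x * b i x := fun h i =>
    contDiff_mul_of_contDiffOn hV h (hb i)
  have c1 : ∀ {χ}, IsTest V χ → ∀ l i, IsL2Bounded Ω fun φ =>
      hess w l i (fun x => χ x * φ x) - hess w l k (fun x => χ x * b i x * φ x) := by
    intro χ hχ l i
    let X : Space n → Space n := fun x =>
      χ x • EuclideanSpace.single i 1 - (χ x * b i x) • EuclideanSpace.single k 1
    have hX : ContDiff ℝ ∞ X := (hχ.1.smul contDiff_const).sub ((hmul hχ i).1.smul contDiff_const)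
    have hX0 : ∀ x, χ x = 0 → X x = 0 := fun x hx => by simp [X, hx]
    have hsupp : tsupport X ⊆ tsupport χ := closure_mono fun x hx h => hx (hX0 x h)
    have hXc : HasCompactSupport X := hχ.2.1.mono fun x hx h => hx (hX0 x h)
    have htan : ∀ x, fderiv ℝ e x (X x) 0 = 0 := fun x => by
      by_cases hx : χ x = 0
      · simp [hX0 x hx]
      · have hxV : x ∈ V := hχ.2.2 (subset_tsupport χ hx)
        simp only [X, map_sub, map_smul, PiLp.sub_apply, PiLp.smul_apply, smul_eq_mul, hbdef]
        field_simp [hVk x hxV]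
        ring
    obtain ⟨F⟩ := nonempty_tangentFlow (Ω := Ω) e he he' hX hXc
      (hsupp.trans (hχ.2.2.trans hVe)) fun x hx s hs => by
        rw [heΩ _ (e.map_target hs), heΩ x hx, e.right_inv hs]
        simp [htan]
    refine (hw.isL2Bounded_of_tangentFlow hX hXc F l).congr fun φ hφ => ?_
    have t1 := hφ.mul_left hχ.1
    have t2 := hφ.mul_left (hmul hχ i).1
    have h1 : ∀ j, hess w l j (fun x => X x j * φ x)
        = (if j = i then 1 else 0) * hess w l j (fun x => χ x * φ x)
          - (if j = k then 1 else 0) * hess w l j (fun x => χ x * b i x * φ x) := fun j => by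
      rw [← hess_const_mul t1, ← hess_const_mul t2,
        ← hess_sub (t1.const_mul _) (t2.const_mul _)]
      congr 1
      ext x
      simp only [X, PiLp.sub_apply, PiLp.smul_apply, PiLp.single_apply, smul_eq_mul]
      ring
    simp only [h1]
    rw [Finset.sum_sub_distrib]
    simp
  -- Trade index `i` for `k`, use the symmetry of `hess`, then trade `l` for `k`.
  have c2 : ∀ {χ}, IsTest V χ → ∀ l i, IsL2Bounded Ω fun φ =>
      hess w l i (fun x => χ x * φ x) - hess w k k (fun x => χ x * b i x * b l x * φ x) := by
    intro χ hχ l i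
    refine ((c1 hχ l i).add (c1 (hmul hχ i) k l)).congr fun φ hφ => ?_
    rw [hess_symm (hφ.mul_left (hmul hχ i).1) k l]
    ring
  -- In these terms the trace is `∑ bᵢ²` times the `(k, k)` derivative. The sum is at least `1`
  -- because `bₖ = 1`, so it can be divided out of the cutoff.
  have c3 : ∀ {χ}, IsTest V χ → IsL2Bounded Ω fun φ => hess w k k fun x => χ x * φ x := by
    intro χ hχ
    have hs : ContDiffOn ℝ ∞ (fun x => ∑ i, b i x * b i x) V :=
      ContDiffOn.sum fun i _ => (hb i).mul (hb i)
    have hs0 : ∀ x ∈ V, ∑ i, b i x * b i x ≠ 0 := fun x hx => by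
      have h1 := Finset.single_le_sum (f := fun i => b i x * b i x)
        (fun i _ => mul_self_nonneg _) (Finset.mem_univ k)
      simp only [hbk x hx] at h1
      linarith
    have hχ' := contDiff_mul_of_contDiffOn hV hχ (hs.inv hs0)
    have h1 := (hw.isL2Bounded_trace.comp_mul hχ'.1 hχ'.2.1).sub
      (IsL2Bounded.sum Finset.univ fun i _ => c2 hχ' i i)
    refine h1.congr fun φ hφ => ?_
    rw [← Finset.sum_sub_distrib]
    simp only [sub_sub_cancel]
    rw [← hess_sum]
    · congr 1
      ext x
      by_cases hx : χ x = 0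
      · simp [hx]
      · have hxV : x ∈ V := hχ.2.2 (subset_tsupport χ hx)
        rw [← Finset.sum_mul]
        simp only [mul_assoc]
        rw [← Finset.mul_sum, ← Finset.mul_sum, Pi.inv_apply, inv_mul_cancel₀ (hs0 x hxV), mul_one]
    · exact fun i _ => hφ.mul_left (hmul (hmul hχ' i) i).1
  intro l i
  exact ((c2 hχ l i).add (c3 (hmul (hmul hχ i) l))).congr fun φ hφ => by ring

/-- Weak solutions are in `H²` near each point of the closure. -/
theorem IsWeakSol.exists_isLocallyH2 [NeZero n] {f : L2 Ω} (hw : IsWeakSol w f)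
    (hΩ : IsSmoothBoundedDomain Ω) {x : Space n} (hx : x ∈ closure Ω) :
    ∃ V, IsOpen V ∧ x ∈ V ∧ ∀ χ, IsTest V χ → IsLocallyH2 w χ := by
  by_cases hxΩ : x ∈ Ω
  · exact ⟨Ω, hΩ.isOpen, hxΩ, fun χ hχ => hw.isLocallyH2_interior hΩ.isOpen hχ⟩
  have hxf : x ∈ frontier Ω := ⟨hx, by rwa [hΩ.isOpen.interior_eq]⟩
  obtain ⟨e, hxe, he, he', heΩ⟩ := hΩ.smooth_boundary x hxf
  -- The differential of the chart is invertible, so its component `0` cannot vanish on all basis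
  -- vectors.
  obtain ⟨k, hk⟩ : ∃ k, fderiv ℝ e x (EuclideanSpace.single k 1) 0 ≠ 0 := by
    by_contra! h
    have h4 : HasFDerivAt e (fderiv ℝ e x) x := ((he.differentiableOn (by simp)).differentiableAt
      (e.open_source.mem_nhds hxe)).hasFDerivAt
    have h1 : HasFDerivAt e.symm (fderiv ℝ e.symm (e x)) (e x) :=
      ((he'.differentiableOn (by simp)).differentiableAt
        (e.open_target.mem_nhds (e.map_source hxe))).hasFDerivAt
    rw [← e.left_inv hxe] at h4
    have h5 := (h4.comp (e x) h1).unique ((hasFDerivAt_id (e x)).congr_of_eventuallyEq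
      (by filter_upwards [e.open_target.mem_nhds (e.map_source hxe)] with y hy
            using e.right_inv hy))
    rw [e.left_inv hxe] at h5
    have h6 : ∀ v : Space n, fderiv ℝ e x v 0 = 0 := fun v => by
      have hv := (EuclideanSpace.basisFun (Fin n) ℝ).sum_repr v
      rw [← hv]
      simp [h]
    have h7 := congrArg (fun T : Space n →L[ℝ] Space n => T (EuclideanSpace.single 0 1) 0) h5
    simp [h6] at h7
  have hc : ContinuousOn (fun y => fderiv ℝ e y (EuclideanSpace.single k 1) 0) e.source := by
    have h1 : ContinuousOn (fun y => fderiv ℝ e y (EuclideanSpace.single k 1)) e.source :=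
      (he.continuousOn_fderiv_of_isOpen e.open_source (by simp)).clm_apply continuousOn_const
    fun_prop
  refine ⟨e.source ∩ (fun y => fderiv ℝ e y (EuclideanSpace.single k 1) 0) ⁻¹' {0}ᶜ,
    hc.isOpen_inter_preimage e.open_source isOpen_compl_singleton, ⟨hxe, hk⟩, fun χ hχ => ?_⟩
  exact hw.isLocallyH2_boundary e he he' heΩ k
    (hc.isOpen_inter_preimage e.open_source isOpen_compl_singleton) inter_subset_left
    (fun y hy => hy.2) hχ

theorem IsWeakSol.isL2Bounded_hess [NeZero n] {f : L2 Ω} (hw : IsWeakSol w f)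
    (hΩ : IsSmoothBoundedDomain Ω) (l i : Fin n) : IsL2Bounded Ω (hess w l i) := by
  have hcpt : IsCompact (closure Ω) := hΩ.isBounded.isCompact_closure
  choose! V hVo hxV hV using fun x (hx : x ∈ closure Ω) => hw.exists_isLocallyH2 hΩ hx
  -- The unit balls only serve to make the supports of the partition of unity bounded, hence
  -- compact.
  obtain ⟨t, ht, hcov⟩ := hcpt.elim_nhds_subcover (fun x => V x ∩ Metric.ball x 1)
    fun x hx => ((hVo x hx).inter Metric.isOpen_ball).mem_nhds
      ⟨hxV x hx, Metric.mem_ball_self one_pos⟩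
  obtain ⟨p, hp⟩ := SmoothPartitionOfUnity.exists_isSubordinate (modelWithCornersSelf ℝ (Space n))
    isClosed_closure (fun x : t => V x ∩ Metric.ball (x : Space n) 1)
    (fun x => (hVo x (ht x x.2)).inter Metric.isOpen_ball)
    (fun y hy => by
      obtain ⟨x, hx, hxy⟩ := mem_iUnion₂.1 (hcov hy)
      exact mem_iUnion.2 ⟨⟨x, hx⟩, hxy⟩)
  have hpT : ∀ x : t, IsTest (V x) (p x) := fun x =>
    ⟨(p x).contMDiff.contDiff, (Metric.isBounded_ball.subset
      ((hp x).trans inter_subset_right)).isCompact_closure.of_isClosed_subset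
        (isClosed_tsupport _) subset_closure, (hp x).trans inter_subset_left⟩
  have h1 : IsL2Bounded Ω fun φ => ∑ x : t, hess w l i fun y => p x y * φ y :=
    IsL2Bounded.sum _ fun x _ => hV x (ht x x.2) (p x) (hpT x) l i
  refine h1.congr fun φ hφ => ?_
  rw [← hess_sum _ fun x _ => hφ.mul_left (hpT x).1]
  congr 1
  ext y
  by_cases hy : y ∈ Ω
  · rw [← Finset.sum_mul, ← finsum_eq_sum_of_fintype, p.sum_eq_one (subset_closure hy), one_mul]
  · simp [hφ.eq_zero hy]

theorem IsWeakSol.memH2 [NeZero n] {f : L2 Ω} (hw : IsWeakSol w f)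
    (hΩ : IsSmoothBoundedDomain Ω) : MemH2 w.fn := by
  refine ⟨fun i => ⟨_, w.hasWeakDeriv i⟩, fun i j => ?_⟩
  rw [(w.hasWeakDeriv i).weakDeriv_eq hΩ.isOpen]
  obtain ⟨K, hK⟩ := hw.isL2Bounded_hess hΩ j i
  exact exists_hasWeakDeriv fun φ hφ => by rw [← hess_eq_inner hφ]; exact hK φ hφ

theorem IsWeakSol.laplacian_eq [NeZero n] {f : L2 Ω} (hw : IsWeakSol w f)
    (hΩ : IsSmoothBoundedDomain Ω) : laplacian w.fn = -f := by
  refine ext_of_inner_test hΩ.isOpen fun φ hφ => ?_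
  have h1 := (hw.memH2 hΩ).inner_laplacian hφ.toH10
  simp only [(w.hasWeakDeriv _).weakDeriv_eq hΩ.isOpen] at h1
  rw [inner_neg_left, ← hw φ hφ]
  exact h1

end Hess

end Regularity

/-! ### The diffusive part -/

section Diffusion

variable {n : ℕ} {Ω : Set (Space n)} {p : Coeffs}

theorem Coeffs.Admissible.c_pos (hp : p.Admissible) : 0 < p.c :=
  mul_pos (inv_pos.2 Real.pi_pos) (Real.sin_pos_of_pos_of_lt_pi
    (mul_pos hp.α_pos Real.pi_pos) (mul_lt_of_lt_one_left Real.pi_pos hp.α_lt_one))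

theorem Coeffs.measurable_μ (p : Coeffs) : Measurable p.μ := by
  unfold Coeffs.μ
  fun_prop

theorem integrable_of_even {f : ℝ → ℝ} (hf : ∀ x, f (-x) = f x) (h : IntegrableOn f (Ioi 0)) :
    Integrable f := by
  have h1 : Integrable ((Ioi 0).indicator f) := h.integrable_indicator measurableSet_Ioi
  refine (h1.add h1.comp_neg).congr ?_
  filter_upwards [compl_mem_ae_iff.2 (measure_singleton (0 : ℝ))] with x hx
  rcases lt_trichotomy x 0 with h0 | h0 | h0
  · simp [indicator, h0, h0.le, hf]
  · exact absurd h0 hx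
  · simp [indicator, h0, h0.le]

/-- The numerator is `|ξ| ^ (2α - 1)`: integrable at zero since `α > 0`, while at infinity the
quotient is at most `ξ ^ (2α - 3)`, integrable since `α < 1`. -/
theorem Coeffs.Admissible.integrable_μ_sq_div (hp : p.Admissible) {r : ℝ} (hr : 0 < r) :
    Integrable fun ξ : ℝ => p.μ ξ ^ 2 / (r + ξ ^ 2 + p.η) := by
  have hη := hp.η_nonneg
  have hα := hp.α_pos
  have hα1 := hp.α_lt_one
  have hm : ∀ s, AEStronglyMeasurable (fun ξ : ℝ => p.μ ξ ^ 2 / (r + ξ ^ 2 + p.η))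
      (volume.restrict s) := fun s =>
    (((p.measurable_μ.pow_const 2).div (by fun_prop)).aestronglyMeasurable)
  have hμ : ∀ ξ : ℝ, 0 < ξ → p.μ ξ ^ 2 = ξ ^ (2 * p.α - 1) := fun ξ hξ => by
    rw [Coeffs.μ, abs_of_pos hξ, ← Real.rpow_natCast, ← Real.rpow_mul hξ.le]
    congr 1
    push_cast
    ring
  refine integrable_of_even (fun ξ => by simp [Coeffs.μ]) ?_
  rw [← Ioc_union_Ioi_eq_Ioi zero_le_one]
  refine IntegrableOn.union ?_ ?_
  · have h1 : IntegrableOn (fun ξ : ℝ => ξ ^ (2 * p.α - 1)) (Ioc 0 1) :=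
      (intervalIntegrable_iff_integrableOn_Ioc_of_le zero_le_one).1
        (intervalIntegral.intervalIntegrable_rpow' (by linarith))
    refine (h1.const_mul r⁻¹).mono' (hm _) ?_
    filter_upwards [ae_restrict_mem measurableSet_Ioc] with ξ hξ
    rw [hμ ξ hξ.1, Real.norm_of_nonneg (div_nonneg (Real.rpow_nonneg hξ.1.le _) (by positivity)),
      div_eq_inv_mul]
    refine mul_le_mul_of_nonneg_right ?_ (Real.rpow_nonneg hξ.1.le _)
    exact inv_anti₀ hr (by nlinarith [sq_nonneg ξ])
  · have h1 : IntegrableOn (fun ξ : ℝ => ξ ^ (2 * p.α - 3)) (Ioi 1) :=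
      integrableOn_Ioi_rpow_of_lt (by linarith) zero_lt_one
    refine h1.mono' (hm _) ?_
    filter_upwards [ae_restrict_mem measurableSet_Ioi] with ξ hξ
    have hξ0 : (0 : ℝ) < ξ := zero_lt_one.trans hξ
    have h : ξ ^ (2 * p.α - 3) = ξ ^ (2 * p.α - 1) / ξ ^ 2 := by
      rw [show 2 * p.α - 3 = (2 * p.α - 1) - 2 by ring, Real.rpow_sub hξ0, Real.rpow_two]
    rw [hμ ξ hξ0, Real.norm_of_nonneg (div_nonneg (Real.rpow_nonneg hξ0.le _) (by positivity)), h]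
    refine div_le_div_of_nonneg_left (Real.rpow_nonneg hξ0.le _) (by positivity) ?_
    linarith

theorem Coeffs.Admissible.memLp_μ_div (hp : p.Admissible) {r : ℝ} (hr : 0 < r) :
    MemLp (fun ξ : ℝ => p.μ ξ / (r + ξ ^ 2 + p.η)) 2 volume := by
  have hη := hp.η_nonneg
  have hm : AEStronglyMeasurable (fun ξ : ℝ => p.μ ξ / (r + ξ ^ 2 + p.η)) volume :=
    (p.measurable_μ.div (by fun_prop)).aestronglyMeasurable
  refine (memLp_two_iff_integrable_sq hm).2
    (((hp.integrable_μ_sq_div hr).const_mul r⁻¹).mono' (hm.pow 2) (Eventually.of_forall fun ξ => ?_))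
  have hq : 0 < r + ξ ^ 2 + p.η := by positivity
  have h1 : r⁻¹ * (p.μ ξ ^ 2 / (r + ξ ^ 2 + p.η)) = p.μ ξ ^ 2 / (r * (r + ξ ^ 2 + p.η)) := by
    field_simp
  rw [Real.norm_of_nonneg (by positivity), div_pow, h1]
  refine div_le_div_of_nonneg_left (sq_nonneg _) (by positivity) ?_
  nlinarith [sq_nonneg ξ]

theorem Coeffs.Admissible.memLp_mul_μ_div (hp : p.Admissible) {r : ℝ} (hr : 0 < r) :
    MemLp (fun ξ : ℝ => ξ * (p.μ ξ / (r + ξ ^ 2 + p.η))) 2 volume := by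
  have hη := hp.η_nonneg
  have hm : AEStronglyMeasurable (fun ξ : ℝ => ξ * (p.μ ξ / (r + ξ ^ 2 + p.η))) volume :=
    (measurable_id.mul (p.measurable_μ.div (by fun_prop))).aestronglyMeasurable
  refine (memLp_two_iff_integrable_sq hm).2
    ((hp.integrable_μ_sq_div hr).mono' (hm.pow 2) (Eventually.of_forall fun ξ => ?_))
  have hq : 0 < r + ξ ^ 2 + p.η := by positivity
  rw [Real.norm_of_nonneg (by positivity), mul_pow, div_pow, ← mul_div_assoc,
    div_le_div_iff₀ (by positivity) hq]
  have h1 : ξ ^ 2 ≤ r + ξ ^ 2 + p.η := by linarith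
  have h2 : 0 ≤ p.μ ξ ^ 2 * (r + ξ ^ 2 + p.η) := by positivity
  nlinarith

theorem memLp_smul_const {f : ℝ → ℝ} (hf : MemLp f 2 volume) (U : L2 Ω) :
    MemLp (fun ξ => f ξ • U) 2 volume :=
  hf.of_le_mul (c := ‖U‖) (hf.aestronglyMeasurable.smul_const U)
    (Eventually.of_forall fun ξ => by rw [norm_smul, mul_comm])

/-- The diffusive part is solvable for each positive spectral parameter. -/
theorem Coeffs.Admissible.exists_diffusion (hp : p.Admissible) {r : ℝ} (hr : 0 < r)
    (f : L2L2 Ω) : ∃ (m : ℝ) (k : L2 Ω), 0 ≤ m ∧ ∀ U : L2 Ω, ∃ φ : L2L2 Ω,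
      Integrable (fun ξ : ℝ => p.μ ξ • φ ξ) ∧ MemLp (fun ξ : ℝ => ξ • φ ξ) 2 volume ∧
      MemLp (p.diffusion φ U) 2 volume ∧ r • φ - p.diffusionLp φ U = f ∧
      ∫ ξ : ℝ, p.μ ξ • φ ξ = k + m • U := by
  have hη := hp.η_nonneg
  have hq : ∀ ξ : ℝ, 0 < r + ξ ^ 2 + p.η := fun ξ => by positivity
  have hqm : Measurable fun ξ : ℝ => r + ξ ^ 2 + p.η := by fun_prop
  have hfm : AEStronglyMeasurable (f : ℝ → L2 Ω) volume := Lp.aestronglyMeasurable f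
  -- Slope and offset are chosen before `U`, so the memory integral is affine in the still unknown
  -- velocity.
  refine ⟨∫ ξ : ℝ, p.μ ξ ^ 2 / (r + ξ ^ 2 + p.η),
    ∫ ξ : ℝ, (p.μ ξ / (r + ξ ^ 2 + p.η)) • f ξ,
    integral_nonneg fun ξ => div_nonneg (sq_nonneg _) (hq ξ).le, fun U => ?_⟩
  -- The pointwise solution of `(r + ξ² + η) φ = f + μ U`.
  set φ₀ : ℝ → L2 Ω := fun ξ =>
    (r + ξ ^ 2 + p.η)⁻¹ • f ξ + (p.μ ξ / (r + ξ ^ 2 + p.η)) • U with hφ₀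
  have hφ₀L : MemLp φ₀ 2 volume := by
    refine MemLp.add ((Lp.memLp f).of_le_mul (c := r⁻¹)
      (hqm.inv.aestronglyMeasurable.smul hfm) (Eventually.of_forall fun ξ => ?_))
      (memLp_smul_const (hp.memLp_μ_div hr) U)
    rw [norm_smul, Real.norm_of_nonneg (inv_nonneg.2 (hq ξ).le)]
    refine mul_le_mul_of_nonneg_right (inv_anti₀ hr ?_) (norm_nonneg _)
    nlinarith [sq_nonneg ξ]
  set φ : L2L2 Ω := hφ₀L.toLp φ₀
  have hφ : φ =ᵐ[volume] φ₀ := hφ₀L.coeFn_toLp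
  have hdiff : p.diffusion φ U =ᵐ[volume] (r • φ - f : L2L2 Ω) := by
    filter_upwards [hφ, Lp.coeFn_sub (r • φ) f, Lp.coeFn_smul r φ] with ξ h1 h2 h3
    rw [h2, Pi.sub_apply, h3, Pi.smul_apply, Coeffs.diffusion, h1]
    have h4 : f ξ = (r + ξ ^ 2 + p.η) • (r + ξ ^ 2 + p.η)⁻¹ • f ξ := by
      rw [smul_smul, mul_inv_cancel₀ (hq ξ).ne', one_smul]
    have h5 : p.μ ξ • U = (r + ξ ^ 2 + p.η) • (p.μ ξ / (r + ξ ^ 2 + p.η)) • U := by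
      rw [smul_smul, mul_div_cancel₀ _ (hq ξ).ne']
    simp only [h5, hφ₀]
    nth_rewrite 3 [h4]
    module
  have hdL : MemLp (p.diffusion φ U) 2 volume := (memLp_congr_ae hdiff).2 (Lp.memLp _)
  have hi1 : Integrable fun ξ : ℝ => (p.μ ξ / (r + ξ ^ 2 + p.η)) • f ξ :=
    memLp_one_iff_integrable.1 (MemLp.smul (p := 2) (q := 2) (Lp.memLp f) (hp.memLp_μ_div hr))
  have hi2 : Integrable fun ξ : ℝ => (p.μ ξ ^ 2 / (r + ξ ^ 2 + p.η)) • U :=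
    (hp.integrable_μ_sq_div hr).smul_const U
  have hμφ : (fun ξ : ℝ => p.μ ξ • φ ξ) =ᵐ[volume] fun ξ =>
      (p.μ ξ / (r + ξ ^ 2 + p.η)) • f ξ + (p.μ ξ ^ 2 / (r + ξ ^ 2 + p.η)) • U := by
    filter_upwards [hφ] with ξ h1
    rw [h1, hφ₀]
    simp only [smul_add, smul_smul]
    congr 2
    ring
  refine ⟨φ, (integrable_congr hμφ).2 (hi1.add hi2), ?_, hdL, ?_, ?_⟩
  · have h1 : MemLp (fun ξ : ℝ => (ξ * (r + ξ ^ 2 + p.η)⁻¹) • f ξ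
        + (ξ * (p.μ ξ / (r + ξ ^ 2 + p.η))) • U) 2 volume := by
      refine MemLp.add ((Lp.memLp f).of_le_mul (c := r⁻¹ + 1)
        ((measurable_id.mul hqm.inv).aestronglyMeasurable.smul hfm)
        (Eventually.of_forall fun ξ => ?_)) (memLp_smul_const (hp.memLp_mul_μ_div hr) U)
      rw [norm_smul]
      refine mul_le_mul_of_nonneg_right ?_ (norm_nonneg _)
      rw [norm_mul, Real.norm_eq_abs, Real.norm_of_nonneg (inv_nonneg.2 (hq ξ).le),
        ← div_eq_mul_inv, div_le_iff₀ (hq ξ)]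
      have h2 : |ξ| ≤ 1 + ξ ^ 2 := by
        rw [← sq_abs]; nlinarith [sq_nonneg (|ξ| - 1), abs_nonneg ξ]
      have h3 : (1 : ℝ) ≤ r⁻¹ * (r + ξ ^ 2 + p.η) := by
        rw [← div_eq_inv_mul, one_le_div hr]; nlinarith [sq_nonneg ξ]
      nlinarith
    refine (memLp_congr_ae ?_).2 h1
    filter_upwards [hφ] with ξ h1
    rw [h1, hφ₀]
    simp only [smul_add, smul_smul]
  · rw [Coeffs.diffusionLp, dif_pos hdL]
    have : hdL.toLp (p.diffusion φ U) = r • φ - f := Lp.ext (hdL.coeFn_toLp.trans hdiff)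
    rw [this, sub_sub_cancel]
  · rw [integral_congr_ae hμφ, integral_add hi1 hi2, integral_smul_const]

theorem Coeffs.coeFn_diffusionLp {φ : L2L2 Ω} {U : L2 Ω}
    (h : MemLp (p.diffusion φ U) 2 volume) : p.diffusionLp φ U =ᵐ[volume] p.diffusion φ U := by
  rw [Coeffs.diffusionLp, dif_pos h]
  exact h.coeFn_toLp

theorem Coeffs.diffusion_add (φ ψ : L2L2 Ω) (U V : L2 Ω) :
    p.diffusion (φ + ψ) (U + V) =ᵐ[volume] p.diffusion φ U + p.diffusion ψ V := by
  filter_upwards [Lp.coeFn_add φ ψ] with ξ h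
  rw [Pi.add_apply, Coeffs.diffusion, h, Pi.add_apply, Coeffs.diffusion, Coeffs.diffusion]
  module

theorem Coeffs.diffusion_smul (c : ℝ) (φ : L2L2 Ω) (U : L2 Ω) :
    p.diffusion (c • φ) (c • U) =ᵐ[volume] c • p.diffusion φ U := by
  filter_upwards [Lp.coeFn_smul c φ] with ξ h
  rw [Pi.smul_apply, Coeffs.diffusion, h, Pi.smul_apply, Coeffs.diffusion]
  module

theorem Coeffs.diffusionLp_add {φ ψ : L2L2 Ω} {U V : L2 Ω}
    (h : MemLp (p.diffusion φ U) 2 volume) (h' : MemLp (p.diffusion ψ V) 2 volume) :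
    MemLp (p.diffusion (φ + ψ) (U + V)) 2 volume ∧
      p.diffusionLp (φ + ψ) (U + V) = p.diffusionLp φ U + p.diffusionLp ψ V := by
  have hm : MemLp (p.diffusion (φ + ψ) (U + V)) 2 volume :=
    (memLp_congr_ae (p.diffusion_add φ ψ U V)).2 (h.add h')
  refine ⟨hm, Lp.ext ?_⟩
  filter_upwards [p.coeFn_diffusionLp hm, p.coeFn_diffusionLp h, p.coeFn_diffusionLp h',
    Lp.coeFn_add (p.diffusionLp φ U) (p.diffusionLp ψ V), p.diffusion_add φ ψ U V]
    with ξ h1 h2 h3 h4 h5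
  rw [h1, h4, h5, Pi.add_apply, Pi.add_apply, h2, h3]

theorem Coeffs.diffusionLp_smul (c : ℝ) {φ : L2L2 Ω} {U : L2 Ω}
    (h : MemLp (p.diffusion φ U) 2 volume) :
    MemLp (p.diffusion (c • φ) (c • U)) 2 volume ∧
      p.diffusionLp (c • φ) (c • U) = c • p.diffusionLp φ U := by
  have hm : MemLp (p.diffusion (c • φ) (c • U)) 2 volume :=
    (memLp_congr_ae (p.diffusion_smul c φ U)).2 (h.const_smul c)
  refine ⟨hm, Lp.ext ?_⟩
  filter_upwards [p.coeFn_diffusionLp hm, p.coeFn_diffusionLp h,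
    Lp.coeFn_smul c (p.diffusionLp φ U), p.diffusion_smul c φ U] with ξ h1 h2 h3 h4
  rw [h1, h3, h4, Pi.smul_apply, Pi.smul_apply, h2]

theorem smul_add_ae (a : ℝ → ℝ) (φ ψ : L2L2 Ω) :
    (fun ξ => a ξ • (φ + ψ) ξ) =ᵐ[volume] fun ξ => a ξ • φ ξ + a ξ • ψ ξ := by
  filter_upwards [Lp.coeFn_add φ ψ] with ξ h
  rw [h, Pi.add_apply, smul_add]

theorem smul_smul_ae (a : ℝ → ℝ) (c : ℝ) (φ : L2L2 Ω) :
    (fun ξ => a ξ • (c • φ) ξ) =ᵐ[volume] fun ξ => c • (a ξ • φ ξ) := by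
  filter_upwards [Lp.coeFn_smul c φ] with ξ h
  rw [h, Pi.smul_apply, smul_comm]

theorem integrable_weight_mul_sq {φ : L2L2 Ω} (h : MemLp (fun ξ : ℝ => ξ • φ ξ) 2 volume)
    (η : ℝ) : Integrable fun ξ : ℝ => (ξ ^ 2 + η) * ‖φ ξ‖ ^ 2 := by
  have h1 := h.integrable_norm_pow (p := 2) two_ne_zero
  have h2 := (Lp.memLp φ).integrable_norm_pow (p := 2) two_ne_zero
  refine (h1.add (h2.const_mul η)).congr (Eventually.of_forall fun ξ => ?_)
  simp only [Pi.add_apply, norm_smul, Real.norm_eq_abs, mul_pow, sq_abs]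
  ring

/-- Integrate the pointwise product in `ξ`. The first term on the right is what cancels the memory
term of the momentum equation in the energy balance. -/
theorem Coeffs.inner_diffusionLp {φ : L2L2 Ω} {U : L2 Ω}
    (hi : Integrable fun ξ : ℝ => p.μ ξ • φ ξ) (hm : MemLp (fun ξ : ℝ => ξ • φ ξ) 2 volume)
    (hd : MemLp (p.diffusion φ U) 2 volume) :
    inner ℝ (p.diffusionLp φ U) φ
      = inner ℝ (∫ ξ : ℝ, p.μ ξ • φ ξ) U - ∫ ξ : ℝ, (ξ ^ 2 + p.η) * ‖φ ξ‖ ^ 2 := by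
  rw [real_inner_comm U, ← integral_inner hi, ← integral_sub (hi.const_inner U)
    (integrable_weight_mul_sq hm p.η), L2.inner_def]
  refine integral_congr_ae ?_
  filter_upwards [p.coeFn_diffusionLp hd] with ξ h
  rw [h, Coeffs.diffusion, inner_add_left, inner_neg_left, real_inner_smul_left,
    real_inner_smul_left, real_inner_self_eq_norm_sq, real_inner_smul_right]
  ring

end Diffusion

/-! ### The energy form -/

section EnergyForm

/-- The bilinear form `(x, y) ↦ ⟪S x, T y⟫`. -/
def innerForm {E F : Type*} [NormedAddCommGroup E] [NormedSpace ℝ E] [NormedAddCommGroup F]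
    [InnerProductSpace ℝ F] (S T : E →L[ℝ] F) : E →L[ℝ] E →L[ℝ] ℝ :=
  ContinuousLinearMap.bilinearComp (innerSL ℝ : F →L[ℝ] F →L[ℝ] ℝ) S T

@[simp]
theorem innerForm_apply {E F : Type*} [NormedAddCommGroup E] [NormedSpace ℝ E]
    [NormedAddCommGroup F] [InnerProductSpace ℝ F] (S T : E →L[ℝ] F) (x y : E) :
    innerForm S T x y = inner ℝ (S x) (T y) := rfl

theorem IsEnergyForm.add_innerForm {E F : Type*} [NormedAddCommGroup E] [NormedSpace ℝ E]
    [NormedAddCommGroup F] [InnerProductSpace ℝ F] {B : E →L[ℝ] E →L[ℝ] ℝ} (hB : IsEnergyForm B)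
    (T : E →L[ℝ] F) {s : ℝ} (hs : 0 ≤ s) : IsEnergyForm (B + s • innerForm T T) := by
  obtain ⟨c, hc, h⟩ := hB.coercive
  refine ⟨fun x y => ?_, c, hc, fun x => (h x).trans ?_⟩
  · simp only [_root_.add_apply, _root_.smul_apply, innerForm_apply, hB.symm x, real_inner_comm]
  · simp only [_root_.add_apply, _root_.smul_apply, innerForm_apply, smul_eq_mul,
      real_inner_self_eq_norm_sq]
    exact le_add_of_nonneg_right (by positivity)

theorem norm_sq_le_add {E F : Type*} [SeminormedAddCommGroup E] [SeminormedAddCommGroup F]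
    (x : E × F) : ‖x‖ ^ 2 ≤ ‖x.1‖ ^ 2 + ‖x.2‖ ^ 2 := by
  rcases max_choice ‖x.1‖ ‖x.2‖ with h | h <;> rw [Prod.norm_def, h]
  · exact le_add_of_nonneg_right (sq_nonneg _)
  · exact le_add_of_nonneg_left (sq_nonneg _)

variable {n : ℕ} {Ω : Set (Space n)} {p : Coeffs}

theorem H10.exists_norm_sq_le [NeZero n] (hΩ : Bornology.IsBounded Ω) :
    ∃ K : ℝ, 0 < K ∧ ∀ u : H10 Ω, ‖u‖ ^ 2 ≤ K * ∑ i, ‖u.grad i‖ ^ 2 := by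
  obtain ⟨C, hC, h⟩ := H10.exists_norm_fn_le hΩ 0
  refine ⟨C ^ 2 + 1, by positivity, fun u => ?_⟩
  have hle : ∀ i, ‖u.grad i‖ ^ 2 ≤ ∑ i, ‖u.grad i‖ ^ 2 := fun i =>
    Finset.single_le_sum (f := fun i => ‖u.grad i‖ ^ 2) (fun j _ => sq_nonneg _)
      (Finset.mem_univ i)
  have h0 : 0 ≤ ∑ i, ‖u.grad i‖ ^ 2 := Finset.sum_nonneg fun i _ => sq_nonneg _
  have h1 : ‖u.fn‖ ^ 2 ≤ C ^ 2 * ∑ i, ‖u.grad i‖ ^ 2 :=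
    calc ‖u.fn‖ ^ 2 ≤ (C * ‖u.grad 0‖) ^ 2 := pow_le_pow_left₀ (norm_nonneg _) (h u) 2
      _ = C ^ 2 * ‖u.grad 0‖ ^ 2 := mul_pow _ _ _
      _ ≤ _ := mul_le_mul_of_nonneg_left (hle 0) (sq_nonneg _)
  have h2 : ‖u.1.2‖ ≤ √(∑ i, ‖u.grad i‖ ^ 2) :=
    (pi_norm_le_iff_of_nonneg (Real.sqrt_nonneg _)).2 fun i =>
      Real.le_sqrt_of_sq_le (hle i)
  have h3 : ‖u.1.2‖ ^ 2 ≤ ∑ i, ‖u.grad i‖ ^ 2 := by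
    rw [← Real.sq_sqrt h0]
    exact pow_le_pow_left₀ (norm_nonneg _) h2 2
  calc ‖u‖ ^ 2 ≤ ‖u.fn‖ ^ 2 + ‖u.1.2‖ ^ 2 := norm_sq_le_add u.1
    _ ≤ _ := by linarith

/-- The form `∫ (a₁₁ ∇u·∇u' + a₁₂ (∇u·∇v' + ∇v·∇u') + a₂₂ ∇v·∇v') + κ ∫ (u - v) (u' - v')`. -/
def Coeffs.elasticForm (p : Coeffs) (Ω : Set (Space n)) :
    (H10 Ω × H10 Ω) →L[ℝ] (H10 Ω × H10 Ω) →L[ℝ] ℝ :=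
  let u := ContinuousLinearMap.fst ℝ (H10 Ω) (H10 Ω)
  let v := ContinuousLinearMap.snd ℝ (H10 Ω) (H10 Ω)
  ∑ i, (innerForm (H10.gradL i ∘L (p.a₁₁ • u + p.a₁₂ • v)) (H10.gradL i ∘L u)
      + innerForm (H10.gradL i ∘L (p.a₁₂ • u + p.a₂₂ • v)) (H10.gradL i ∘L v))
    + p.κ • innerForm (H10.fnL ∘L (u - v)) (H10.fnL ∘L (u - v))

theorem Coeffs.elasticForm_apply (x y : H10 Ω × H10 Ω) : p.elasticForm Ω x y =
    ∑ i, (inner ℝ ((p.a₁₁ • x.1 + p.a₁₂ • x.2).grad i) (y.1.grad i)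
      + inner ℝ ((p.a₁₂ • x.1 + p.a₂₂ • x.2).grad i) (y.2.grad i))
    + p.κ * inner ℝ (x.1.fn - x.2.fn) (y.1.fn - y.2.fn) := by
  simp only [Coeffs.elasticForm, _root_.add_apply, _root_.sum_apply,
    _root_.smul_apply, innerForm_apply, smul_eq_mul]
  rfl

theorem H10.grad_add_smul (a b : ℝ) (u v : H10 Ω) (i : Fin n) :
    (a • u + b • v).grad i = a • u.grad i + b • v.grad i := rfl

theorem Coeffs.elasticForm_symm (x y : H10 Ω × H10 Ω) :
    p.elasticForm Ω x y = p.elasticForm Ω y x := by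
  rw [Coeffs.elasticForm_apply, Coeffs.elasticForm_apply,
    real_inner_comm (x.1.fn - x.2.fn) (y.1.fn - y.2.fn)]
  congr 1
  refine Finset.sum_congr rfl fun i _ => ?_
  simp only [H10.grad_add_smul, inner_add_left, real_inner_smul_left]
  simp only [real_inner_comm (x.1.grad i), real_inner_comm (x.2.grad i)]
  ring

theorem Coeffs.elasticForm_self (x : H10 Ω × H10 Ω) : p.elasticForm Ω x x =
    ∑ i, (p.a₁₁ * ‖x.1.grad i‖ ^ 2 + 2 * p.a₁₂ * inner ℝ (x.1.grad i) (x.2.grad i)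
        + p.a₂₂ * ‖x.2.grad i‖ ^ 2) + p.κ * ‖x.1.fn - x.2.fn‖ ^ 2 := by
  rw [Coeffs.elasticForm_apply, real_inner_self_eq_norm_sq]
  congr 1
  refine Finset.sum_congr rfl fun i _ => ?_
  simp only [H10.grad_add_smul, inner_add_left, real_inner_smul_left, real_inner_self_eq_norm_sq,
    real_inner_comm (x.1.grad i) (x.2.grad i)]
  ring

/-- The constant is determinant over trace, which is below the smaller eigenvalue. -/
theorem exists_le_quadratic_form {F : Type*} [NormedAddCommGroup F] [InnerProductSpace ℝ F]
    {a b d : ℝ} (ha : 0 < a) (h : 0 < a * d - b ^ 2) : ∃ c : ℝ, 0 < c ∧ ∀ x y : F,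
      c * (‖x‖ ^ 2 + ‖y‖ ^ 2) ≤ a * ‖x‖ ^ 2 + 2 * b * inner ℝ x y + d * ‖y‖ ^ 2 := by
  have hd : 0 < d := by
    by_contra! hd
    nlinarith [mul_nonneg ha.le (neg_nonneg.2 hd), sq_nonneg b]
  have hs : 0 < a + d := by positivity
  refine ⟨(a * d - b ^ 2) / (a + d), by positivity, fun x y => ?_⟩
  -- By Cayley–Hamilton this square is the trace times the form minus the determinant times `‖x‖² +
  -- ‖y‖²`.
  have h1 : 0 ≤ ‖a • x + b • y‖ ^ 2 + ‖b • x + d • y‖ ^ 2 := by positivity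
  rw [norm_add_sq_real, norm_add_sq_real] at h1
  simp only [norm_smul, real_inner_smul_left, real_inner_smul_right, mul_pow, Real.norm_eq_abs,
    sq_abs] at h1
  rw [div_mul_eq_mul_div, div_le_iff₀ hs]
  nlinarith

theorem Coeffs.Admissible.isEnergyForm_elasticForm [NeZero n] (hp : p.Admissible)
    (hΩ : Bornology.IsBounded Ω) : IsEnergyForm (p.elasticForm Ω) := by
  obtain ⟨K, hK, hK'⟩ := H10.exists_norm_sq_le hΩ
  obtain ⟨c, hc, hc'⟩ := exists_le_quadratic_form (F := L2 Ω) hp.a₁₁_pos hp.det_pos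
  refine ⟨p.elasticForm_symm, c / K, by positivity, fun x => ?_⟩
  have h1 : ‖x‖ ^ 2 ≤ K * ∑ i, (‖x.1.grad i‖ ^ 2 + ‖x.2.grad i‖ ^ 2) := by
    rw [Finset.sum_add_distrib, mul_add]
    exact (norm_sq_le_add x).trans (add_le_add (hK' x.1) (hK' x.2))
  have h2 := mul_nonneg hp.κ_nonneg (sq_nonneg ‖x.1.fn - x.2.fn‖)
  rw [p.elasticForm_self]
  calc c / K * ‖x‖ ^ 2 ≤ c / K * (K * ∑ i, (‖x.1.grad i‖ ^ 2 + ‖x.2.grad i‖ ^ 2)) :=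
        mul_le_mul_of_nonneg_left h1 (by positivity)
    _ = ∑ i, c * (‖x.1.grad i‖ ^ 2 + ‖x.2.grad i‖ ^ 2) := by
        rw [← mul_assoc, div_mul_cancel₀ _ hK.ne', Finset.mul_sum]
    _ ≤ ∑ i, (p.a₁₁ * ‖x.1.grad i‖ ^ 2 + 2 * p.a₁₂ * inner ℝ (x.1.grad i) (x.2.grad i)
        + p.a₂₂ * ‖x.2.grad i‖ ^ 2) := Finset.sum_le_sum fun i _ => hc' _ _
    _ ≤ _ := le_add_of_nonneg_right h2

/-- The bilinear form of twice the energy. -/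
def Coeffs.energyForm (p : Coeffs) (Ω : Set (Space n)) :
    Phase Ω →L[ℝ] Phase Ω →L[ℝ] ℝ :=
  let T₀ := ContinuousLinearMap.id ℝ (Phase Ω)
  let T₁ := ContinuousLinearMap.snd ℝ _ _ ∘L T₀
  let T₂ := ContinuousLinearMap.snd ℝ _ _ ∘L T₁
  let T₃ := ContinuousLinearMap.snd ℝ _ _ ∘L T₂
  let T₄ := ContinuousLinearMap.snd ℝ _ _ ∘L T₃
  let q := (ContinuousLinearMap.fst ℝ _ _ ∘L T₀).prod (ContinuousLinearMap.fst ℝ _ _ ∘L T₁)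
  let U := ContinuousLinearMap.fst ℝ _ _ ∘L T₂
  let V := ContinuousLinearMap.fst ℝ _ _ ∘L T₃
  let φ₁ := ContinuousLinearMap.fst ℝ _ _ ∘L T₄
  let φ₂ := ContinuousLinearMap.snd ℝ _ _ ∘L T₄
  (p.elasticForm Ω).bilinearComp q q + p.ρ₁ • innerForm U U + p.ρ₂ • innerForm V V
    + p.c • innerForm φ₁ φ₁ + p.c • innerForm φ₂ φ₂

theorem Coeffs.energyForm_apply (W Z : Phase Ω) : p.energyForm Ω W Z =
    p.elasticForm Ω (W.u, W.v) (Z.u, Z.v) + p.ρ₁ * inner ℝ W.U Z.U + p.ρ₂ * inner ℝ W.V Z.V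
      + p.c * inner ℝ W.φ₁ Z.φ₁ + p.c * inner ℝ W.φ₂ Z.φ₂ := rfl

theorem Coeffs.energy_eq (W : Phase Ω) : p.energy W = 1 / 2 * p.energyForm Ω W W := by
  rw [Coeffs.energyForm_apply, p.elasticForm_self, Coeffs.energy]
  simp only [real_inner_self_eq_norm_sq]
  ring

theorem Coeffs.Admissible.isEnergyForm [NeZero n] (hp : p.Admissible)
    (hΩ : Bornology.IsBounded Ω) : IsEnergyForm (p.energyForm Ω) := by
  have hE := hp.isEnergyForm_elasticForm hΩ
  obtain ⟨c, hc, hc'⟩ := hE.coercive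
  refine ⟨fun x y => ?_, min c (min p.ρ₁ (min p.ρ₂ p.c)),
    lt_min hc (lt_min hp.ρ₁_pos (lt_min hp.ρ₂_pos hp.c_pos)), fun W => ?_⟩
  · rw [p.energyForm_apply, p.energyForm_apply, hE.symm (x.u, x.v), real_inner_comm x.U,
      real_inner_comm x.V, real_inner_comm x.φ₁, real_inner_comm x.φ₂]
  · set m := min c (min p.ρ₁ (min p.ρ₂ p.c))
    have m1 : m ≤ c := min_le_left _ _
    have m2 : m ≤ p.ρ₁ := (min_le_right _ _).trans (min_le_left _ _)
    have m3 : m ≤ p.ρ₂ := (min_le_right _ _).trans ((min_le_right _ _).trans (min_le_left _ _))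
    have m4 : m ≤ p.c := (min_le_right _ _).trans ((min_le_right _ _).trans (min_le_right _ _))
    have m0 : 0 < m := lt_min hc (lt_min hp.ρ₁_pos (lt_min hp.ρ₂_pos hp.c_pos))
    have hn : ‖W‖ ^ 2 ≤ ‖((W.u, W.v) : H10 Ω × H10 Ω)‖ ^ 2 + ‖W.U‖ ^ 2 + ‖W.V‖ ^ 2
        + ‖W.φ₁‖ ^ 2 + ‖W.φ₂‖ ^ 2 := by
      have e : ‖W‖ = max ‖((W.u, W.v) : H10 Ω × H10 Ω)‖ ‖W.2.2‖ := by
        simp only [Prod.norm_def, max_assoc]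
      have h1 := norm_sq_le_add (((W.u, W.v) : H10 Ω × H10 Ω), W.2.2)
      rw [Prod.norm_def] at h1
      rw [e]
      linarith [norm_sq_le_add W.2.2, norm_sq_le_add W.2.2.2, norm_sq_le_add W.2.2.2.2]
    rw [p.energyForm_apply]
    simp only [real_inner_self_eq_norm_sq]
    have h0 := (mul_le_mul_of_nonneg_right m1 (sq_nonneg _)).trans (hc' (W.u, W.v))
    have h1 := mul_le_mul_of_nonneg_right m2 (sq_nonneg ‖W.U‖)
    have h2 := mul_le_mul_of_nonneg_right m3 (sq_nonneg ‖W.V‖)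
    have h3 := mul_le_mul_of_nonneg_right m4 (sq_nonneg ‖W.φ₁‖)
    have h4 := mul_le_mul_of_nonneg_right m4 (sq_nonneg ‖W.φ₂‖)
    have h5 := mul_le_mul_of_nonneg_left hn m0.le
    linarith

end EnergyForm

/-! ### The operator -/

section Operator

variable {n : ℕ} {Ω : Set (Space n)} {p : Coeffs}

theorem toH10_add (hΩ : IsOpen Ω) {U V : L2 Ω} (hU : MemH10 U) (hV : MemH10 V) :
    toH10 (U + V) = toH10 U + toH10 V :=
  toH10_eq hΩ (congrArg₂ (· + ·) (toH10_fn hU) (toH10_fn hV))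

theorem toH10_smul (hΩ : IsOpen Ω) (c : ℝ) {U : L2 Ω} (hU : MemH10 U) :
    toH10 (c • U) = c • toH10 U :=
  toH10_eq hΩ (congrArg (c • ·) (toH10_fn hU))

theorem MemH10.add {U V : L2 Ω} (hU : MemH10 U) (hV : MemH10 V) : MemH10 (U + V) := by
  obtain ⟨u, rfl⟩ := hU
  obtain ⟨v, rfl⟩ := hV
  exact ⟨u + v, rfl⟩

theorem MemH10.smul (c : ℝ) {U : L2 Ω} (hU : MemH10 U) : MemH10 (c • U) := by
  obtain ⟨u, rfl⟩ := hU
  exact ⟨c • u, rfl⟩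

theorem combination_add (a b : ℝ) (u v u' v' : H10 Ω) : a • (u + u').fn + b • (v + v').fn
    = (a • u.fn + b • v.fn) + (a • u'.fn + b • v'.fn) := by
  change a • (u.fn + u'.fn) + b • (v.fn + v'.fn) = _
  module

theorem combination_smul (a b c : ℝ) (u v : H10 Ω) : a • (c • u).fn + b • (c • v).fn
    = c • (a • u.fn + b • v.fn) := by
  change a • (c • u.fn) + b • (c • v.fn) = _
  module

theorem Coeffs.MemDomain.add (hΩ : IsOpen Ω) {W Z : Phase Ω} (hW : p.MemDomain W)
    (hZ : p.MemDomain Z) : p.MemDomain (W + Z) where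
  memH10_U := hW.memH10_U.add hZ.memH10_U
  memH10_V := hW.memH10_V.add hZ.memH10_V
  memH2₁ := (combination_add _ _ W.u W.v Z.u Z.v).symm ▸ hW.memH2₁.add hΩ hZ.memH2₁
  memH2₂ := (combination_add _ _ W.u W.v Z.u Z.v).symm ▸ hW.memH2₂.add hΩ hZ.memH2₂
  integrable₁ := (integrable_congr (smul_add_ae _ _ _)).2 (hW.integrable₁.add hZ.integrable₁)
  integrable₂ := (integrable_congr (smul_add_ae _ _ _)).2 (hW.integrable₂.add hZ.integrable₂)
  memLp_mul₁ := (memLp_congr_ae (smul_add_ae _ _ _)).2 (hW.memLp_mul₁.add hZ.memLp_mul₁)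
  memLp_mul₂ := (memLp_congr_ae (smul_add_ae _ _ _)).2 (hW.memLp_mul₂.add hZ.memLp_mul₂)
  memLp_diffusion₁ := (p.diffusionLp_add hW.memLp_diffusion₁ hZ.memLp_diffusion₁).1
  memLp_diffusion₂ := (p.diffusionLp_add hW.memLp_diffusion₂ hZ.memLp_diffusion₂).1

theorem Coeffs.MemDomain.smul (hΩ : IsOpen Ω) (c : ℝ) {W : Phase Ω} (hW : p.MemDomain W) :
    p.MemDomain (c • W) where
  memH10_U := hW.memH10_U.smul c
  memH10_V := hW.memH10_V.smul c
  memH2₁ := (combination_smul _ _ c W.u W.v).symm ▸ hW.memH2₁.smul hΩ c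
  memH2₂ := (combination_smul _ _ c W.u W.v).symm ▸ hW.memH2₂.smul hΩ c
  integrable₁ := (integrable_congr (smul_smul_ae _ _ _)).2 (hW.integrable₁.smul c)
  integrable₂ := (integrable_congr (smul_smul_ae _ _ _)).2 (hW.integrable₂.smul c)
  memLp_mul₁ := (memLp_congr_ae (smul_smul_ae _ _ _)).2 (hW.memLp_mul₁.const_smul c)
  memLp_mul₂ := (memLp_congr_ae (smul_smul_ae _ _ _)).2 (hW.memLp_mul₂.const_smul c)
  memLp_diffusion₁ := (p.diffusionLp_smul c hW.memLp_diffusion₁).1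
  memLp_diffusion₂ := (p.diffusionLp_smul c hW.memLp_diffusion₂).1

theorem memH2_zero (hΩ : IsOpen Ω) : MemH2 (0 : L2 Ω) := by
  have h : ∀ i : Fin n, HasWeakDeriv i (0 : L2 Ω) 0 := (0 : H10 Ω).hasWeakDeriv
  refine ⟨fun i => ⟨0, h i⟩, fun i j => ⟨0, ?_⟩⟩
  rw [(h i).weakDeriv_eq hΩ]
  exact h j

theorem Coeffs.memDomain_zero (hΩ : IsOpen Ω) : p.MemDomain (0 : Phase Ω) := by
  have h0 : ∀ f : ℝ → ℝ, (fun ξ => f ξ • (0 : L2L2 Ω) ξ) =ᵐ[volume] fun _ => (0 : L2 Ω) :=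
    fun f => by
      filter_upwards [Lp.coeFn_zero (L2 Ω) 2 (volume : Measure ℝ)] with ξ h
      rw [h, Pi.zero_apply, smul_zero]
  have hd : p.diffusion (0 : L2L2 Ω) 0 =ᵐ[volume] fun _ => (0 : L2 Ω) := by
    filter_upwards [h0 fun ξ => ξ ^ 2 + p.η] with ξ h
    rw [Coeffs.diffusion, h, smul_zero, neg_zero, add_zero]
  have h2 : ∀ a b : ℝ, MemH2 (a • (0 : H10 Ω).fn + b • (0 : H10 Ω).fn) := fun a b => by
    change MemH2 (a • (0 : L2 Ω) + b • (0 : L2 Ω))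
    simpa using memH2_zero hΩ
  exact ⟨⟨0, rfl⟩, ⟨0, rfl⟩, h2 _ _, h2 _ _,
    (integrable_congr (h0 _)).2 (integrable_zero _ _ _),
    (integrable_congr (h0 _)).2 (integrable_zero _ _ _),
    (memLp_congr_ae (h0 _)).2 MemLp.zero', (memLp_congr_ae (h0 _)).2 MemLp.zero',
    (memLp_congr_ae hd).2 MemLp.zero', (memLp_congr_ae hd).2 MemLp.zero'⟩

/-- The domain of the operator as a subspace. -/
def Coeffs.domain (p : Coeffs) (hΩ : IsOpen Ω) : Submodule ℝ (Phase Ω) where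
  carrier := {W | p.MemDomain W}
  zero_mem' := p.memDomain_zero hΩ
  add_mem' hW hZ := hW.add hΩ hZ
  smul_mem' c _ hW := hW.smul hΩ c

theorem Coeffs.op_add (hΩ : IsOpen Ω) {W Z : Phase Ω} (hW : p.MemDomain W)
    (hZ : p.MemDomain Z) : p.op (W + Z) = p.op W + p.op Z := by
  have hc : (W + Z).u.fn - (W + Z).v.fn = (W.u.fn - W.v.fn) + (Z.u.fn - Z.v.fn) :=
    add_sub_add_comm _ _ _ _
  simp only [Coeffs.op, Prod.mk_add_mk]
  refine Prod.ext (toH10_add hΩ hW.memH10_U hZ.memH10_U) (Prod.ext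
    (toH10_add hΩ hW.memH10_V hZ.memH10_V) (Prod.ext ?_ (Prod.ext ?_ (Prod.ext
      (p.diffusionLp_add hW.memLp_diffusion₁ hZ.memLp_diffusion₁).2
      (p.diffusionLp_add hW.memLp_diffusion₂ hZ.memLp_diffusion₂).2))))
  · have hi : ∫ ξ : ℝ, p.μ ξ • (W + Z).φ₁ ξ = _ := (integral_congr_ae (smul_add_ae _ _ _)).trans
      (integral_add hW.integrable₁ hZ.integrable₁)
    have hl : laplacian (p.a₁₁ • (W + Z).u.fn + p.a₁₂ • (W + Z).v.fn) = _ :=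
      (congrArg laplacian (combination_add _ _ W.u W.v Z.u Z.v)).trans
        (laplacian_add hΩ hW.memH2₁ hZ.memH2₁)
    dsimp only
    rw [hi, hl, hc]
    module
  · have hi : ∫ ξ : ℝ, p.μ ξ • (W + Z).φ₂ ξ = _ := (integral_congr_ae (smul_add_ae _ _ _)).trans
      (integral_add hW.integrable₂ hZ.integrable₂)
    have hl : laplacian (p.a₁₂ • (W + Z).u.fn + p.a₂₂ • (W + Z).v.fn) = _ :=
      (congrArg laplacian (combination_add _ _ W.u W.v Z.u Z.v)).trans
        (laplacian_add hΩ hW.memH2₂ hZ.memH2₂)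
    dsimp only
    rw [hi, hl, hc]
    module

theorem Coeffs.op_smul (hΩ : IsOpen Ω) (c : ℝ) {W : Phase Ω} (hW : p.MemDomain W) :
    p.op (c • W) = c • p.op W := by
  have hc : (c • W).u.fn - (c • W).v.fn = c • (W.u.fn - W.v.fn) := (smul_sub _ _ _).symm
  simp only [Coeffs.op, Prod.smul_mk]
  refine Prod.ext (toH10_smul hΩ c hW.memH10_U) (Prod.ext
    (toH10_smul hΩ c hW.memH10_V) (Prod.ext ?_ (Prod.ext ?_ (Prod.ext
      (p.diffusionLp_smul c hW.memLp_diffusion₁).2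
      (p.diffusionLp_smul c hW.memLp_diffusion₂).2))))
  · have hi : ∫ ξ : ℝ, p.μ ξ • (c • W).φ₁ ξ = _ :=
      (integral_congr_ae (smul_smul_ae _ _ _)).trans (integral_smul c _)
    have hl : laplacian (p.a₁₁ • (c • W).u.fn + p.a₁₂ • (c • W).v.fn) = _ :=
      (congrArg laplacian (combination_smul _ _ c W.u W.v)).trans
        (laplacian_smul hΩ c hW.memH2₁)
    dsimp only
    rw [hi, hl, hc]
    module
  · have hi : ∫ ξ : ℝ, p.μ ξ • (c • W).φ₂ ξ = _ :=
      (integral_congr_ae (smul_smul_ae _ _ _)).trans (integral_smul c _)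
    have hl : laplacian (p.a₁₂ • (c • W).u.fn + p.a₂₂ • (c • W).v.fn) = _ :=
      (congrArg laplacian (combination_smul _ _ c W.u W.v)).trans
        (laplacian_smul hΩ c hW.memH2₂)
    dsimp only
    rw [hi, hl, hc]
    module

theorem H10.inner_laplacian (hΩ : IsOpen Ω) {z : H10 Ω} (hz : MemH2 z.fn) (w : H10 Ω) :
    ∑ i, inner ℝ (z.grad i) (w.grad i) = -inner ℝ (laplacian z.fn) w.fn := by
  rw [hz.inner_laplacian, neg_neg]
  simp only [(z.hasWeakDeriv _).weakDeriv_eq hΩ]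

theorem Coeffs.MemDomain.finiteDissipation {W : Phase Ω} (hW : p.MemDomain W) :
    p.FiniteDissipation W :=
  ⟨integrable_weight_mul_sq hW.memLp_mul₁ _, integrable_weight_mul_sq hW.memLp_mul₂ _⟩

/-- Green's formula cancels the elastic terms against the Laplacians, the densities cancel their
inverses, and the common weight `p.c` cancels the memory integrals against the sources of the
diffusive equations. -/
theorem Coeffs.Admissible.energyForm_op (hp : p.Admissible) (hΩ : IsOpen Ω) {W : Phase Ω}
    (hW : p.MemDomain W) : p.energyForm Ω (p.op W) W = -p.dissipation W := by
  have hρ₁ := hp.ρ₁_pos.ne'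
  have hρ₂ := hp.ρ₂_pos.ne'
  have h1 : ∑ i, inner ℝ ((p.a₁₁ • W.u + p.a₁₂ • W.v).grad i) ((toH10 W.U).grad i)
      = -inner ℝ (laplacian (p.a₁₁ • W.u.fn + p.a₁₂ • W.v.fn)) W.U := by
    rw [H10.inner_laplacian hΩ (z := p.a₁₁ • W.u + p.a₁₂ • W.v) hW.memH2₁, toH10_fn hW.memH10_U]
    rfl
  have h2 : ∑ i, inner ℝ ((p.a₁₂ • W.u + p.a₂₂ • W.v).grad i) ((toH10 W.V).grad i)
      = -inner ℝ (laplacian (p.a₁₂ • W.u.fn + p.a₂₂ • W.v.fn)) W.V := by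
    rw [H10.inner_laplacian hΩ (z := p.a₁₂ • W.u + p.a₂₂ • W.v) hW.memH2₂, toH10_fn hW.memH10_V]
    rfl
  have e₁ : (p.op W).u = toH10 W.U := rfl
  have e₂ : (p.op W).v = toH10 W.V := rfl
  have e₃ : (p.op W).U = p.ρ₁⁻¹ • (laplacian (p.a₁₁ • W.u.fn + p.a₁₂ • W.v.fn)
    - p.κ • (W.u.fn - W.v.fn) - p.c • ∫ ξ : ℝ, p.μ ξ • W.φ₁ ξ) := rfl
  have e₄ : (p.op W).V = p.ρ₂⁻¹ • (laplacian (p.a₁₂ • W.u.fn + p.a₂₂ • W.v.fn)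
    + p.κ • (W.u.fn - W.v.fn) - p.c • ∫ ξ : ℝ, p.μ ξ • W.φ₂ ξ) := rfl
  have e₅ : (p.op W).φ₁ = p.diffusionLp W.φ₁ W.U := rfl
  have e₆ : (p.op W).φ₂ = p.diffusionLp W.φ₂ W.V := rfl
  rw [p.energyForm_apply, p.elasticForm_symm, p.elasticForm_apply, Finset.sum_add_distrib,
    Coeffs.dissipation]
  simp only [e₁, e₂, e₃, e₄, e₅, e₆, toH10_fn hW.memH10_U, toH10_fn hW.memH10_V, h1, h2,
    p.inner_diffusionLp hW.integrable₁ hW.memLp_mul₁ hW.memLp_diffusion₁,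
    p.inner_diffusionLp hW.integrable₂ hW.memLp_mul₂ hW.memLp_diffusion₂,
    real_inner_smul_left, inner_sub_left, inner_add_left, inner_sub_right]
  field_simp
  ring

/-- The elliptic system of the resolvent equation. -/
theorem Coeffs.Admissible.exists_elastic_eq [NeZero n] (hp : p.Admissible)
    (hΩ : IsSmoothBoundedDomain Ω) {s t : ℝ} (hs : 0 ≤ s) (ht : 0 ≤ t) (f g : L2 Ω) :
    ∃ u v : H10 Ω, MemH2 (p.a₁₁ • u.fn + p.a₁₂ • v.fn) ∧
      MemH2 (p.a₁₂ • u.fn + p.a₂₂ • v.fn) ∧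
      laplacian (p.a₁₁ • u.fn + p.a₁₂ • v.fn) = p.κ • (u.fn - v.fn) + s • u.fn - f ∧
      laplacian (p.a₁₂ • u.fn + p.a₂₂ • v.fn) = -(p.κ • (u.fn - v.fn)) + t • v.fn - g := by
  let fnU := H10.fnL ∘L ContinuousLinearMap.fst ℝ (H10 Ω) (H10 Ω)
  let fnV := H10.fnL ∘L ContinuousLinearMap.snd ℝ (H10 Ω) (H10 Ω)
  have hE := ((hp.isEnergyForm_elasticForm hΩ.isBounded).add_innerForm fnU hs).add_innerForm fnV ht
  obtain ⟨⟨u, v⟩, hx⟩ := hE.exists_repr ((innerSL ℝ f ∘L fnU) + (innerSL ℝ g ∘L fnV))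
  have h : ∀ y : H10 Ω × H10 Ω, p.elasticForm Ω (u, v) y + s * inner ℝ u.fn y.1.fn
      + t * inner ℝ v.fn y.2.fn = inner ℝ f y.1.fn + inner ℝ g y.2.fn := hx
  have e2 : (0 : H10 Ω).fn = 0 := rfl
  have e3 : ∀ i, (0 : H10 Ω).grad i = 0 := fun i => rfl
  -- Testing with pairs `(φ, 0)` decouples the principal part: this combination solves a scalar
  -- Poisson equation, so no regularity theory for systems is needed.
  have hz₁ : IsWeakSol (p.a₁₁ • u + p.a₁₂ • v) (f - p.κ • (u.fn - v.fn) - s • u.fn) :=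
    fun φ hφ => by
      have h1 := h (hφ.toH10, 0)
      have e1 : (hφ.toH10).fn = hφ.toL2 := rfl
      have e4 : ∀ i, (hφ.toH10).grad i = (hφ.pderiv i).toL2 := fun i => rfl
      rw [p.elasticForm_apply] at h1
      simp only [e1, e2, e3, e4, inner_zero_right, add_zero, sub_zero, mul_zero] at h1
      rw [inner_sub_left, inner_sub_left, real_inner_smul_left, real_inner_smul_left]
      linarith
  have hz₂ : IsWeakSol (p.a₁₂ • u + p.a₂₂ • v) (g + p.κ • (u.fn - v.fn) - t • v.fn) :=
    fun φ hφ => by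
      have h1 := h (0, hφ.toH10)
      have e1 : (hφ.toH10).fn = hφ.toL2 := rfl
      have e4 : ∀ i, (hφ.toH10).grad i = (hφ.pderiv i).toL2 := fun i => rfl
      rw [p.elasticForm_apply] at h1
      simp only [e1, e2, e3, e4, inner_zero_right, add_zero, zero_add, zero_sub, mul_zero,
        inner_neg_right] at h1
      rw [inner_sub_left, inner_add_left, real_inner_smul_left, real_inner_smul_left]
      linarith
  exact ⟨u, v, hz₁.memH2 hΩ, hz₂.memH2 hΩ, (hz₁.laplacian_eq hΩ).trans (by module),
    (hz₂.laplacian_eq hΩ).trans (by module)⟩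

/-- Put `U = r u - F.u` and `V = r v - F.v` and insert the affine memory integrals. The system left
for `u, v` has zeroth order coefficients `r (r ρⱼ + c mⱼ)`, nonnegative because the slopes `mⱼ` are.
-/
theorem Coeffs.Admissible.exists_op_eq [NeZero n] (hp : p.Admissible)
    (hΩ : IsSmoothBoundedDomain Ω) {r : ℝ} (hr : 0 < r) (F : Phase Ω) :
    ∃ W, p.MemDomain W ∧ r • W - p.op W = F := by
  obtain ⟨m₁, k₁, hm₁, H₁⟩ := hp.exists_diffusion hr F.φ₁
  obtain ⟨m₂, k₂, hm₂, H₂⟩ := hp.exists_diffusion hr F.φ₂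
  have hρ₁ := hp.ρ₁_pos
  have hρ₂ := hp.ρ₂_pos
  have hc := hp.c_pos
  obtain ⟨u, v, hz₁, hz₂, L₁, L₂⟩ := hp.exists_elastic_eq hΩ
    (s := r * (r * p.ρ₁ + p.c * m₁)) (t := r * (r * p.ρ₂ + p.c * m₂))
    (by positivity) (by positivity)
    (p.ρ₁ • F.U + (r * p.ρ₁ + p.c * m₁) • F.u.fn - p.c • k₁)
    (p.ρ₂ • F.V + (r * p.ρ₂ + p.c * m₂) • F.v.fn - p.c • k₂)
  obtain ⟨φ₁, i₁, l₁, d₁, q₁, s₁⟩ := H₁ (r • u - F.u).fn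
  obtain ⟨φ₂, i₂, l₂, d₂, q₂, s₂⟩ := H₂ (r • v - F.v).fn
  refine ⟨(u, v, (r • u - F.u).fn, (r • v - F.v).fn, φ₁, φ₂),
    ⟨⟨r • u - F.u, rfl⟩, ⟨r • v - F.v, rfl⟩, hz₁, hz₂, i₁, i₂, l₁, l₂, d₁, d₂⟩, ?_⟩
  have f₁ : (r • u - F.u).fn = r • u.fn - F.u.fn := rfl
  have f₂ : (r • v - F.v).fn = r • v.fn - F.v.fn := rfl
  refine Prod.ext ?_ (Prod.ext ?_ (Prod.ext ?_ (Prod.ext ?_ (Prod.ext q₁ q₂))))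
  · change r • u - toH10 (r • u - F.u).fn = F.u
    rw [toH10_eq hΩ.isOpen rfl, sub_sub_cancel]
  · change r • v - toH10 (r • v - F.v).fn = F.v
    rw [toH10_eq hΩ.isOpen rfl, sub_sub_cancel]
  · change r • (r • u - F.u).fn - p.ρ₁⁻¹ • (laplacian (p.a₁₁ • u.fn + p.a₁₂ • v.fn)
      - p.κ • (u.fn - v.fn) - p.c • ∫ ξ : ℝ, p.μ ξ • φ₁ ξ) = F.U
    refine smul_right_injective _ hρ₁.ne' ?_
    dsimp only
    rw [smul_sub, smul_inv_smul₀ hρ₁.ne', L₁, s₁, f₁]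
    module
  · change r • (r • v - F.v).fn - p.ρ₂⁻¹ • (laplacian (p.a₁₂ • u.fn + p.a₂₂ • v.fn)
      + p.κ • (u.fn - v.fn) - p.c • ∫ ξ : ℝ, p.μ ξ • φ₂ ξ) = F.V
    refine smul_right_injective _ hρ₂.ne' ?_
    dsimp only
    rw [smul_sub, smul_inv_smul₀ hρ₂.ne', L₂, s₂, f₂]
    module

theorem Coeffs.Admissible.dissipation_nonneg (hp : p.Admissible) (W : Phase Ω) :
    0 ≤ p.dissipation W := by
  have hη := hp.η_nonneg
  have hc := hp.c_pos
  have h : ∀ φ : L2L2 Ω, 0 ≤ ∫ ξ : ℝ, (ξ ^ 2 + p.η) * ‖φ ξ‖ ^ 2 := fun φ =>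
    integral_nonneg fun ξ => by positivity
  exact add_nonneg (mul_nonneg hc.le (h _)) (mul_nonneg hc.le (h _))

theorem Coeffs.Admissible.isMaxDissipative [NeZero n] (hp : p.Admissible)
    (hΩ : IsSmoothBoundedDomain Ω) :
    IsMaxDissipative (p.energyForm Ω) (p.domain hΩ.isOpen) p.op where
  map_add _ hx _ hy := Coeffs.op_add hΩ.isOpen hx hy
  map_smul c _ hx := Coeffs.op_smul hΩ.isOpen c hx
  form_nonpos x hx := by
    rw [hp.energyForm_op hΩ.isOpen hx]
    exact neg_nonpos.2 (hp.dissipation_nonneg x)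
  range_eq _ hr F := hp.exists_op_eq hΩ hr F

theorem Coeffs.isMildSolution_iff (hΩ : IsOpen Ω) {W₀ : Phase Ω} {W : ℝ → Phase Ω} :
    p.IsMildSolution W₀ W ↔ IsMild (p.domain hΩ) p.op W₀ W :=
  ⟨fun h => ⟨h.1, h.2, h.3⟩, fun h => ⟨h.1, h.2, h.3⟩⟩

theorem Coeffs.isStrongSolution_iff (hΩ : IsOpen Ω) {W₀ : Phase Ω} {W : ℝ → Phase Ω} :
    p.IsStrongSolution W₀ W ↔ IsStrong (p.domain hΩ) p.op W₀ W :=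
  ⟨fun h => ⟨h.1, h.2, h.3, h.4, h.5⟩, fun h => ⟨h.1, h.2, h.3, h.4, h.5⟩⟩

end Operator

/-! ### The energy law -/

section EnergyLaw

open scoped ENNReal NNReal

variable {X : Type*} [NormedAddCommGroup X] [NormedSpace ℝ X]

/-- `d` is a lower semicontinuous extension of the dissipation `-B (A x) x` to the whole space. -/
structure IsDissipation (B : X →L[ℝ] X →L[ℝ] ℝ) (D : Submodule ℝ X) (A : X → X)
    (d : X → ℝ≥0∞) : Prop where
  lowerSemicontinuous : LowerSemicontinuous d
  add_le : ∀ (ε : ℝ≥0), 0 < ε → ∀ x y, d (x + y) ≤ (1 + ε) * d x + (1 + (ε⁻¹ : ℝ≥0)) * d y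
  eq_ofReal : ∀ x ∈ D, d x = ENNReal.ofReal (-B (A x) x)

variable {B : X →L[ℝ] X →L[ℝ] ℝ} {D : Submodule ℝ X} {A : X → X} {d : X → ℝ≥0∞}

theorem IsEnergyForm.hasDerivWithinAt_form (hB : IsEnergyForm B) {x₀ : X} {W : ℝ → X} (hW : IsStrong D A x₀ W)
    {t : ℝ} (ht : 0 ≤ t) :
    HasDerivWithinAt (fun t => 1 / 2 * B (W t) (W t)) (B (A (W t)) (W t)) (Ici 0) t := by
  have h1 := ((B.hasFDerivAt.comp_hasDerivWithinAt t (hW.hasDeriv t ht)).clm_apply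
    (hW.hasDeriv t ht)).const_mul (1 / 2 : ℝ)
  refine h1.congr_deriv ?_
  simp only [Function.comp_apply, hB.symm (W t) (A (W t))]
  ring

theorem IsDissipation.aemeasurable (hd : IsDissipation B D A d) {W : ℝ → X}
    (hW : ContinuousOn W (Ici 0)) (t : ℝ) :
    AEMeasurable (fun s => d (W s)) (volume.restrict (Ioc 0 t)) := by
  have hc : Continuous fun s => W (max s 0) :=
    hW.comp_continuous (by fun_prop) fun s => mem_Ici.2 (le_max_right _ _)
  refine (hd.lowerSemicontinuous.comp hc).measurable.aemeasurable.congr ?_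
  filter_upwards [ae_restrict_mem measurableSet_Ioc] with s hs
  simp only [Function.comp_apply, max_eq_left hs.1.le]

namespace IsMaxDissipative

theorem lintegral_dissipation_of_isStrong (hA : IsMaxDissipative B D A) (hB : IsEnergyForm B)
    (hd : IsDissipation B D A d) {x₀ : X} {W : ℝ → X} (hW : IsStrong D A x₀ W) {t : ℝ}
    (ht : 0 ≤ t) : ∫⁻ s in Ioc 0 t, d (W s)
      = ENNReal.ofReal (1 / 2 * B x₀ x₀ - 1 / 2 * B (W t) (W t)) := by
  have hc : ContinuousOn (fun s => B (A (W s)) (W s)) (Ici 0) :=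
    (B.continuous.comp_continuousOn hW.continuousOn_op).clm_apply hW.continuousOn
  have h1 := integral_eq_sub_of_hasDerivWithinAt_Ici
    (fun s hs => hB.hasDerivWithinAt_form hW hs) hc ht
  have h2 : IntegrableOn (fun s => -B (A (W s)) (W s)) (Ioc 0 t) :=
    (intervalIntegrable_iff_integrableOn_Ioc_of_le ht).1
      (intervalIntegrable_of_continuousOn_Ici hc.neg ht)
  rw [hW.initial, intervalIntegral.integral_of_le ht] at h1
  rw [← neg_sub, ← h1, ← integral_neg, ofReal_integral_eq_lintegral_ofReal h2]
  · exact setLIntegral_congr_fun measurableSet_Ioc fun s hs => hd.eq_ofReal _ (hW.mem s hs.1.le)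
  · filter_upwards [ae_restrict_mem measurableSet_Ioc] with s hs
    exact neg_nonneg.2 (hA.form_nonpos _ (hW.mem s hs.1.le))

variable [CompleteSpace X]

/-- The law is exact for the strong solutions `J k (W ·)`. Lower semicontinuity and Fatou's lemma
keep one inequality in the limit. -/
theorem lintegral_dissipation_le (hA : IsMaxDissipative B D A) (hB : IsEnergyForm B)
    (hd : IsDissipation B D A d) {x₀ : X} {W : ℝ → X} (hW : IsMild D A x₀ W) {t : ℝ}
    (ht : 0 ≤ t) : ∫⁻ s in Ioc 0 t, d (W s)
      ≤ ENNReal.ofReal (1 / 2 * B x₀ x₀ - 1 / 2 * B (W t) (W t)) := by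
  obtain ⟨J, hJ⟩ := hA.exists_isYosida hB
  have hc : Continuous fun x => 1 / 2 * B x x := by fun_prop
  have hlim : Tendsto (fun k => ENNReal.ofReal
      (1 / 2 * B (J k x₀) (J k x₀) - 1 / 2 * B (J k (W t)) (J k (W t)))) atTop
      (𝓝 (ENNReal.ofReal (1 / 2 * B x₀ x₀ - 1 / 2 * B (W t) (W t)))) :=
    ENNReal.tendsto_ofReal (((hc.tendsto _).comp (hJ.tendsto hA hB x₀)).sub
      ((hc.tendsto _).comp (hJ.tendsto hA hB (W t))))
  calc ∫⁻ s in Ioc 0 t, d (W s)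
      ≤ ∫⁻ s in Ioc 0 t, liminf (fun k => d (J k (W s))) atTop := lintegral_mono fun s =>
        (hd.lowerSemicontinuous.le_liminf _).trans
          (liminf_le_liminf_of_le (hJ.tendsto hA hB (W s)))
    _ ≤ liminf (fun k => ∫⁻ s in Ioc 0 t, d (J k (W s))) atTop :=
        lintegral_liminf_le' fun k =>
          hd.aemeasurable (hJ.isStrong hW k).continuousOn t
    _ = _ := by
        simp only [fun k => hA.lintegral_dissipation_of_isStrong hB hd (hJ.isStrong hW k) ht]
        exact hlim.liminf_eq

/-- For the reverse inequality, the one already known bounds the total dissipation of `J k (W ·) -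
W` by its initial energy, which tends to zero. The weighted triangle inequality `add_le` transfers
this to `J k (W ·)`: first `k → ∞` with `ε` fixed, then `ε → 0`. -/
theorem lintegral_dissipation (hA : IsMaxDissipative B D A) (hB : IsEnergyForm B)
    (hd : IsDissipation B D A d) {x₀ : X} {W : ℝ → X} (hW : IsMild D A x₀ W) {t : ℝ}
    (ht : 0 ≤ t) : ∫⁻ s in Ioc 0 t, d (W s)
      = ENNReal.ofReal (1 / 2 * B x₀ x₀ - 1 / 2 * B (W t) (W t)) := by
  refine (hA.lintegral_dissipation_le hB hd hW ht).antisymm ?_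
  obtain ⟨J, hJ⟩ := hA.exists_isYosida hB
  have hc : Continuous fun x => 1 / 2 * B x x := by fun_prop
  have hlim : Tendsto (fun k => ENNReal.ofReal
      (1 / 2 * B (J k x₀) (J k x₀) - 1 / 2 * B (J k (W t)) (J k (W t)))) atTop
      (𝓝 (ENNReal.ofReal (1 / 2 * B x₀ x₀ - 1 / 2 * B (W t) (W t)))) :=
    ENNReal.tendsto_ofReal (((hc.tendsto _).comp (hJ.tendsto hA hB x₀)).sub
      ((hc.tendsto _).comp (hJ.tendsto hA hB (W t))))
  have herr : Tendsto (fun k => ENNReal.ofReal (1 / 2 * B (J k x₀ - x₀) (J k x₀ - x₀))) atTop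
      (𝓝 0) := by
    have h := (hJ.tendsto hA hB x₀).sub_const x₀
    rw [sub_self] at h
    simpa using ENNReal.tendsto_ofReal ((hc.tendsto 0).comp h)
  have hle : ∀ (ε : ℝ≥0), 0 < ε → ∀ k, ENNReal.ofReal
      (1 / 2 * B (J k x₀) (J k x₀) - 1 / 2 * B (J k (W t)) (J k (W t)))
      ≤ (1 + ε) * (∫⁻ s in Ioc 0 t, d (W s))
        + (1 + (ε⁻¹ : ℝ≥0)) * ENNReal.ofReal (1 / 2 * B (J k x₀ - x₀) (J k x₀ - x₀)) :=
    fun ε hε k => by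
      have hS := hJ.isStrong hW k
      have hM := hA.isMild_sub (hA.isMild_of_isStrong hB hS) hW
      have h1 : ∫⁻ s in Ioc 0 t, d (J k (W s) - W s)
          ≤ ENNReal.ofReal (1 / 2 * B (J k x₀ - x₀) (J k x₀ - x₀)) :=
        (hA.lintegral_dissipation_le hB hd hM ht).trans
          (ENNReal.ofReal_le_ofReal (by linarith [hB.nonneg (J k (W t) - W t)]))
      rw [← hA.lintegral_dissipation_of_isStrong hB hd hS ht]
      calc ∫⁻ s in Ioc 0 t, d (J k (W s))
          ≤ ∫⁻ s in Ioc 0 t, ((1 + ε) * d (W s) + (1 + (ε⁻¹ : ℝ≥0)) * d (J k (W s) - W s)) :=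
            lintegral_mono fun s => by
              simpa using hd.add_le ε hε (W s) (J k (W s) - W s)
        _ = (1 + ε) * (∫⁻ s in Ioc 0 t, d (W s))
            + (1 + (ε⁻¹ : ℝ≥0)) * ∫⁻ s in Ioc 0 t, d (J k (W s) - W s) := by
            rw [lintegral_add_left' ((hd.aemeasurable hW.continuousOn t).const_mul _),
              lintegral_const_mul'' _ (hd.aemeasurable hW.continuousOn t),
              lintegral_const_mul'' _ (hd.aemeasurable hM.continuousOn t)]
        _ ≤ _ := by gcongr
  have hle' : ∀ (ε : ℝ≥0), 0 < ε → ENNReal.ofReal (1 / 2 * B x₀ x₀ - 1 / 2 * B (W t) (W t))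
      ≤ (1 + ε) * (∫⁻ s in Ioc 0 t, d (W s)) := fun ε hε => by
    have h1 := (ENNReal.Tendsto.const_mul herr (a := 1 + (ε⁻¹ : ℝ≥0)) (Or.inr (by finiteness))).const_add
      ((1 + ε) * (∫⁻ s in Ioc 0 t, d (W s)))
    rw [mul_zero, add_zero] at h1
    exact le_of_tendsto_of_tendsto' hlim h1 (hle ε hε)
  have hε : Tendsto (fun ε : ℝ≥0 => (1 + (ε : ℝ≥0∞)) * (∫⁻ s in Ioc 0 t, d (W s))) (𝓝[>] 0)
      (𝓝 ((1 + ((0 : ℝ≥0) : ℝ≥0∞)) * (∫⁻ s in Ioc 0 t, d (W s)))) :=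
    ENNReal.Tendsto.mul_const ((ENNReal.tendsto_coe.2
      (tendsto_id.mono_left nhdsWithin_le_nhds)).const_add 1) (Or.inl (by simp))
  rw [ENNReal.coe_zero, add_zero, one_mul] at hε
  exact ge_of_tendsto hε (by filter_upwards [self_mem_nhdsWithin] with ε h using hle' ε h)

end IsMaxDissipative

end EnergyLaw

/-! ### The dissipation of the system -/

section Dissipation

open scoped ENNReal NNReal

variable {n : ℕ} {Ω : Set (Space n)} {p : Coeffs}

/-- `∫ w(ξ) ‖φ(ξ)‖² dξ` as an extended number. -/
def weightedSq (w : ℝ → ℝ≥0∞) (φ : L2L2 Ω) : ℝ≥0∞ := ∫⁻ ξ : ℝ, w ξ * ‖φ ξ‖ₑ ^ 2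

/-- Sublevel sets are sequentially closed: a sequence converging in `L²` has an almost everywhere
convergent subsequence, to which Fatou's lemma applies. -/
theorem lowerSemicontinuous_weightedSq {w : ℝ → ℝ≥0∞} (hw : Measurable w) (hw' : ∀ ξ, w ξ ≠ ⊤) :
    LowerSemicontinuous (weightedSq w : L2L2 Ω → ℝ≥0∞) := by
  refine lowerSemicontinuous_iff_isClosed_preimage.2 fun y => IsSeqClosed.isClosed ?_
  intro φ ψ hφ hlim
  obtain ⟨ns, -, hns⟩ := (tendstoInMeasure_of_tendsto_Lp hlim).exists_seq_tendsto_ae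
  have hm : ∀ φ : L2L2 Ω, AEMeasurable (fun ξ => w ξ * ‖φ ξ‖ₑ ^ 2) volume := fun φ =>
    hw.aemeasurable.mul ((Lp.aestronglyMeasurable φ).enorm.pow_const 2)
  calc weightedSq w ψ ≤ ∫⁻ ξ, liminf (fun k => w ξ * ‖φ (ns k) ξ‖ₑ ^ 2) atTop := by
        refine lintegral_mono_ae ?_
        filter_upwards [hns] with ξ hξ
        exact (ENNReal.Tendsto.const_mul (ENNReal.Tendsto.pow hξ.enorm)
          (Or.inr (hw' ξ))).liminf_eq.ge
    _ ≤ liminf (fun k => ∫⁻ ξ, w ξ * ‖φ (ns k) ξ‖ₑ ^ 2) atTop :=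
        lintegral_liminf_le' fun k => hm _
    _ ≤ y := liminf_le_of_le (by isBoundedDefault) fun b hb => by
        obtain ⟨k, hk⟩ := hb.exists
        exact hk.trans (hφ (ns k))

/-- Young's inequality `2 s t ≤ ε s² + ε⁻¹ t²` for the cross term. -/
theorem enorm_add_sq_le {F : Type*} [NormedAddCommGroup F] {ε : ℝ≥0} (hε : 0 < ε) (a b : F) :
    ‖a + b‖ₑ ^ 2 ≤ (1 + ε) * ‖a‖ₑ ^ 2 + (1 + (ε⁻¹ : ℝ≥0)) * ‖b‖ₑ ^ 2 := by
  have h : ‖a + b‖₊ ^ 2 ≤ (1 + ε) * ‖a‖₊ ^ 2 + (1 + ε⁻¹) * ‖b‖₊ ^ 2 := by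
    rw [← NNReal.coe_le_coe]
    push_cast
    have h1 : ‖a + b‖ ^ 2 ≤ (‖a‖ + ‖b‖) ^ 2 := pow_le_pow_left₀ (norm_nonneg _) (norm_add_le a b) 2
    have hε' : (0 : ℝ) < ε := hε
    have h2 : 0 ≤ (ε : ℝ)⁻¹ * (ε * ‖a‖ - ‖b‖) ^ 2 := by positivity
    have h3 : (ε : ℝ)⁻¹ * (ε * ‖a‖ - ‖b‖) ^ 2
        = ε * ‖a‖ ^ 2 - 2 * ‖a‖ * ‖b‖ + (ε : ℝ)⁻¹ * ‖b‖ ^ 2 := by field_simp; ring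
    nlinarith
  simp only [enorm_eq_nnnorm]
  exact_mod_cast h

theorem weightedSq_add_le {w : ℝ → ℝ≥0∞} (hw : Measurable w) {ε : ℝ≥0} (hε : 0 < ε)
    (φ ψ : L2L2 Ω) : weightedSq w (φ + ψ)
      ≤ (1 + ε) * weightedSq w φ + (1 + (ε⁻¹ : ℝ≥0)) * weightedSq w ψ := by
  have hm : ∀ φ : L2L2 Ω, AEMeasurable (fun ξ => w ξ * ‖φ ξ‖ₑ ^ 2) volume := fun φ =>
    hw.aemeasurable.mul ((Lp.aestronglyMeasurable φ).enorm.pow_const 2)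
  rw [weightedSq, weightedSq, weightedSq, ← lintegral_const_mul'' _ (hm φ),
    ← lintegral_const_mul'' _ (hm ψ), ← lintegral_add_left' ((hm φ).const_mul _)]
  refine lintegral_mono_ae ?_
  filter_upwards [Lp.coeFn_add φ ψ] with ξ h
  rw [h, Pi.add_apply, mul_left_comm _ (w ξ), mul_left_comm _ (w ξ), ← mul_add]
  exact mul_le_mul_right (enorm_add_sq_le hε _ _) _

/-- The dissipation as an extended number. -/
def Coeffs.edissipation (p : Coeffs) (W : Phase Ω) : ℝ≥0∞ :=
  ENNReal.ofReal p.c * (weightedSq (fun ξ => ENNReal.ofReal (ξ ^ 2 + p.η)) W.φ₁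
    + weightedSq (fun ξ => ENNReal.ofReal (ξ ^ 2 + p.η)) W.φ₂)

theorem ofReal_weight_mul_sq {η : ℝ} (hη : 0 ≤ η) (φ : L2L2 Ω) (ξ : ℝ) :
    ENNReal.ofReal ((ξ ^ 2 + η) * ‖φ ξ‖ ^ 2) = ENNReal.ofReal (ξ ^ 2 + η) * ‖φ ξ‖ₑ ^ 2 := by
  rw [ENNReal.ofReal_mul (by positivity), ENNReal.ofReal_pow (norm_nonneg _), ofReal_norm]

theorem aestronglyMeasurable_weight_mul_sq (η : ℝ) (φ : L2L2 Ω) :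
    AEStronglyMeasurable (fun ξ : ℝ => (ξ ^ 2 + η) * ‖φ ξ‖ ^ 2) volume :=
  (by fun_prop : Continuous fun ξ : ℝ => ξ ^ 2 + η).aestronglyMeasurable.mul
    ((Lp.aestronglyMeasurable φ).norm.pow 2)

theorem integrable_weight_mul_sq_iff {η : ℝ} (hη : 0 ≤ η) (φ : L2L2 Ω) :
    Integrable (fun ξ : ℝ => (ξ ^ 2 + η) * ‖φ ξ‖ ^ 2) ↔
      weightedSq (fun ξ => ENNReal.ofReal (ξ ^ 2 + η)) φ ≠ ⊤ := by
  rw [Integrable, and_iff_right (aestronglyMeasurable_weight_mul_sq η φ),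
    hasFiniteIntegral_iff_ofReal (Eventually.of_forall fun ξ => by positivity), lt_top_iff_ne_top]
  simp only [ofReal_weight_mul_sq hη]
  rfl

theorem integral_weight_mul_sq {η : ℝ} (hη : 0 ≤ η) (φ : L2L2 Ω) :
    ∫ ξ : ℝ, (ξ ^ 2 + η) * ‖φ ξ‖ ^ 2
      = (weightedSq (fun ξ => ENNReal.ofReal (ξ ^ 2 + η)) φ).toReal := by
  rw [integral_eq_lintegral_of_nonneg_ae (Eventually.of_forall fun ξ => by positivity)
    (aestronglyMeasurable_weight_mul_sq η φ)]
  simp only [ofReal_weight_mul_sq hη]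
  rfl

theorem Coeffs.Admissible.finiteDissipation_iff (hp : p.Admissible) (W : Phase Ω) :
    p.FiniteDissipation W ↔ p.edissipation W ≠ ⊤ := by
  rw [Coeffs.FiniteDissipation, integrable_weight_mul_sq_iff hp.η_nonneg,
    integrable_weight_mul_sq_iff hp.η_nonneg, Coeffs.edissipation, ← ENNReal.add_ne_top]
  refine ⟨fun h => ENNReal.mul_ne_top ENNReal.ofReal_ne_top h, fun h h' => h ?_⟩
  rw [h', ENNReal.mul_top (ENNReal.ofReal_pos.2 hp.c_pos).ne']

/-- Finiteness is essential: the Bochner integrals in `dissipation` are zero when they diverge, so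
only there do the two notions have to agree. -/
theorem Coeffs.Admissible.toReal_edissipation (hp : p.Admissible) {W : Phase Ω}
    (h : p.FiniteDissipation W) : (p.edissipation W).toReal = p.dissipation W := by
  rw [Coeffs.dissipation, integral_weight_mul_sq hp.η_nonneg, integral_weight_mul_sq hp.η_nonneg,
    Coeffs.edissipation, ENNReal.toReal_mul, ENNReal.toReal_ofReal hp.c_pos.le, ENNReal.toReal_add
      ((integrable_weight_mul_sq_iff hp.η_nonneg _).1 h.1)
      ((integrable_weight_mul_sq_iff hp.η_nonneg _).1 h.2), mul_add]

theorem Coeffs.Admissible.isDissipation (hp : p.Admissible) (hΩ : IsOpen Ω) :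
    IsDissipation (p.energyForm Ω) (p.domain hΩ) p.op p.edissipation where
  lowerSemicontinuous := by
    have h : LowerSemicontinuous
        (weightedSq fun ξ => ENNReal.ofReal (ξ ^ 2 + p.η) : L2L2 Ω → ℝ≥0∞) :=
      lowerSemicontinuous_weightedSq (by fun_prop) fun _ => ENNReal.ofReal_ne_top
    exact (ENNReal.continuous_const_mul ENNReal.ofReal_ne_top).comp_lowerSemicontinuous
      ((h.comp (by fun_prop : Continuous fun W : Phase Ω => W.φ₁)).add
        (h.comp (by fun_prop : Continuous fun W : Phase Ω => W.φ₂))) fun _ _ h => mul_le_mul_right h _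
  add_le ε hε W Z := by
    have h := fun φ ψ : L2L2 Ω => weightedSq_add_le
      (w := fun ξ => ENNReal.ofReal (ξ ^ 2 + p.η)) (by fun_prop) hε φ ψ
    refine (mul_le_mul_right (add_le_add (h W.φ₁ Z.φ₁) (h W.φ₂ Z.φ₂)) _).trans_eq ?_
    rw [Coeffs.edissipation, Coeffs.edissipation]
    ring
  eq_ofReal W hW := by
    have h := Coeffs.MemDomain.finiteDissipation hW
    rw [hp.energyForm_op hΩ hW, neg_neg, ← hp.toReal_edissipation h,
      ENNReal.ofReal_toReal ((hp.finiteDissipation_iff W).1 h)]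

theorem Coeffs.Admissible.energy_law_strong [NeZero n] (hp : p.Admissible)
    (hΩ : IsSmoothBoundedDomain Ω) {W₀ : Phase Ω} {W : ℝ → Phase Ω} (hW : p.IsStrongSolution W₀ W)
    {t : ℝ} (ht : 0 ≤ t) : p.FiniteDissipation (W t) ∧
      HasDerivWithinAt (fun s => p.energy (W s)) (-p.dissipation (W t)) (Ici 0) t := by
  refine ⟨(hW.mem t ht).finiteDissipation, ?_⟩
  rw [← hp.energyForm_op hΩ.isOpen (hW.mem t ht)]
  simp only [Coeffs.energy_eq]
  exact (hp.isEnergyForm hΩ.isBounded).hasDerivWithinAt_form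
    ((Coeffs.isStrongSolution_iff hΩ.isOpen).1 hW) ht

theorem Coeffs.Admissible.energy_law_mild [NeZero n] (hp : p.Admissible)
    (hΩ : IsSmoothBoundedDomain Ω) {W₀ : Phase Ω} {W : ℝ → Phase Ω} (hW : p.IsMildSolution W₀ W)
    {t : ℝ} (ht : 0 ≤ t) : (∀ᵐ s ∂(volume.restrict (Ioc 0 t)), p.FiniteDissipation (W s)) ∧
      IntervalIntegrable (fun s => p.dissipation (W s)) volume 0 t ∧
      p.energy (W t) = p.energy W₀ - ∫ s in (0 : ℝ)..t, p.dissipation (W s) := by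
  have hA := hp.isMaxDissipative hΩ
  have hB := hp.isEnergyForm hΩ.isBounded
  have hd := hp.isDissipation hΩ.isOpen
  have hM := (Coeffs.isMildSolution_iff hΩ.isOpen).1 hW
  have hm := hd.aemeasurable hM.continuousOn t
  have hI := hA.lintegral_dissipation hB hd hM ht
  have hfin : ∫⁻ s in Ioc 0 t, p.edissipation (W s) ≠ ⊤ := by
    rw [hI]
    exact ENNReal.ofReal_ne_top
  have hlt := ae_lt_top' hm hfin
  have hF : ∀ᵐ s ∂(volume.restrict (Ioc 0 t)), p.FiniteDissipation (W s) :=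
    hlt.mono fun s hs => (hp.finiteDissipation_iff _).2 hs.ne
  have hae : (fun s => (p.edissipation (W s)).toReal) =ᵐ[volume.restrict (Ioc 0 t)]
      fun s => p.dissipation (W s) := hF.mono fun s hs => hp.toReal_edissipation hs
  refine ⟨hF, (intervalIntegrable_iff_integrableOn_Ioc_of_le ht).2
    ((integrable_toReal_of_lintegral_ne_top hm hfin).congr hae), ?_⟩
  have hle := hA.form_le_of_isMild hB hM ht
  rw [intervalIntegral.integral_of_le ht, ← integral_congr_ae hae, integral_toReal hm hlt, hI,
    ENNReal.toReal_ofReal (by linarith), p.energy_eq, p.energy_eq]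
  ring

theorem Coeffs.Admissible.ae_finiteDissipation [NeZero n] (hp : p.Admissible)
    (hΩ : IsSmoothBoundedDomain Ω) {W₀ : Phase Ω} {W : ℝ → Phase Ω}
    (hW : p.IsMildSolution W₀ W) :
    ∀ᵐ s ∂(volume.restrict (Ici (0 : ℝ))), p.FiniteDissipation (W s) := by
  rw [← restrict_Ioi_eq_restrict_Ici]
  have hU : Ioi (0 : ℝ) = ⋃ N : ℕ, Ioc 0 (N : ℝ) := by
    ext s
    simp only [mem_Ioi, mem_iUnion, mem_Ioc, exists_and_left]
    exact ⟨fun h => ⟨h, exists_nat_ge s⟩, fun h => h.1⟩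
  rw [hU, ae_restrict_iUnion_iff]
  exact fun N => (hp.energy_law_mild hΩ hW N.cast_nonneg).1

end Dissipation

end MixtureSystem

end

/-! ### Assembly of the well-posedness theorem -/

theorem mainTheorem4 {n : ℕ} [NeZero n] (Ω : Set (MixtureSystem.Space n))
    (hΩ : MixtureSystem.IsSmoothBoundedDomain Ω)
    (p : MixtureSystem.Coeffs) (hp : p.Admissible) :
    -- existence and uniqueness for data in the phase space
    (∀ W₀ : MixtureSystem.Phase Ω, ∃ W : ℝ → MixtureSystem.Phase Ω, p.IsMildSolution W₀ W ∧
      ∀ W' : ℝ → MixtureSystem.Phase Ω, p.IsMildSolution W₀ W' → Set.EqOn W' W (Set.Ici 0)) ∧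
    -- existence and uniqueness for data in the domain of the operator
    (∀ W₀ : MixtureSystem.Phase Ω, p.MemDomain W₀ →
      ∃ W : ℝ → MixtureSystem.Phase Ω, p.IsStrongSolution W₀ W ∧
        ∀ W' : ℝ → MixtureSystem.Phase Ω, p.IsStrongSolution W₀ W' →
          Set.EqOn W' W (Set.Ici 0)) ∧
    -- strong solutions are mild solutions
    (∀ (W₀ : MixtureSystem.Phase Ω) (W : ℝ → MixtureSystem.Phase Ω),
      p.IsStrongSolution W₀ W → p.IsMildSolution W₀ W) ∧
    -- continuous dependence: the solution map is a contraction for the energy norm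
    (∀ (W₀ Z₀ : MixtureSystem.Phase Ω) (W Z : ℝ → MixtureSystem.Phase Ω),
      p.IsMildSolution W₀ W → p.IsMildSolution Z₀ Z →
        ∀ t : ℝ, 0 ≤ t → p.energy (W t - Z t) ≤ p.energy (W₀ - Z₀)) ∧
    -- energy law for strong solutions
    (∀ (W₀ : MixtureSystem.Phase Ω) (W : ℝ → MixtureSystem.Phase Ω), p.IsStrongSolution W₀ W →
      ∀ t : ℝ, 0 ≤ t → p.FiniteDissipation (W t) ∧
        HasDerivWithinAt (fun s => p.energy (W s)) (-p.dissipation (W t)) (Set.Ici 0) t) ∧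
    -- energy law for mild solutions, integrated in time
    (∀ (W₀ : MixtureSystem.Phase Ω) (W : ℝ → MixtureSystem.Phase Ω), p.IsMildSolution W₀ W →
      (∀ᵐ s ∂(MeasureTheory.volume.restrict (Set.Ici (0 : ℝ))), p.FiniteDissipation (W s)) ∧
      ∀ t : ℝ, 0 ≤ t →
        IntervalIntegrable (fun s => p.dissipation (W s)) MeasureTheory.volume 0 t ∧
        p.energy (W t) = p.energy W₀ - ∫ s in (0 : ℝ)..t, p.dissipation (W s)) := by
  have hA := hp.isMaxDissipative hΩ
  have hB := hp.isEnergyForm hΩ.isBounded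
  simp only [MixtureSystem.Coeffs.isMildSolution_iff hΩ.isOpen,
    MixtureSystem.Coeffs.isStrongSolution_iff hΩ.isOpen]
  refine ⟨fun W₀ => ?_, fun W₀ hW₀ => ?_, fun W₀ W hW => hA.isMild_of_isStrong hB hW,
    fun W₀ Z₀ W Z hW hZ t ht => ?_, fun W₀ W hW t ht => ?_, fun W₀ W hW => ?_⟩
  · obtain ⟨W, hW⟩ := hA.exists_isMild hB W₀
    exact ⟨W, hW, fun W' hW' => hA.isMild_unique hB hW' hW⟩
  · obtain ⟨W, hW⟩ := hA.exists_isStrong hB (x₀ := W₀) hW₀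
    -- Strong solutions are mild, so their uniqueness is inherited.
    exact ⟨W, hW, fun W' hW' => hA.isMild_unique hB (hA.isMild_of_isStrong hB hW')
      (hA.isMild_of_isStrong hB hW)⟩
  · rw [p.energy_eq, p.energy_eq]
    have h := hA.form_le_of_isMild hB (hA.isMild_sub hW hZ) ht
    linarith
  · exact hp.energy_law_strong hΩ
      ((MixtureSystem.Coeffs.isStrongSolution_iff hΩ.isOpen).2 hW) ht
  · have hW' := (MixtureSystem.Coeffs.isMildSolution_iff hΩ.isOpen).2 hW
    exact ⟨hp.ae_finiteDissipation hΩ hW', fun t ht => (hp.energy_law_mild hΩ hW' ht).2⟩
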